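/- Fix $K$ layers with densities $\lambda_k>0$, transmission powers $P_k>0$, altitudes $h_k>0$ ($k\in\mathcal K=\{1,\dots,K\}$), parameters $a\ge 0$, $b\in\mathbb R$, pathloss exponents $\alpha^{(c)}\ge 2$ and integers $m^{(c)}\ge 1$ for the two link states $c\in\{\mathrm L,\mathrm N\}$ (line-of-sight and non-line-of-sight), noise power $\sigma^2\ge 0$ and target SINR $\beta>0$. For $x\ge h_k$ put $\rho_k^{(\mathrm L)}(x)=\bigl(1+a\exp(-b[\sin^{-1}(h_k/x)-a])\bigr)^{-1}$ and $\rho_k^{(\mathrm N)}=1-\rho_k^{(\mathrm L)}$. The nodes of layer $k$ are located at altitude $h_k$ above the points of a homogeneous Poisson point process of density $\lambda_k$ in the plane, independently for different layers; the receiver is at a point of the ground. Given all positions, the nodes independently have a link state $c$ and a channel gain $G$: a node of layer $k$ whose link to the receiver has length $x$ is in state $c$ with probability $\rho_k^{(c)}(x)$, and given this, $G\sim\Gamma(m^{(c)},1/m^{(c)})$ (shape, scale). Its average received power is $P_kx^{-\alpha^{(c)}}$ and its received power is $P_kGx^{-\alpha^{(c)}}$. The main link is that of the node with the largest average received power; $\mathcal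 I$ is $\sigma^2$ plus the sum of the received powers of all other nodes, possibly $\infty$; $\mathrm{SINR}$ is the received power of the main link divided by $\mathcal I$; and $\mathcal P=\mathbb P[\mathrm{SINR}>\beta]$ is the successful transmission probability. For $j,k\in\mathcal K$ and $c,c_o\in\{\mathrm L,\mathrm N\}$ put $R(y)=R_{j,k}^{(c,c_o)}(y)=(P_ky^{\alpha^{(c)}}/P_j)^{1/\alpha^{(c_o)}}$, $$\bar F_{V_k^{(c)}}(v)=\exp\Bigl[-\int_{h_k}^{\max(v,h_k)}2\pi\lambda_kx\rho_k^{(c)}(x)\,dx\Bigr],$$ $$f_{V_k^{(c)}}(v)=2\pi\lambda_kv\rho_k^{(c)}(v)\exp\Bigl[-\int_{h_k}^{v}2\pi\lambda_kx\rho_k^{(c)}(x)\,dx\Bigr]\ (v\ge h_k),\qquad f_{V_k^{(c)}}(v)=0\ (v<h_k),$$ $$\mathcal A_j^{(c)}=\int_0^\infty f_{V_j^{(c)}}(y)\prod_{(k,c_o)\ne(j,c)}\bar F_{V_k^{(c_o)}}(R_{j,k}^{(c,c_o)}(y))\,dy,\qquad f_{Y_j^{(c)}}(y)=\frac{f_{V_j^{(c)}}(y)}{\mathcal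 A_j^{(c)}}\prod_{(k,c_o)\ne(j,c)}\bar F_{V_k^{(c_o)}}(R_{j,k}^{(c,c_o)}(y))$$ (with $f_{Y_j^{(c)}}=0$ if $\mathcal A_j^{(c)}=0$), and $$\mathcal L_{j,y}^{(c)}(s)=e^{-s\sigma^2}\prod_{k\in\mathcal K,\;c_o\in\{\mathrm L,\mathrm N\}}\exp\Bigl[-2\pi\lambda_k\int_{\max(R(y),h_k)}^\infty x\rho_k^{(c_o)}(x)\Bigl(1-\Bigl(1+\tfrac{sP_kx^{-\alpha^{(c_o)}}}{m^{(c_o)}}\Bigr)^{-m^{(c_o)}}\Bigr)dx\Bigr]\quad(\exp(-\infty)=0),$$ $$p_j^{(c)}(y)=\sum_{n=0}^{m^{(c)}-1}\frac{(-s)^n}{n!}\frac{d^n}{ds^n}\mathcal L_{j,y}^{(c)}(s)\Big|_{s=m^{(c)}\beta y^{\alpha^{(c)}}/P_j}.$$ Then $$\mathcal P=\sum_{j\in\mathcal K,\;c\in\{\mathrm L,\mathrm N\}}\int_{h_j}^\infty p_j^{(c)}(y)\,f_{Y_j^{(c)}}(y)\,\mathcal A_j^{(c)}\,dy,$$ where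 the integrals converge absolutely. Here $\mathcal A_j^{(c)}$ is the probability that the main link belongs to layer $j$ and state $c$, and given this, its length has density $f_{Y_j^{(c)}}$ (on $(h_j,\infty)$, whenever $\mathcal A_j^{(c)}>0$); and given that the main link belongs to layer $j$, is in state $c$ and has length $y$, $p_j^{(c)}(y)$ is the conditional probability of $\mathrm{SINR}>\beta$ and $\mathcal L_{j,y}^{(c)}(s)$ is, for every $s\ge0$, the conditional expectation of $e^{-s\mathcal I}$ (with $e^{-0\cdot\infty}=1$); that is, these are versions of the conditional expectations, as functions of $y$. -/

import Mathlib

open MeasureTheory ProbabilityTheory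
open scoped ENNReal NNReal

noncomputable section

namespace AerialNetwork

/-- The state of a link: line-of-sight or non-line-of-sight. -/
inductive Channel where
  | los
  | nlos
  deriving DecidableEq

instance : Fintype Channel :=
  ⟨{Channel.los, Channel.nlos}, fun c => by cases c <;> simp⟩

/-- The ground plane, with the Euclidean norm. -/
abbrev Plane : Type := EuclideanSpace ℝ (Fin 2)

/-- A node is named by its layer and by its number within the layer. -/
abbrev Node (K : ℕ) : Type := Fin K × ℕ

/-- `exp (-t)` for an extended nonnegative real `t`, with `exp (-∞) = 0`. -/
def expNeg (t : ℝ≥0∞) : ℝ := if t = ∞ then 0 else Real.exp (-t.toReal)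

/-- The deterministic parameters of a `K`-layer aerial network and of its receiver. -/
structure Params (K : ℕ) where
  /-- densities of the layers -/
  lam : Fin K → ℝ
  /-- transmission powers of the layers -/
  P : Fin K → ℝ
  /-- altitudes of the layers -/
  h : Fin K → ℝ
  /-- environment parameters of the line-of-sight probability -/
  a : ℝ
  /-- environment parameters of the line-of-sight probability -/
  b : ℝ
  /-- pathloss exponents -/
  α : Channel → ℝ
  /-- Nakagami fading parameters -/
  m : Channel → ℕ
  /-- the noise power is `σ ^ 2` -/
  σ : ℝ
  /-- target SINR -/
  β : ℝ
  /-- position of the receiver on the ground -/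
  xrec : Plane
  lam_pos : ∀ k, 0 < lam k
  P_pos : ∀ k, 0 < P k
  h_pos : ∀ k, 0 < h k
  a_nonneg : 0 ≤ a
  two_le_α : ∀ c, 2 ≤ α c
  one_le_m : ∀ c, 1 ≤ m c
  β_pos : 0 < β

/-- Number of indices `i` with `X i ω ∈ A`. -/
def pointCount {Ω E : Type*} (X : ℕ → Ω → E) (A : Set E) (ω : Ω) : ℝ≥0∞ :=
  ∑' i, A.indicator (fun _ => (1 : ℝ≥0∞)) (X i ω)

/-- The random points `X 0, X 1, …` form a Poisson point process with intensity measure `ν`: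
the number of points in a measurable set of finite intensity is Poisson distributed, and the
numbers of points in disjoint measurable sets are independent. -/
structure IsPoissonProcess {Ω E : Type*} [MeasurableSpace Ω] [MeasurableSpace E]
    (X : ℕ → Ω → E) (ν : Measure E) (μ : Measure Ω) : Prop where
  measurable : ∀ i, Measurable (X i)
  law : ∀ A : Set E, MeasurableSet A → ν A ≠ ∞ →
    μ.map (pointCount X A) = (poissonMeasure (ν A).toNNReal).map (fun n : ℕ => (n : ℝ≥0∞))
  indep : ∀ (n : ℕ) (A : Fin n → Set E), (∀ l, MeasurableSet (A l)) →
    Pairwise (fun l l' => Disjoint (A l) (A l')) → iIndepFun (fun l => pointCount X (A l)) μ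

namespace Params

variable {K : ℕ} (N : Params K)

/-! ### The parameters of a link as functions of its length -/

/-- Line-of-sight probability of a link of length `x` to a node of layer `k`. -/
def rhoLoS (k : Fin K) (x : ℝ) : ℝ :=
  1 / (1 + N.a * Real.exp (-N.b * (Real.arcsin (N.h k / x) - N.a)))

/-- Probability that a link of length `x` to a node of layer `k` is in state `c`. -/
def rho (k : Fin K) : Channel → ℝ → ℝ
  | .los, x => N.rhoLoS k x
  | .nlos, x => 1 - N.rhoLoS k x

/-- Length of the link from a node of layer `k` above the ground point `z` to the receiver. -/
def linkDist (k : Fin K) (z : Plane) : ℝ := Real.sqrt (‖z - N.xrec‖ ^ 2 + N.h k ^ 2)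

/-- Law of the channel gain: the Gamma distribution of shape `m` and scale `1 / m`
(that is, of rate `m`). -/
def gainLaw (c : Channel) : Measure ℝ := gammaMeasure (N.m c : ℝ) (N.m c : ℝ)

/-! ### The closed-form quantities -/

/-- Complementary distribution function of the distance to the nearest node of layer `k` in
state `c`. -/
def ccdfV (k : Fin K) (c : Channel) (v : ℝ) : ℝ :=
  Real.exp (-∫ x in N.h k..max v (N.h k), 2 * Real.pi * N.lam k * x * N.rho k c x)

/-- Density of the distance to the nearest node of layer `k` in state `c`. -/
def pdfV (k : Fin K) (c : Channel) (v : ℝ) : ℝ :=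
  if v < N.h k then 0 else
    2 * Real.pi * N.lam k * v * N.rho k c v *
      Real.exp (-∫ x in N.h k..v, 2 * Real.pi * N.lam k * x * N.rho k c x)

/-- Length at which a link of layer `k` in state `co` has the same average received power as a
link of layer `j` in state `c` and of length `y`. -/
def radius (j : Fin K) (c : Channel) (k : Fin K) (co : Channel) (y : ℝ) : ℝ :=
  (N.P k * y ^ N.α c / N.P j) ^ (1 / N.α co)

/-- The product of the complementary distribution functions over all pairs other than
`(j, c)`. -/
def otherVoid (j : Fin K) (c : Channel) (y : ℝ) : ℝ :=
  ∏ q ∈ Finset.univ.erase (j, c), N.ccdfV q.1 q.2 (N.radius j c q.1 q.2 y)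

/-- Association probability. -/
def assocProb (j : Fin K) (c : Channel) : ℝ :=
  ∫ y in Set.Ioi (0 : ℝ), N.pdfV j c y * N.otherVoid j c y

/-- Density of the main link distance, given that the main link belongs to layer `j` and
state `c`. -/
def pdfY (j : Fin K) (c : Channel) (y : ℝ) : ℝ :=
  N.pdfV j c y / N.assocProb j c * N.otherVoid j c y

/-- Transform at `s` of the interference from layer `k` and state `co`, given that the main link
belongs to layer `j`, is in state `c` and has length `y`. The integral is taken in `[0, ∞]`. -/
def laplaceI (j : Fin K) (c : Channel) (y : ℝ) (k : Fin K) (co : Channel) (s : ℝ) : ℝ :=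
  expNeg (ENNReal.ofReal (2 * Real.pi * N.lam k) *
    ∫⁻ x in Set.Ioi (max (N.radius j c k co y) (N.h k)),
      ENNReal.ofReal (x * N.rho k co x *
        (1 - (1 / (1 + s * N.P k * x ^ (-N.α co) / N.m co)) ^ N.m co)))

/-- Transform of interference plus noise. -/
def laplaceTotal (j : Fin K) (c : Channel) (y : ℝ) (s : ℝ) : ℝ :=
  Real.exp (-s * N.σ ^ 2) * ∏ q : Fin K × Channel, N.laplaceI j c y q.1 q.2 s

/-- The argument at which the transform is evaluated. -/
def evalPoint (j : Fin K) (c : Channel) (y : ℝ) : ℝ :=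
  N.m c * N.β / (N.P j * y ^ (-N.α c))

/-- The conditional successful transmission probability in closed form. -/
def condSTP (j : Fin K) (c : Channel) (y : ℝ) : ℝ :=
  ∑ n ∈ Finset.range (N.m c),
    (-N.evalPoint j c y) ^ n / (n.factorial : ℝ) *
      iteratedDeriv n (N.laplaceTotal j c y) (N.evalPoint j c y)

end Params

/-- A random network with parameters `N` on the probability space `(Ω, μ)`. -/
structure Network {K : ℕ} (N : Params K) {Ω : Type*} [MeasurableSpace Ω] (μ : Measure Ω) where
  /-- ground position of the `i`-th node of layer `k` -/
  pos : Fin K → ℕ → Ω → Plane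
  /-- state of the link of a node to the receiver -/
  chan : Node K → Ω → Channel
  /-- channel gain of the link of a node to the receiver -/
  gain : Node K → Ω → ℝ
  /-- each layer is a homogeneous Poisson point process -/
  poisson : ∀ k, IsPoissonProcess (pos k) (ENNReal.ofReal (N.lam k) • (volume : Measure Plane)) μ
  /-- the layers are independent -/
  indep_layers : iIndepFun (fun (k : Fin K) (ω : Ω) (i : ℕ) => pos k i ω) μ
  measurable_chan : ∀ p c, MeasurableSet {ω | chan p ω = c}
  measurable_gain : ∀ p, Measurable (gain p)
  /-- Given all the positions, the pairs (link state, gain) of the nodes are independent; the state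
  of a link is `c` with the probability that belongs to its length, and given this the gain has the
  law that belongs to `c`. (Finite-dimensional laws on the events `E` about the positions.) -/
  marks : ∀ (E : Set (Fin K → ℕ → Plane)), MeasurableSet E →
    ∀ (S : Finset (Node K)) (c : Node K → Channel) (B : Node K → Set ℝ),
      (∀ p, MeasurableSet (B p)) →
      μ {ω | (fun k i => pos k i ω) ∈ E ∧ ∀ p ∈ S, chan p ω = c p ∧ gain p ω ∈ B p} =
        ∫⁻ ω in {ω | (fun k i => pos k i ω) ∈ E},
          ∏ p ∈ S, ENNReal.ofReal (N.rho p.1 (c p) (N.linkDist p.1 (pos p.1 p.2 ω))) *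
            N.gainLaw (c p) (B p) ∂μ

namespace Network

variable {K : ℕ} {N : Params K} {Ω : Type*} [MeasurableSpace Ω] {μ : Measure Ω}
  (W : Network N μ)

/-- Length of the link of the node `p` to the receiver. -/
def dist (p : Node K) (ω : Ω) : ℝ := N.linkDist p.1 (W.pos p.1 p.2 ω)

/-- Average received power from the node `p`. -/
def avgPower (p : Node K) (ω : Ω) : ℝ := N.P p.1 * W.dist p ω ^ (-N.α (W.chan p ω))

/-- Received power from the node `p`. -/
def power (p : Node K) (ω : Ω) : ℝ :=
  N.P p.1 * W.gain p ω * W.dist p ω ^ (-N.α (W.chan p ω))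

/-- `p` is the transmitter of the main link: it is the one with the strongest average received
power. (Ties have probability zero.) -/
def IsMain (p : Node K) (ω : Ω) : Prop := ∀ q, q ≠ p → W.avgPower q ω < W.avgPower p ω

/-- Interference (from all nodes but `p`) plus noise, when `p` is the transmitter; it may be
infinite. -/
def interference (p : Node K) (ω : Ω) : ℝ≥0∞ :=
  (∑' q : {q : Node K // q ≠ p}, ENNReal.ofReal (W.power q ω)) + ENNReal.ofReal (N.σ ^ 2)

/-- Signal-to-interference-plus-noise ratio, when `p` is the transmitter. -/
def sinr (p : Node K) (ω : Ω) : ℝ≥0∞ := ENNReal.ofReal (W.power p ω) / W.interference p ω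

/-- Interference plus noise for the main link. (There is at most one `p` with `IsMain p ω`.) -/
def mainInterference (ω : Ω) : ℝ≥0∞ := ⨆ (p : Node K) (_ : W.IsMain p ω), W.interference p ω

/-- The transmission over the main link is successful. -/
def success : Set Ω := {ω | ∃ p, W.IsMain p ω ∧ ENNReal.ofReal N.β < W.sinr p ω}

/-- The main link belongs to layer `j`, is in state `c`, and its length lies in `B`. -/
def mainEvent (j : Fin K) (c : Channel) (B : Set ℝ) : Set Ω :=
  {ω | ∃ i, W.IsMain (j, i) ω ∧ W.chan (j, i) ω = c ∧ W.dist (j, i) ω ∈ B}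

end Network

end AerialNetwork

end

noncomputable section

namespace AerialNetwork

open Filter Topology Set

/-! ### The function `exp (-t)` on `[0, ∞]` -/

/-! Give every node its layer, position, link state and gain as one marked point. What is needed of
the Poisson property of the marked points is only their Laplace functional, E exp(-∑ w(x_p)) =
exp(-∫ (1 - e^{-w}) dΛ) with Λ = `intensity` (`Network.hasPoissonLaplace`). It comes from the
Laplace functional of each layer (`IsPoissonProcess.laplace`), the independence of the layers and
the averaging over states and gains (`Network.lintegral_prod_mark`). Differentiation in the
direction of a function g gives Campbell's formula; moving one factor e^{-w} to the other side turns
it into Mecke's formula for E ∑_p γ(x_p) exp(-∑_{q ≠ p} w(x_q)). A monotone grid argument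
(`mecke_monotone`) lets w depend on the link length of the distinguished point.

Now let w be infinite at the nodes that are on average at least as strong as the distinguished one,
and s times the received power at the others (`Params.weight`). Together with the noise factor,
exp(-∑ w) is e^{-sI} if the distinguished node carries the main link, and 0 otherwise
(`Network.eneg_rest`). Mecke's formula thus evaluates the mean of e^{-sI} on the event that the main
link is in layer j and state c, has its length in B and its gain in C
(`Network.lintegral_mainLaw_eneg`). The infinite part of w produces the void probabilities; the
finite part, by the transform (1 + t/m)^{-m} of the Gamma law, produces `laplaceTotal`.

A finite measure on [0, ∞] is determined by its Laplace transform (`measure_eq_of_laplace`). Hence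
the gain of the main link is independent of length and interference. The case s = 0 gives the
density of the length, and disintegration gives a conditional law of I at length y whose transform
is `laplaceTotal`. Given I = t, success means that the gain exceeds a multiple of t. For an integer
shape m this has probability ∑_{n<m} (st)^n/n! e^{-st}, and averaging over t turns the terms into
derivatives of the transform (`sum_iteratedDeriv_eq`).

With values in [0, ∞] and e^{-∞} = 0, infinite interference is covered by the same formulas. -/

/-- `exp (-t)` for `t` in `[0, ∞]`, as an extended nonnegative real. -/
def eneg (t : ℝ≥0∞) : ℝ≥0∞ := EReal.exp (-(t : EReal))

lemma continuous_eneg : Continuous eneg :=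
  ENNReal.continuous_exp.comp (continuous_neg.comp continuous_coe_ennreal_ereal)

@[fun_prop]
lemma measurable_eneg : Measurable eneg := continuous_eneg.measurable

@[simp] lemma eneg_zero : eneg 0 = 1 := by simp [eneg]

@[simp] lemma eneg_top : eneg ∞ = 0 := by simp [eneg]

lemma antitone_eneg : Antitone eneg := fun a b h => by
  unfold eneg
  rw [EReal.exp_le_exp_iff, EReal.neg_le_neg_iff]
  exact_mod_cast h

lemma eneg_le_one (t : ℝ≥0∞) : eneg t ≤ 1 := by
  simpa using antitone_eneg (zero_le : 0 ≤ t)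

lemma eneg_ne_top (t : ℝ≥0∞) : eneg t ≠ ∞ := ne_top_of_le_ne_top ENNReal.one_ne_top (eneg_le_one t)

lemma eneg_add (a b : ℝ≥0∞) : eneg (a + b) = eneg a * eneg b := by
  unfold eneg
  rw [EReal.coe_ennreal_add, EReal.neg_add (by simp) (by simp), sub_eq_add_neg, EReal.exp_add]

lemma eneg_coe (t : ℝ≥0) : eneg t = ENNReal.ofReal (Real.exp (-t)) := rfl

lemma eneg_ofReal {t : ℝ} (ht : 0 ≤ t) : eneg (ENNReal.ofReal t) = ENNReal.ofReal (Real.exp (-t)) := by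
  rw [ENNReal.ofReal, eneg_coe, Real.coe_toNNReal t ht]

lemma expNeg_nonneg (t : ℝ≥0∞) : 0 ≤ expNeg t := by
  unfold expNeg; split_ifs <;> positivity

lemma eneg_eq_ofReal (t : ℝ≥0∞) : eneg t = ENNReal.ofReal (expNeg t) := by
  by_cases h : t = ∞
  · simp [h, expNeg]
  · lift t to ℝ≥0 using h
    simp [expNeg, eneg_coe]

lemma toReal_eneg (t : ℝ≥0∞) : (eneg t).toReal = expNeg t := by
  rw [eneg_eq_ofReal, ENNReal.toReal_ofReal (expNeg_nonneg t)]

lemma eneg_sum {ι : Type*} (s : Finset ι) (f : ι → ℝ≥0∞) :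
    eneg (∑ i ∈ s, f i) = ∏ i ∈ s, eneg (f i) := by
  classical
  induction s using Finset.induction_on with
  | empty => simp
  | insert a s h ih => rw [Finset.sum_insert h, Finset.prod_insert h, eneg_add, ih]

lemma eneg_mul_nat (t : ℝ≥0∞) (n : ℕ) : eneg (t * n) = eneg t ^ n := by
  have := eneg_sum (Finset.range n) (fun _ => t)
  simpa [mul_comm] using this

lemma eneg_ne_zero {t : ℝ≥0∞} (ht : t ≠ ∞) : eneg t ≠ 0 := by
  lift t to ℝ≥0 using ht
  rw [eneg_coe]; simp [Real.exp_pos]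

/-- The inverse of `eneg` on `[0, 1]`. -/
def nlog (v : ℝ≥0∞) : ℝ≥0∞ := (-(ENNReal.log v)).toENNReal

@[fun_prop]
lemma measurable_nlog : Measurable nlog :=
  (continuous_neg.measurable.comp ENNReal.measurable_log).ereal_toENNReal

lemma eneg_nlog {v : ℝ≥0∞} (hv : v ≤ 1) : eneg (nlog v) = v := by
  have : 0 ≤ -(ENNReal.log v) := by
    rw [EReal.neg_nonneg]
    simpa using ENNReal.log_monotone hv
  rw [eneg, nlog, EReal.coe_toENNReal this, neg_neg, ENNReal.exp_log]

/-! ### The Laplace functional of a Poisson process -/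

lemma lintegral_poisson (r : ℝ≥0) (f : ℕ → ℝ≥0∞) :
    ∫⁻ n, f n ∂(poissonMeasure r) =
      ∑' n : ℕ, ENNReal.ofReal (Real.exp (-r) * r ^ n / n.factorial) * f n := by
  rw [poissonMeasure, lintegral_sum_measure]
  simp

/-- The Poisson weights and the factors `exp (-c * n)` combine to the exponential series at `r * exp
(-c)`. -/
lemma lintegral_eneg_poisson (r c : ℝ≥0) :
    ∫⁻ n : ℕ, eneg (c * n) ∂(poissonMeasure r) = eneg (r * (1 - eneg c)) := by
  rw [lintegral_poisson]
  have h1 : ∀ n : ℕ, ENNReal.ofReal (Real.exp (-r) * r ^ n / n.factorial) * eneg (c * n) =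
      ENNReal.ofReal (Real.exp (-r) * ((r * Real.exp (-c)) ^ n / n.factorial)) := fun n => by
    rw [eneg_mul_nat, eneg_coe, ← ENNReal.ofReal_pow (by positivity), ← ENNReal.ofReal_mul (by positivity)]
    congr 1
    rw [mul_pow]; ring
  simp_rw [h1]
  have hs : HasSum (fun n : ℕ => Real.exp (-r) * ((r * Real.exp (-c)) ^ n / n.factorial))
      (Real.exp (-r) * Real.exp (r * Real.exp (-c))) := by
    apply HasSum.mul_left
    rw [Real.exp_eq_exp_ℝ]
    exact NormedSpace.expSeries_div_hasSum_exp (r * NormedSpace.exp (-c : ℝ) : ℝ)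
  rw [← ENNReal.ofReal_tsum_of_nonneg (fun n => by positivity) hs.summable, hs.tsum_eq, ← Real.exp_add]
  have hc : Real.exp (-c) ≤ 1 := by simp
  have : (r : ℝ≥0∞) * (1 - eneg c) = ENNReal.ofReal (r * (1 - Real.exp (-c))) := by
    rw [eneg_coe, ENNReal.ofReal_mul (by positivity), ENNReal.ofReal_coe_nnreal,
      ENNReal.ofReal_sub _ (by positivity), ENNReal.ofReal_one]
  rw [this, eneg_ofReal (mul_nonneg r.coe_nonneg (by linarith))]
  congr 2; ring

/-- Monotone convergence for the counting measure. -/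
lemma ennreal_iSup_tsum {ι : Type*} (f : ℕ → ι → ℝ≥0∞) (hf : Monotone f) :
    ∑' i, ⨆ n, f n i = ⨆ n, ∑' i, f n i := by
  let : MeasurableSpace ι := ⊤
  simp_rw [← lintegral_count]
  exact lintegral_iSup (fun n => measurable_from_top) hf

/-- Dominated by the constant `1`. Continuity of `eneg` at `∞` makes any finiteness of the exponents
superfluous. -/
lemma tendsto_lintegral_eneg {Ω : Type*} [MeasurableSpace Ω] {μ : Measure Ω} [IsFiniteMeasure μ]
    {f : ℕ → Ω → ℝ≥0∞} {g : Ω → ℝ≥0∞} (hf : ∀ n, Measurable (f n))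
    (h : ∀ ω, Tendsto (fun n => f n ω) atTop (𝓝 (g ω))) :
    Tendsto (fun n => ∫⁻ ω, eneg (f n ω) ∂μ) atTop (𝓝 (∫⁻ ω, eneg (g ω) ∂μ)) :=
  tendsto_lintegral_of_dominated_convergence (fun _ => 1)
    (fun n => measurable_eneg.comp (hf n)) (fun n => Eventually.of_forall fun ω => eneg_le_one _)
    (by simp) (Eventually.of_forall fun ω => (continuous_eneg.tendsto _).comp (h ω))

section Poisson

variable {Ω E : Type*} [MeasurableSpace Ω] [MeasurableSpace E] {X : ℕ → Ω → E} {ν : Measure E}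
  {μ : Measure Ω}

lemma measurable_pointCount (hX : ∀ i, Measurable (X i)) {A : Set E} (hA : MeasurableSet A) :
    Measurable (pointCount X A) := by
  unfold pointCount
  exact Measurable.tsum fun i => (measurable_const.indicator hA).comp (hX i)

lemma IsPoissonProcess.laplace_count (h : IsPoissonProcess X ν μ) {A : Set E}
    (hA : MeasurableSet A) (hν : ν A ≠ ∞) (c : ℝ≥0) :
    ∫⁻ ω, eneg (c * pointCount X A ω) ∂μ = eneg (ν A * (1 - eneg c)) := by
  have hm := measurable_pointCount h.measurable hA
  have : ∫⁻ ω, eneg (c * pointCount X A ω) ∂μ = ∫⁻ t, eneg (c * t) ∂(μ.map (pointCount X A)) := by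
    rw [lintegral_map (by fun_prop) hm]
  rw [this, h.law A hA hν, lintegral_map (by fun_prop) (by fun_prop), lintegral_eneg_poisson,
    ENNReal.coe_toNNReal hν]

/-- The Laplace functional of a Poisson process at a simple function. -/
lemma IsPoissonProcess.laplace_simple (h : IsPoissonProcess X ν μ)
    (f : SimpleFunc E ℝ≥0∞) (hf : ∀ x, f x < ∞) {D : Set E} (hD : MeasurableSet D) (hνD : ν D ≠ ∞) :
    ∫⁻ ω, eneg (∑' i, D.indicator f (X i ω)) ∂μ =
      eneg (∫⁻ x, (1 - eneg (D.indicator f x)) ∂ν) := by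
  classical
  -- The level sets of `f` inside `D` are disjoint and of finite measure, so the numbers of points
  -- in them are independent Poisson variables.
  set e := f.range.equivFin
  set r : Fin f.range.card → ℝ≥0∞ := fun l => (e.symm l : ℝ≥0∞) with hr
  set A : Fin f.range.card → Set E := fun l => f ⁻¹' {r l} ∩ D with hA
  have hAm : ∀ l, MeasurableSet (A l) := fun l => (f.measurableSet_preimage _).inter hD
  have hrtop : ∀ l, r l ≠ ∞ := fun l => by
    obtain ⟨x, hx⟩ := SimpleFunc.mem_range.1 (e.symm l).2
    rw [hr]; simp only [← hx]; exact (hf x).ne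
  -- Needed for two functions: the identity, in the exponent on the left, and `1 - eneg`, in the
  -- integral on the right. Both vanish at `0`, the value outside `D`.
  have hdec : ∀ g : ℝ≥0∞ → ℝ≥0∞, g 0 = 0 → ∀ x,
      g (D.indicator f x) = ∑ l, g (r l) * (A l).indicator (fun _ => 1) x := by
    intro g hg x
    have hsum : ∑ l, g (r l) * (A l).indicator (fun _ => (1 : ℝ≥0∞)) x =
        ∑ a : f.range, g a * (f ⁻¹' {(a : ℝ≥0∞)} ∩ D).indicator (fun _ => (1 : ℝ≥0∞)) x :=
      e.symm.sum_comp (fun a : f.range => g a * (f ⁻¹' {(a : ℝ≥0∞)} ∩ D).indicator (fun _ => (1 : ℝ≥0∞)) x)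
    rw [hsum]
    by_cases hx : x ∈ D
    · rw [Finset.sum_eq_single ⟨f x, SimpleFunc.mem_range_self f x⟩]
      · simp [hx]
      · intro b _ hb
        have : f x ≠ b := fun hh => hb (Subtype.ext hh.symm)
        simp [this]
      · simp
    · simp [hx, hg]
  have h1 : ∀ ω, ∑' i, D.indicator f (X i ω) = ∑ l, r l * pointCount X (A l) ω := by
    intro ω
    simp_rw [pointCount, ← ENNReal.tsum_mul_left]
    rw [← Summable.tsum_finsetSum (fun _ _ => ENNReal.summable)]
    exact tsum_congr fun i => hdec id rfl _
  simp_rw [h1, eneg_sum]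
  have hdisj : Pairwise (fun l l' => Disjoint (A l) (A l')) := by
    intro l l' hll
    rw [Set.disjoint_left]
    rintro x ⟨hx, -⟩ ⟨hx', -⟩
    apply hll
    apply e.symm.injective
    apply Subtype.ext
    exact (hx : f x = r l).symm.trans hx'
  have hind := h.indep _ A hAm hdisj
  have hind2 : iIndepFun (fun l ω => eneg (r l * pointCount X (A l) ω)) μ :=
    hind.comp (fun l t => eneg (r l * t)) (fun l => by fun_prop)
  rw [lintegral_prod_eq_prod_lintegral_of_indepFun Finset.univ _ hind2
    (fun l => measurable_eneg.comp ((measurable_pointCount h.measurable (hAm l)).const_mul _))]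
  have hνA : ∀ l, ν (A l) ≠ ∞ := fun l => ne_top_of_le_ne_top hνD (measure_mono inter_subset_right)
  have h2 : ∀ l, ∫⁻ ω, eneg (r l * pointCount X (A l) ω) ∂μ = eneg (ν (A l) * (1 - eneg (r l))) := by
    intro l
    have := h.laplace_count (hAm l) (hνA l) (r l).toNNReal
    rwa [ENNReal.coe_toNNReal (hrtop l)] at this
  simp_rw [h2]
  rw [← eneg_sum]
  congr 1
  simp_rw [hdec (fun t => 1 - eneg t) (by simp)]
  rw [lintegral_finsetSum _ (fun l _ => (measurable_const.indicator (hAm l)).const_mul _)]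
  refine Finset.sum_congr rfl fun l _ => ?_
  rw [lintegral_const_mul _ (measurable_const.indicator (hAm l)), lintegral_indicator (hAm l)]
  simp [mul_comm]

/-- The Laplace functional of a Poisson process. -/
theorem IsPoissonProcess.laplace [SigmaFinite ν] [IsFiniteMeasure μ] (h : IsPoissonProcess X ν μ)
    {w : E → ℝ≥0∞} (hw : Measurable w) :
    ∫⁻ ω, eneg (∑' i, w (X i ω)) ∂μ = eneg (∫⁻ x, (1 - eneg (w x)) ∂ν) := by
  set D : ℕ → Set E := spanningSets ν
  set f : ℕ → E → ℝ≥0∞ := fun n => (D n).indicator (SimpleFunc.eapprox w n) with hf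
  have hfm : ∀ n, Measurable (f n) := fun n =>
    (SimpleFunc.measurable _).indicator (measurableSet_spanningSets ν n)
  have hmono : Monotone f := by
    intro n m hnm x
    by_cases hx : x ∈ D n
    · have hx' : x ∈ D m := monotone_spanningSets ν hnm hx
      simp only [hf, indicator_of_mem hx, indicator_of_mem hx']
      exact SimpleFunc.monotone_eapprox w hnm x
    · simp [hf, hx]
  have hsup : ∀ x, ⨆ n, f n x = w x := by
    intro x
    refine le_antisymm (iSup_le fun n => ?_) ?_
    · rw [← SimpleFunc.iSup_eapprox_apply hw x]
      exact (indicator_le_self _ _ _).trans (le_iSup (fun n => SimpleFunc.eapprox w n x) n)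
    · rw [← SimpleFunc.iSup_eapprox_apply hw x]
      refine iSup_le fun n => ?_
      obtain ⟨k, hk⟩ : ∃ k, x ∈ D k := by
        have : x ∈ ⋃ k, D k := by rw [iUnion_spanningSets]; trivial
        simpa using this
      -- The index must be large enough both for the approximation and for the spanning set to
      -- contain `x`.
      refine le_trans ?_ (le_iSup _ (max n k))
      have : x ∈ D (max n k) := monotone_spanningSets ν (le_max_right _ _) hk
      simp only [hf, indicator_of_mem this]
      exact SimpleFunc.monotone_eapprox w (le_max_left _ _) x
  have hs : ∀ n, ∫⁻ ω, eneg (∑' i, f n (X i ω)) ∂μ = eneg (∫⁻ x, (1 - eneg (f n x)) ∂ν) := fun n =>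
    h.laplace_simple _ (SimpleFunc.eapprox_lt_top w n) (measurableSet_spanningSets ν n)
      (measure_spanningSets_lt_top ν n).ne
  have hL : Tendsto (fun n => ∫⁻ ω, eneg (∑' i, f n (X i ω)) ∂μ) atTop
      (𝓝 (∫⁻ ω, eneg (∑' i, w (X i ω)) ∂μ)) := by
    refine tendsto_lintegral_eneg (fun n => Measurable.tsum fun i => (hfm n).comp (h.measurable i)) fun ω => ?_
    simp_rw [← hsup]
    rw [ennreal_iSup_tsum (fun n i => f n (X i ω)) (fun n m hnm i => hmono hnm _)]
    exact tendsto_atTop_iSup fun n m hnm => ENNReal.tsum_le_tsum fun i => hmono hnm _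
  have hR : Tendsto (fun n => eneg (∫⁻ x, (1 - eneg (f n x)) ∂ν)) atTop
      (𝓝 (eneg (∫⁻ x, (1 - eneg (w x)) ∂ν))) := by
    refine (continuous_eneg.tendsto _).comp ?_
    refine lintegral_tendsto_of_tendsto_of_monotone (fun n => ((measurable_eneg.comp (hfm n)).const_sub _).aemeasurable) ?_ ?_
    · exact Eventually.of_forall fun x n m hnm => tsub_le_tsub_left (antitone_eneg (hmono hnm x)) _
    · refine Eventually.of_forall fun x => ?_
      have : Tendsto (fun n => f n x) atTop (𝓝 (w x)) := by
        rw [← hsup]; exact tendsto_atTop_iSup fun n m hnm => hmono hnm x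
      exact ENNReal.Tendsto.sub tendsto_const_nhds ((continuous_eneg.tendsto _).comp this) (by simp)
  simp_rw [hs] at hL
  exact tendsto_nhds_unique hL hR

end Poisson

/-! ### Difference quotients of `exp (-t)` at `0` -/

/-- The difference quotient `2 ^ n * (1 - exp (-x / 2 ^ n))`, which increases to `x`. -/
def diffQuot (n : ℕ) (x : ℝ≥0∞) : ℝ≥0∞ := 2 ^ n * (1 - eneg (x / 2 ^ n))

lemma continuous_diffQuot (n : ℕ) : Continuous (diffQuot n) := by
  unfold diffQuot
  refine (ENNReal.continuous_const_mul (by simp)).comp ?_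
  refine (ENNReal.continuous_sub_left ENNReal.one_ne_top).comp (continuous_eneg.comp ?_)
  exact ENNReal.continuous_div_const _ (by simp)

lemma measurable_diffQuot (n : ℕ) : Measurable (diffQuot n) := (continuous_diffQuot n).measurable

/-- This is `(a - 1) ^ 2 ≥ 0`. For `a = eneg (x / 2 ^ (n + 1))` it compares `diffQuot n x` with
`diffQuot (n + 1) x`; halving the increment is what makes the quotients monotone so easily. -/
lemma two_mul_one_sub_ge {a : ℝ≥0∞} (ha : a ≤ 1) : 1 - a * a ≤ 2 * (1 - a) := by
  rw [tsub_le_iff_right]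
  lift a to ℝ≥0 using ne_top_of_le_ne_top ENNReal.one_ne_top ha
  have ha' : a ≤ 1 := by exact_mod_cast ha
  have : (1 : ℝ≥0) ≤ 2 * (1 - a) + a * a := by
    rw [← NNReal.coe_le_coe]
    push_cast [NNReal.coe_sub ha']
    nlinarith [sq_nonneg ((a : ℝ) - 1)]
  exact_mod_cast this

lemma diffQuot_monotone (x : ℝ≥0∞) : Monotone (fun n => diffQuot n x) := by
  refine monotone_nat_of_le_succ fun n => ?_
  unfold diffQuot
  have h : x / 2 ^ n = x / 2 ^ (n + 1) + x / 2 ^ (n + 1) := by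
    rw [← ENNReal.add_div, ← two_mul, pow_succ', ENNReal.mul_div_mul_left _ _ (by simp) (by simp)]
  rw [h, eneg_add, pow_succ, mul_assoc]
  gcongr
  exact two_mul_one_sub_ge (eneg_le_one _)

lemma one_sub_eneg_le (x : ℝ≥0∞) : 1 - eneg x ≤ x := by
  by_cases h : x = ∞
  · simp [h]
  lift x to ℝ≥0 using h
  rw [tsub_le_iff_left, eneg_coe, ← ENNReal.ofReal_coe_nnreal, ← ENNReal.ofReal_add (by positivity) (by positivity),
    ← ENNReal.ofReal_one]
  apply ENNReal.ofReal_le_ofReal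
  linarith [Real.add_one_le_exp (-(x : ℝ))]

lemma diffQuot_le (n : ℕ) (x : ℝ≥0∞) : diffQuot n x ≤ x := by
  unfold diffQuot
  calc 2 ^ n * (1 - eneg (x / 2 ^ n)) ≤ 2 ^ n * (x / 2 ^ n) := by gcongr; exact one_sub_eneg_le _
    _ = x := ENNReal.mul_div_cancel (by simp) (by simp)

/-- For finite `x` the quotient lies between `x / (1 + x / 2 ^ n)` and `x`, both bounds coming from
`1 + u ≤ exp u`. At `x = ∞` it equals `2 ^ n`. -/
lemma tendsto_diffQuot (x : ℝ≥0∞) : Tendsto (fun n => diffQuot n x) atTop (𝓝 x) := by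
  have hpow : Tendsto (fun n : ℕ => (2 : ℝ≥0∞) ^ n) atTop (𝓝 ∞) :=
    ENNReal.tendsto_pow_atTop_nhds_top_iff.2 (by norm_num)
  by_cases h : x = ∞
  · subst h
    have : (fun n => diffQuot n ∞) = fun n : ℕ => (2 : ℝ≥0∞) ^ n := by
      ext n
      simp [diffQuot, ENNReal.top_div]
    rwa [this]
  lift x to ℝ≥0 using h
  have key : ∀ n : ℕ, diffQuot n x = ENNReal.ofReal (2 ^ n * (1 - Real.exp (-(x / 2 ^ n)))) := by
    intro n
    have h1 : (x : ℝ≥0∞) / 2 ^ n = ENNReal.ofReal (x / 2 ^ n) := by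
      rw [ENNReal.ofReal_div_of_pos (by positivity), ENNReal.ofReal_coe_nnreal,
        ENNReal.ofReal_pow (by positivity)]; simp
    rw [diffQuot, h1, eneg_ofReal (by positivity), ENNReal.ofReal_mul (by positivity),
      ENNReal.ofReal_pow (by positivity), ENNReal.ofReal_sub _ (by positivity)]
    simp
  simp_rw [key]
  rw [← ENNReal.ofReal_coe_nnreal (p := x)]
  refine (ENNReal.continuous_ofReal.tendsto _).comp ?_
  have hlim : Tendsto (fun n : ℕ => (x : ℝ) / (1 + x / 2 ^ n)) atTop (𝓝 x) := by
    have h0 : Tendsto (fun n : ℕ => (x : ℝ) / 2 ^ n) atTop (𝓝 0) :=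
      tendsto_const_nhds.div_atTop (tendsto_pow_atTop_atTop_of_one_lt (by norm_num))
    have := (tendsto_const_nhds (x := (x : ℝ))).div ((tendsto_const_nhds (x := (1 : ℝ))).add h0) (by simp)
    rw [add_zero, div_one] at this
    exact this
  refine tendsto_of_tendsto_of_tendsto_of_le_of_le hlim tendsto_const_nhds (fun n => ?_) (fun n => ?_)
  · have hu : 0 ≤ (x : ℝ) / 2 ^ n := by positivity
    set u : ℝ := x / 2 ^ n with hudef
    have hx : (x : ℝ) = 2 ^ n * u := by rw [hudef]; field_simp
    have h2 : u / (1 + u) ≤ 1 - Real.exp (-u) := by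
      have h3 : Real.exp (-u) ≤ 1 / (1 + u) := by
        rw [Real.exp_neg, ← one_div]
        exact one_div_le_one_div_of_le (by positivity) (by linarith [Real.add_one_le_exp u])
      have h4 : u / (1 + u) = 1 - 1 / (1 + u) := by field_simp; ring
      linarith
    calc (x : ℝ) / (1 + u) = 2 ^ n * (u / (1 + u)) := by rw [hx]; ring
      _ ≤ 2 ^ n * (1 - Real.exp (-u)) := by gcongr
  · have := Real.add_one_le_exp (-((x : ℝ) / 2 ^ n))
    calc (2 : ℝ) ^ n * (1 - Real.exp (-(x / 2 ^ n))) ≤ 2 ^ n * (x / 2 ^ n) := by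
          gcongr; linarith
      _ = x := by field_simp

/-- From below, freeze the index of the quotient at `m ≤ n`, use continuity of `diffQuot m`, and
then let `m` grow. From above, `diffQuot n x ≤ x`. -/
lemma tendsto_diffQuot_diag {C : ℕ → ℝ≥0∞} {c : ℝ≥0∞} (hC : Tendsto C atTop (𝓝 c)) :
    Tendsto (fun n => diffQuot n (C n)) atTop (𝓝 c) := by
  refine tendsto_of_le_liminf_of_limsup_le ?_ ?_
  · refine le_of_tendsto' (tendsto_diffQuot c) fun m => ?_
    have h1 : Tendsto (fun n => diffQuot m (C n)) atTop (𝓝 (diffQuot m c)) :=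
      ((continuous_diffQuot m).tendsto _).comp hC
    rw [← h1.liminf_eq]
    exact liminf_le_liminf (eventually_atTop.2 ⟨m, fun n hn => diffQuot_monotone _ hn⟩)
  · rw [← hC.limsup_eq]
    exact limsup_le_limsup (Eventually.of_forall fun n => diffQuot_le n _)

/-! ### Campbell and Mecke formulas -/

lemma tsum_ne_add {ι : Type*} (f : ι → ℝ≥0∞) (p : ι) :
    f p + ∑' q : {q // q ≠ p}, f q = ∑' q, f q := by
  classical
  have h1 : ∑' q : {q // q ≠ p}, f q = ∑' q, ({q | q ≠ p} : Set ι).indicator f q :=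
    tsum_subtype ({q | q ≠ p} : Set ι) f
  rw [h1, ENNReal.tsum_eq_add_tsum_ite (f := f) p]
  congr 1
  refine tsum_congr fun q => ?_
  by_cases h : q = p <;> simp [h]

/-- The random points `x p` have the Laplace functional of a Poisson process with intensity
measure `Λ`. -/
structure HasPoissonLaplace {Ω E ι : Type*} [MeasurableSpace Ω] [MeasurableSpace E]
    (x : ι → Ω → E) (Λ : Measure E) (μ : Measure Ω) : Prop where
  measurable : ∀ p, Measurable (x p)
  laplace : ∀ w : E → ℝ≥0∞, Measurable w →
    ∫⁻ ω, eneg (∑' p, w (x p ω)) ∂μ = eneg (∫⁻ y, (1 - eneg (w y)) ∂Λ)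

namespace HasPoissonLaplace

variable {Ω E ι : Type*} [MeasurableSpace Ω] [MeasurableSpace E] [Countable ι]
  {x : ι → Ω → E} {Λ : Measure E} {μ : Measure Ω}

/-- A weighted form of Campbell's formula. -/
lemma campbell [IsFiniteMeasure μ] (h : HasPoissonLaplace x Λ μ) {g w : E → ℝ≥0∞} (hg : Measurable g)
    (hw : Measurable w) :
    ∫⁻ ω, (∑' p, g (x p ω)) * eneg (∑' p, w (x p ω)) ∂μ =
      (∫⁻ y, g y * eneg (w y) ∂Λ) * eneg (∫⁻ y, (1 - eneg (w y)) ∂Λ) := by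
  have hxm := h.measurable
  set G : Ω → ℝ≥0∞ := fun ω => ∑' p, g (x p ω) with hG
  set V : Ω → ℝ≥0∞ := fun ω => ∑' p, w (x p ω) with hV
  have hGm : Measurable G := Measurable.tsum fun p => hg.comp (hxm p)
  have hVm : Measurable V := Measurable.tsum fun p => hw.comp (hxm p)
  set A := ∫⁻ y, (1 - eneg (w y)) ∂Λ
  -- The formula is the derivative of the Laplace functional at `w` in the direction `g`. The
  -- difference quotients increase, so no integrability of `g` is needed.
  have hL : Tendsto (fun n => ∫⁻ ω, diffQuot n (G ω) * eneg (V ω) ∂μ) atTop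
      (𝓝 (∫⁻ ω, G ω * eneg (V ω) ∂μ)) := by
    refine lintegral_tendsto_of_tendsto_of_monotone (fun n => ?_) ?_ ?_
    · exact (((measurable_diffQuot n).comp hGm).mul (measurable_eneg.comp hVm)).aemeasurable
    · exact Eventually.of_forall fun ω n m hnm =>
        mul_le_mul_left (diffQuot_monotone _ hnm) _
    · exact Eventually.of_forall fun ω =>
        ENNReal.Tendsto.mul_const (tendsto_diffQuot _) (Or.inr (eneg_ne_top _))
  set C : ℕ → ℝ≥0∞ := fun n => ∫⁻ y, diffQuot n (g y) * eneg (w y) ∂Λ with hCdef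
  have hC : Tendsto C atTop (𝓝 (∫⁻ y, g y * eneg (w y) ∂Λ)) := by
    refine lintegral_tendsto_of_tendsto_of_monotone (fun n => ?_) ?_ ?_
    · exact (((measurable_diffQuot n).comp hg).mul (measurable_eneg.comp hw)).aemeasurable
    · exact Eventually.of_forall fun ω n m hnm =>
        mul_le_mul_left (diffQuot_monotone _ hnm) _
    · exact Eventually.of_forall fun ω =>
        ENNReal.Tendsto.mul_const (tendsto_diffQuot _) (Or.inr (eneg_ne_top _))
  have hR : Tendsto (fun n => diffQuot n (C n) * eneg A) atTop
      (𝓝 ((∫⁻ y, g y * eneg (w y) ∂Λ) * eneg A)) :=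
    ENNReal.Tendsto.mul_const (tendsto_diffQuot_diag hC) (Or.inr (eneg_ne_top _))
  -- The left side is `2 ^ n` times the difference of the Laplace functionals at `w` and at `w + g /
  -- 2 ^ n`.
  have hEq : ∀ n, ∫⁻ ω, diffQuot n (G ω) * eneg (V ω) ∂μ = diffQuot n (C n) * eneg A := by
    intro n
    have hgn : Measurable (fun y => g y / 2 ^ n) := hg.div_const _
    have h1 : ∀ ω, diffQuot n (G ω) * eneg (V ω) =
        2 ^ n * (eneg (V ω) - eneg (∑' p, (w (x p ω) + g (x p ω) / 2 ^ n))) := by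
      intro ω
      rw [ENNReal.tsum_add, eneg_add]
      simp_rw [div_eq_mul_inv]
      rw [ENNReal.tsum_mul_right, diffQuot, mul_assoc, ENNReal.sub_mul (fun _ _ => eneg_ne_top _),
        one_mul, mul_comm (eneg (∑' p, w (x p ω)))]
      simp only [hG, hV, div_eq_mul_inv]
    have h2 : ∀ y, eneg (w y + g y / 2 ^ n) ≤ eneg (w y) := fun y => antitone_eneg le_self_add
    have h3 : ∫⁻ y, (1 - eneg (w y + g y / 2 ^ n)) ∂Λ = A + C n / 2 ^ n := by
      have : C n / 2 ^ n = ∫⁻ y, (1 - eneg (g y / 2 ^ n)) * eneg (w y) ∂Λ := by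
        rw [hCdef, div_eq_mul_inv, ← lintegral_mul_const' _ _ (by simp)]
        refine lintegral_congr fun y => ?_
        rw [diffQuot, mul_comm, ← mul_assoc, ← mul_assoc, ENNReal.inv_mul_cancel (by simp) (by simp), one_mul]
      rw [this, ← lintegral_add_left (by fun_prop)]
      refine lintegral_congr fun y => ?_
      rw [ENNReal.sub_mul (fun _ _ => eneg_ne_top _), one_mul, mul_comm (eneg (g y / 2 ^ n)), ← eneg_add]
      rw [tsub_add_tsub_cancel (eneg_le_one _) (h2 y)]
    simp_rw [h1]
    rw [lintegral_const_mul' _ _ (by simp)]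
    have hVm' : Measurable fun ω => ∑' p, (w (x p ω) + g (x p ω) / 2 ^ n) :=
      Measurable.tsum fun p => (hw.comp (hxm p)).add (hgn.comp (hxm p))
    have hVm'' : Measurable fun ω => eneg (∑' p, (w (x p ω) + g (x p ω) / 2 ^ n)) :=
      measurable_eneg.comp hVm'
    rw [lintegral_sub hVm'']
    · have e1 : ∫⁻ ω, eneg (V ω) ∂μ = eneg A := h.laplace w hw
      have e2 := h.laplace (fun y => w y + g y / 2 ^ n) (hw.add hgn)
      rw [e1, e2, h3, eneg_add, diffQuot, mul_assoc, ENNReal.sub_mul (fun _ _ => eneg_ne_top _), one_mul,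
        mul_comm (eneg A)]
    · exact ne_top_of_le_ne_top (measure_ne_top μ univ)
        ((lintegral_mono fun ω => eneg_le_one _).trans (by simp))
    · exact Eventually.of_forall fun ω => antitone_eneg (ENNReal.tsum_le_tsum fun p => le_self_add)
  simp_rw [hEq] at hL
  exact tendsto_nhds_unique hL hR

/-- Campbell's formula for `g = γ / eneg w`: the division cancels the factor of the distinguished
point in the product over all points. This is where `w` has to be finite. -/
lemma mecke_of_ne_top [IsFiniteMeasure μ] (h : HasPoissonLaplace x Λ μ) {γ w : E → ℝ≥0∞}
    (hγ : Measurable γ) (hw : Measurable w) (hwt : ∀ y, w y ≠ ∞) :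
    ∫⁻ ω, ∑' p, γ (x p ω) * eneg (∑' q : {q // q ≠ p}, w (x q ω)) ∂μ =
      (∫⁻ y, γ y ∂Λ) * eneg (∫⁻ y, (1 - eneg (w y)) ∂Λ) := by
  have hinv : ∀ y, (eneg (w y))⁻¹ * eneg (w y) = 1 := fun y =>
    ENNReal.inv_mul_cancel (eneg_ne_zero (hwt y)) (eneg_ne_top _)
  have := h.campbell (g := fun y => γ y * (eneg (w y))⁻¹) (by fun_prop) hw
  simp_rw [mul_assoc, hinv, mul_one] at this
  rw [← this]
  refine lintegral_congr fun ω => ?_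
  rw [← ENNReal.tsum_mul_right]
  refine tsum_congr fun p => ?_
  rw [← tsum_ne_add (fun q => w (x q ω)) p, eneg_add, mul_assoc, ← mul_assoc (eneg (w (x p ω)))⁻¹, hinv, one_mul]

lemma measurable_rest (h : HasPoissonLaplace x Λ μ) {w : E → ℝ≥0∞} (hw : Measurable w) (p : ι) :
    Measurable fun ω => ∑' q : {q // q ≠ p}, w (x q ω) :=
  Measurable.tsum fun q => hw.comp (h.measurable q)

lemma measurable_term (h : HasPoissonLaplace x Λ μ) {γ w : E → ℝ≥0∞} (hγ : Measurable γ)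
    (hw : Measurable w) (p : ι) :
    Measurable fun ω => γ (x p ω) * eneg (∑' q : {q // q ≠ p}, w (x q ω)) :=
  (hγ.comp (h.measurable p)).mul (measurable_eneg.comp (h.measurable_rest hw p))

/-- Mecke's formula for a product functional. -/
theorem mecke [IsFiniteMeasure μ] (h : HasPoissonLaplace x Λ μ) {γ w : E → ℝ≥0∞}
    (hγ : Measurable γ) (hγi : ∫⁻ y, γ y ∂Λ ≠ ∞) (hw : Measurable w) :
    ∫⁻ ω, ∑' p, γ (x p ω) * eneg (∑' q : {q // q ≠ p}, w (x q ω)) ∂μ =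
      (∫⁻ y, γ y ∂Λ) * eneg (∫⁻ y, (1 - eneg (w y)) ∂Λ) := by
  -- Truncation makes `w` finite. The left sides decrease in `n`, so the limit needs a majorant,
  -- namely `γ` at the distinguished point.
  set v : ℕ → E → ℝ≥0∞ := fun n y => min (w y) n with hv
  have hvm : ∀ n, Measurable (v n) := fun n => hw.min measurable_const
  have hvmono : Monotone v := fun n m hnm y => min_le_min le_rfl (by exact_mod_cast hnm)
  have hvlim : ∀ y, Tendsto (fun n => v n y) atTop (𝓝 (w y)) := fun y => by
    have := (tendsto_const_nhds (x := w y)).min ENNReal.tendsto_nat_nhds_top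
    simpa using this
  have hvsup : ∀ y, ⨆ n, v n y = w y := fun y =>
    tendsto_nhds_unique (tendsto_atTop_iSup fun n m hnm => hvmono hnm y) (hvlim y)
  have hn := fun n => h.mecke_of_ne_top hγ (hvm n) (fun y => by simp [hv])
  -- The majorant is summable by the formula for `w = 0`.
  have hγ1 : ∑' p, ∫⁻ ω, γ (x p ω) ∂μ ≠ ∞ := by
    have := h.mecke_of_ne_top hγ (w := fun _ => 0) measurable_const (by simp)
    simp only [tsum_zero, eneg_zero, mul_one, tsub_self, lintegral_zero] at this
    have hm : ∀ p, AEMeasurable (fun ω => γ (x p ω)) μ := fun p =>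
      (hγ.comp (h.measurable p)).aemeasurable
    rw [← lintegral_tsum hm, this]
    exact hγi
  simp_rw [lintegral_tsum fun p => (h.measurable_term hγ (hvm _) p).aemeasurable] at hn
  rw [lintegral_tsum fun p => (h.measurable_term hγ hw p).aemeasurable]
  have hp : ∀ p, Tendsto (fun n => ∫⁻ ω, γ (x p ω) * eneg (∑' q : {q // q ≠ p}, v n (x q ω)) ∂μ) atTop
      (𝓝 (∫⁻ ω, γ (x p ω) * eneg (∑' q : {q // q ≠ p}, w (x q ω)) ∂μ)) := by
    intro p
    have hfin : ∫⁻ ω, γ (x p ω) ∂μ ≠ ∞ := ENNReal.ne_top_of_tsum_ne_top hγ1 p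
    refine tendsto_lintegral_of_dominated_convergence (fun ω => γ (x p ω))
      (fun n => h.measurable_term hγ (hvm n) p) (fun n => Eventually.of_forall fun ω => ?_) hfin ?_
    · exact mul_le_of_le_one_right' (eneg_le_one _)
    · filter_upwards [ae_lt_top (hγ.comp (h.measurable p)) hfin] with ω hω
      refine ENNReal.Tendsto.const_mul ?_ (Or.inr hω.ne)
      refine (continuous_eneg.tendsto _).comp ?_
      simp_rw [← hvsup]
      rw [ennreal_iSup_tsum (fun n (q : {q // q ≠ p}) => v n (x q ω)) (fun n m hnm i => hvmono hnm _)]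
      exact tendsto_atTop_iSup fun n m hnm => ENNReal.tsum_le_tsum fun i => hvmono hnm _
  have hL : Tendsto (fun n => ∑' p, ∫⁻ ω, γ (x p ω) * eneg (∑' q : {q // q ≠ p}, v n (x q ω)) ∂μ) atTop
      (𝓝 (∑' p, ∫⁻ ω, γ (x p ω) * eneg (∑' q : {q // q ≠ p}, w (x q ω)) ∂μ)) := by
    -- Dominated convergence once more, now for the sum over `p` as an integral against the counting
    -- measure.
    let : MeasurableSpace ι := ⊤
    simp_rw [← lintegral_count (α := ι)] at hγ1 ⊢
    refine tendsto_lintegral_of_dominated_convergence (fun p => ∫⁻ ω, γ (x p ω) ∂μ)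
      (fun n => measurable_from_top) (fun n => Eventually.of_forall fun p => ?_) hγ1
      (Eventually.of_forall hp)
    exact lintegral_mono fun ω => mul_le_of_le_one_right' (eneg_le_one _)
  have hR : Tendsto (fun n => (∫⁻ y, γ y ∂Λ) * eneg (∫⁻ y, (1 - eneg (v n y)) ∂Λ)) atTop
      (𝓝 ((∫⁻ y, γ y ∂Λ) * eneg (∫⁻ y, (1 - eneg (w y)) ∂Λ))) := by
    refine ENNReal.Tendsto.const_mul ((continuous_eneg.tendsto _).comp ?_) (Or.inr hγi)
    refine lintegral_tendsto_of_tendsto_of_monotone (fun n => ((measurable_eneg.comp (hvm n)).const_sub _).aemeasurable) ?_ ?_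
    · exact Eventually.of_forall fun x n m hnm => tsub_le_tsub_left (antitone_eneg (hvmono hnm x)) _
    · exact Eventually.of_forall fun y =>
        ENNReal.Tendsto.sub tendsto_const_nhds ((continuous_eneg.tendsto _).comp (hvlim y)) (by simp)
  simp_rw [hn] at hL
  exact tendsto_nhds_unique hL hR

/-- Mecke's formula for a product functional that depends on the distinguished point through an
integer-valued function. -/
lemma mecke_int [IsFiniteMeasure μ] (h : HasPoissonLaplace x Λ μ) {γ : E → ℝ≥0∞} {w : ℤ → E → ℝ≥0∞}
    {ζ : E → ℤ} (hγ : Measurable γ) (hγi : ∫⁻ y, γ y ∂Λ ≠ ∞) (hw : ∀ z, Measurable (w z))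
    (hζ : Measurable ζ) :
    ∫⁻ ω, ∑' p, γ (x p ω) * eneg (∑' q : {q // q ≠ p}, w (ζ (x p ω)) (x q ω)) ∂μ =
      ∫⁻ y, γ y * eneg (∫⁻ y', (1 - eneg (w (ζ y) y')) ∂Λ) ∂Λ := by
  -- Split `γ` according to the value of `ζ`; on each piece the functional of the other points is
  -- fixed.
  set c : ℤ → E → ℝ≥0∞ := fun z => (ζ ⁻¹' {z}).indicator γ with hc
  have hcm : ∀ z, Measurable (c z) := fun z => hγ.indicator (hζ (measurableSet_singleton z))
  have hci : ∀ z, ∫⁻ y, c z y ∂Λ ≠ ∞ := fun z =>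
    ne_top_of_le_ne_top hγi (lintegral_mono (indicator_le_self _ _))
  have hdec : ∀ (F : ℤ → ℝ≥0∞) (y : E), γ y * F (ζ y) = ∑' z, c z y * F z := by
    intro F y
    rw [tsum_eq_single (ζ y)]
    · simp [hc]
    · intro z hz
      simp [hc, hz.symm]
  have hdec' : ∀ ω p, γ (x p ω) * eneg (∑' q : {q // q ≠ p}, w (ζ (x p ω)) (x q ω)) =
      ∑' z, c z (x p ω) * eneg (∑' q : {q // q ≠ p}, w z (x q ω)) := fun ω p =>
    hdec (fun z => eneg (∑' q : {q // q ≠ p}, w z (x q ω))) (x p ω)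
  simp_rw [hdec']
  simp_rw [hdec (fun z => eneg (∫⁻ y', (1 - eneg (w z y')) ∂Λ))]
  rw [lintegral_tsum fun z => ((hcm z).mul_const _).aemeasurable]
  simp_rw [lintegral_mul_const _ (hcm _), ENNReal.tsum_comm (α := ι)]
  rw [lintegral_tsum fun z => (Measurable.tsum fun p => h.measurable_term (hcm z) (hw z) p).aemeasurable]
  exact tsum_congr fun z => h.mecke (hcm z) (hci z) (hw z)

/-- Mecke's formula for a product functional that depends monotonically on a real parameter of the
distinguished point. -/
theorem mecke_monotone [IsFiniteMeasure μ] (h : HasPoissonLaplace x Λ μ) {γ : E → ℝ≥0∞} {w : ℝ → E → ℝ≥0∞}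
    {d : E → ℝ} (hγ : Measurable γ) (hγi : ∫⁻ y, γ y ∂Λ ≠ ∞) (hw : ∀ t, Measurable (w t))
    (hmono : Monotone w) (hd : Measurable d) (hatom : ∀ t, Λ {y | d y = t} = 0) :
    ∫⁻ ω, ∑' p, γ (x p ω) * eneg (∑' q : {q // q ≠ p}, w (d (x p ω)) (x q ω)) ∂μ =
      ∫⁻ y, γ y * eneg (∫⁻ y', (1 - eneg (w (d y) y')) ∂Λ) ∂Λ := by
  -- `H` is antitone, so it has only countably many discontinuities, and `d` avoids them almost
  -- everywhere because its law has no atoms.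
  set H : ℝ → ℝ≥0∞ := fun t => eneg (∫⁻ y', (1 - eneg (w t y')) ∂Λ) with hH
  have hHanti : Antitone H := fun s t hst =>
    antitone_eneg (lintegral_mono fun y => tsub_le_tsub_left (antitone_eneg (hmono hst y)) _)
  have hcount := hHanti.countable_not_continuousAt
  have hae : ∀ᵐ y ∂Λ, ContinuousAt H (d y) := by
    have : ∀ᵐ y ∂Λ, ∀ t ∈ {t | ¬ContinuousAt H t}, d y ≠ t :=
      (ae_ball_iff hcount).2 fun t _ => by
        have := hatom t
        rw [ae_iff]; simpa using this
    filter_upwards [this] with y hy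
    by_contra hcon
    exact hy _ hcon rfl
  have hγae : ∀ᵐ y ∂Λ, γ y < ∞ := ae_lt_top hγ hγi
  -- The parameter `d` lies between the grid values `(ζ n - 1) / (n + 1)` and `ζ n / (n + 1)`. In
  -- what follows `a = 1` gives the lower grid and `a = 0` the upper one.
  set ζ : ℕ → E → ℤ := fun n y => ⌈((n : ℝ) + 1) * d y⌉ with hζ
  have hζm : ∀ n, Measurable (ζ n) := fun n => Int.measurable_ceil.comp (hd.const_mul _)
  have hlim : ∀ (a : ℝ) (t : ℝ), Tendsto (fun n : ℕ => ((⌈((n : ℝ) + 1) * t⌉ : ℝ) - a) / ((n : ℝ) + 1))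
      atTop (𝓝 t) := by
    intro a t
    have h1 : Tendsto (fun n : ℕ => (n : ℝ) + 1) atTop atTop :=
      tendsto_atTop_add_const_right _ _ tendsto_natCast_atTop_atTop
    have hA : Tendsto (fun n : ℕ => t + (-a) / ((n : ℝ) + 1)) atTop (𝓝 t) := by
      simpa using (tendsto_const_nhds (x := t)).add ((tendsto_const_nhds (x := -a)).div_atTop h1)
    have hB : Tendsto (fun n : ℕ => t + (1 - a) / ((n : ℝ) + 1)) atTop (𝓝 t) := by
      simpa using (tendsto_const_nhds (x := t)).add ((tendsto_const_nhds (x := 1 - a)).div_atTop h1)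
    refine tendsto_of_tendsto_of_tendsto_of_le_of_le hA hB (fun n => ?_) (fun n => ?_)
    · have hp : (0 : ℝ) < n + 1 := by positivity
      have := Int.le_ceil (((n : ℝ) + 1) * t)
      change t + -a / ((n : ℝ) + 1) ≤ _
      rw [← sub_nonneg]
      have e : ((⌈((n : ℝ) + 1) * t⌉ : ℝ) - a) / ((n : ℝ) + 1) - (t + -a / ((n : ℝ) + 1)) =
        ((⌈((n : ℝ) + 1) * t⌉ : ℝ) - ((n : ℝ) + 1) * t) / ((n : ℝ) + 1) := by field_simp; ring
      rw [e]
      exact div_nonneg (by linarith) hp.le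
    · have hp : (0 : ℝ) < n + 1 := by positivity
      have := Int.ceil_lt_add_one (((n : ℝ) + 1) * t)
      change _ ≤ t + (1 - a) / ((n : ℝ) + 1)
      rw [← sub_nonneg]
      have e : t + (1 - a) / ((n : ℝ) + 1) - ((⌈((n : ℝ) + 1) * t⌉ : ℝ) - a) / ((n : ℝ) + 1) =
        (((n : ℝ) + 1) * t + 1 - (⌈((n : ℝ) + 1) * t⌉ : ℝ)) / ((n : ℝ) + 1) := by field_simp; ring
      rw [e]
      exact div_nonneg (by linarith) hp.le
  have hHm : Measurable H := hHanti.measurable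
  have hconv : ∀ a : ℝ, Tendsto (fun n : ℕ => ∫⁻ y, γ y * H (((ζ n y : ℝ) - a) / ((n : ℝ) + 1)) ∂Λ) atTop
      (𝓝 (∫⁻ y, γ y * H (d y) ∂Λ)) := by
    intro a
    refine tendsto_lintegral_of_dominated_convergence γ (fun n => ?_)
      (fun n => Eventually.of_forall fun y => mul_le_of_le_one_right' (eneg_le_one _)) hγi ?_
    · refine hγ.mul (hHm.comp ?_)
      exact ((measurable_from_top.comp (hζm n)).sub_const a).div_const _
    · filter_upwards [hae, hγae] with y hy hy'
      exact ENNReal.Tendsto.const_mul (hy.tendsto.comp (hlim a (d y))) (Or.inr hy'.ne)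
  have hgrid : ∀ (a : ℝ) (n : ℕ),
      ∫⁻ ω, ∑' p, γ (x p ω) * eneg (∑' q : {q // q ≠ p}, w (((ζ n (x p ω) : ℝ) - a) / ((n : ℝ) + 1)) (x q ω)) ∂μ =
      ∫⁻ y, γ y * H (((ζ n y : ℝ) - a) / ((n : ℝ) + 1)) ∂Λ := fun a n =>
    h.mecke_int (w := fun z => w (((z : ℝ) - a) / ((n : ℝ) + 1))) hγ hγi (fun z => hw _) (hζm n)
  -- `eneg` reverses order: the lower grid bounds the left side from above, the upper grid from
  -- below. Both bounds converge to the right side.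
  refine le_antisymm ?_ ?_
  · refine ge_of_tendsto' (hconv 1) fun n => ?_
    rw [← hgrid 1 n]
    refine lintegral_mono fun ω => ENNReal.tsum_le_tsum fun p => ?_
    gcongr
    refine antitone_eneg (ENNReal.tsum_le_tsum fun q => hmono ?_ _)
    rw [div_le_iff₀ (by positivity)]
    have := Int.ceil_lt_add_one (((n : ℝ) + 1) * d (x p ω))
    simp only [hζ]; linarith
  · refine le_of_tendsto' (hconv 0) fun n => ?_
    rw [← hgrid 0 n]
    refine lintegral_mono fun ω => ENNReal.tsum_le_tsum fun p => ?_
    gcongr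
    refine antitone_eneg (ENNReal.tsum_le_tsum fun q => hmono ?_ _)
    rw [le_div_iff₀ (by positivity)]
    have := Int.le_ceil (((n : ℝ) + 1) * d (x p ω))
    simp only [hζ]; linarith

end HasPoissonLaplace

/-! ### The marked Poisson process of a network -/

instance : MeasurableSpace Channel := ⊤

instance : DiscreteMeasurableSpace Channel := ⟨fun _ => trivial⟩

lemma sum_channel {M : Type*} [AddCommMonoid M] (f : Channel → M) : ∑ c, f c = f .los + f .nlos :=
  Finset.sum_pair (by simp)

namespace Params

variable {K : ℕ} (N : Params K)

lemma rhoLoS_nonneg (k : Fin K) (x : ℝ) : 0 ≤ N.rhoLoS k x := by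
  unfold rhoLoS
  have := N.a_nonneg
  positivity

lemma rhoLoS_le_one (k : Fin K) (x : ℝ) : N.rhoLoS k x ≤ 1 := by
  unfold rhoLoS
  have := N.a_nonneg
  rw [div_le_one (by positivity)]
  have : 0 ≤ N.a * Real.exp (-N.b * (Real.arcsin (N.h k / x) - N.a)) := by positivity
  linarith

lemma rho_nonneg (k : Fin K) (c : Channel) (x : ℝ) : 0 ≤ N.rho k c x := by
  cases c
  · exact N.rhoLoS_nonneg k x
  · exact sub_nonneg.2 (N.rhoLoS_le_one k x)

lemma rho_le_one (k : Fin K) (c : Channel) (x : ℝ) : N.rho k c x ≤ 1 := by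
  cases c
  · exact N.rhoLoS_le_one k x
  · exact sub_le_self _ (N.rhoLoS_nonneg k x)

@[fun_prop]
lemma measurable_rho (k : Fin K) (c : Channel) : Measurable (N.rho k c) := by
  have : Measurable (N.rhoLoS k) := by unfold rhoLoS; fun_prop
  cases c
  · exact this
  · exact measurable_const.sub this

lemma sum_ofReal_rho (k : Fin K) (x : ℝ) : ∑ c, ENNReal.ofReal (N.rho k c x) = 1 := by
  rw [sum_channel, ← ENNReal.ofReal_add (N.rho_nonneg _ _ _) (N.rho_nonneg _ _ _)]
  simp [rho]

@[fun_prop]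
lemma measurable_linkDist (k : Fin K) : Measurable (N.linkDist k) := by
  unfold linkDist; fun_prop

lemma m_pos (c : Channel) : (0 : ℝ) < N.m c := by exact_mod_cast N.one_le_m c

instance (c : Channel) : IsProbabilityMeasure (N.gainLaw c) :=
  isProbabilityMeasure_gammaMeasure (N.m_pos c) (N.m_pos c)

/-- The mean of `φ (z, state, gain)` over the state and the gain of the link of a node of layer `k`
above `z`. -/
def markMean (k : Fin K) (φ : Plane × Channel × ℝ → ℝ≥0∞) (z : Plane) : ℝ≥0∞ :=
  ∑ c, ENNReal.ofReal (N.rho k c (N.linkDist k z)) * ∫⁻ g, φ (z, c, g) ∂(N.gainLaw c)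

lemma measurable_section {φ : Plane × Channel × ℝ → ℝ≥0∞} (hφ : Measurable φ) (c : Channel) :
    Measurable fun q : Plane × ℝ => φ (q.1, c, q.2) :=
  hφ.comp (measurable_fst.prodMk (measurable_const.prodMk measurable_snd))

lemma measurable_markMean (k : Fin K) {φ : Plane × Channel × ℝ → ℝ≥0∞} (hφ : Measurable φ) :
    Measurable (N.markMean k φ) := by
  unfold markMean
  refine Finset.measurable_sum _ fun c _ => Measurable.mul (by fun_prop) ?_
  exact (measurable_section hφ c).lintegral_prod_right'

lemma markMean_le_one (k : Fin K) {φ : Plane × Channel × ℝ → ℝ≥0∞} (hφ : ∀ x, φ x ≤ 1) (z : Plane) :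
    N.markMean k φ z ≤ 1 := by
  rw [← N.sum_ofReal_rho k (N.linkDist k z)]
  refine Finset.sum_le_sum fun c _ => mul_le_of_le_one_right' ?_
  calc ∫⁻ g, φ (z, c, g) ∂(N.gainLaw c) ≤ ∫⁻ _, 1 ∂(N.gainLaw c) := lintegral_mono fun g => hφ _
    _ = 1 := by simp

lemma markMean_one_sub (k : Fin K) {φ : Plane × Channel × ℝ → ℝ≥0∞} (hφ : Measurable φ)
    (hφ1 : ∀ x, φ x ≤ 1) (z : Plane) :
    N.markMean k (fun x => 1 - φ x) z = 1 - N.markMean k φ z := by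
  refine ENNReal.eq_sub_of_add_eq' ENNReal.one_ne_top ?_
  unfold markMean
  rw [← Finset.sum_add_distrib]
  refine (Finset.sum_congr rfl fun c _ => ?_).trans (N.sum_ofReal_rho k (N.linkDist k z))
  have hm : Measurable fun g => φ (z, c, g) := (measurable_section hφ c).comp (measurable_const.prodMk measurable_id)
  rw [← mul_add, ← lintegral_add_right _ hm]
  simp [tsub_add_cancel_of_le (hφ1 _)]

/-- The law of the marked points over a layer with positions distributed according to `ν`. -/
def markedMeasure (k : Fin K) (ν : Measure Plane) : Measure (Plane × Channel × ℝ) :=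
  ∑ c, ((ν.withDensity fun z => ENNReal.ofReal (N.rho k c (N.linkDist k z))).prod (N.gainLaw c)).map
    fun q => (q.1, c, q.2)

lemma lintegral_markedMeasure (k : Fin K) (ν : Measure Plane) [SFinite ν]
    {φ : Plane × Channel × ℝ → ℝ≥0∞} (hφ : Measurable φ) :
    ∫⁻ x, φ x ∂(N.markedMeasure k ν) = ∫⁻ z, N.markMean k φ z ∂ν := by
  unfold markedMeasure markMean
  have hr : ∀ c, Measurable fun z => ENNReal.ofReal (N.rho k c (N.linkDist k z)) := fun c => by fun_prop
  have hrm : ∀ c, Measurable fun z => ENNReal.ofReal (N.rho k c (N.linkDist k z)) *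
      ∫⁻ g, φ (z, c, g) ∂(N.gainLaw c) := fun c =>
    (hr c).mul (measurable_section hφ c).lintegral_prod_right'
  rw [lintegral_finsetSum_measure, lintegral_finsetSum _ fun c _ => hrm c]
  refine Finset.sum_congr rfl fun c _ => ?_
  rw [lintegral_map hφ (by fun_prop), lintegral_prod _ (measurable_section hφ c).aemeasurable,
    lintegral_withDensity_eq_lintegral_mul _ (hr c) (measurable_section hφ c).lintegral_prod_right']
  rfl

/-- The intensity measure of the marked points of all layers. -/
def intensity : Measure (Fin K × Plane × Channel × ℝ) :=
  ∑ k, (N.markedMeasure k (ENNReal.ofReal (N.lam k) • volume)).map (Prod.mk k)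

lemma lintegral_intensity {φ : Fin K × Plane × Channel × ℝ → ℝ≥0∞} (hφ : Measurable φ) :
    ∫⁻ x, φ x ∂N.intensity =
      ∑ k, ∫⁻ z, N.markMean k (fun x => φ (k, x)) z ∂(ENNReal.ofReal (N.lam k) • (volume : Measure Plane)) := by
  unfold intensity
  rw [lintegral_finsetSum_measure]
  refine Finset.sum_congr rfl fun k _ => ?_
  have hk : Measurable fun x => φ (k, x) := hφ.comp measurable_prodMk_left
  rw [lintegral_map hφ measurable_prodMk_left, lintegral_markedMeasure _ _ _ hk]

end Params

/-! ### Averaging over link states and gains -/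

namespace Network

variable {K : ℕ} {N : Params K} {Ω : Type*} [MeasurableSpace Ω] {μ : Measure Ω}
  (W : Network N μ)

lemma measurable_pos (k : Fin K) (i : ℕ) : Measurable (W.pos k i) := (W.poisson k).measurable i

lemma measurable_chan' (p : Node K) : Measurable (W.chan p) :=
  measurable_to_countable' fun c => W.measurable_chan p c

/-- Position, link state and gain of a node. -/
def mark (p : Node K) (ω : Ω) : Plane × Channel × ℝ := (W.pos p.1 p.2 ω, W.chan p ω, W.gain p ω)

lemma measurable_mark (p : Node K) : Measurable (W.mark p) :=
  (W.measurable_pos _ _).prodMk ((W.measurable_chan' p).prodMk (W.measurable_gain p))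

/-- `φ` is the indicator function of a measurable rectangle. -/
def IsRect (φ : Plane × Channel × ℝ → ℝ≥0∞) : Prop :=
  ∃ (D : Set Plane) (c : Channel) (B : Set ℝ), MeasurableSet D ∧ MeasurableSet B ∧
    φ = (D ×ˢ ({c} : Set Channel) ×ˢ B).indicator 1

lemma IsRect.measurable {φ : Plane × Channel × ℝ → ℝ≥0∞} (h : IsRect φ) : Measurable φ := by
  obtain ⟨D, c, B, hD, hB, rfl⟩ := h
  exact measurable_one.indicator (hD.prod ((measurableSet_singleton c).prod hB))

lemma IsRect.le_one {φ : Plane × Channel × ℝ → ℝ≥0∞} (h : IsRect φ) (x) : φ x ≤ 1 := by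
  obtain ⟨D, c, B, hD, hB, rfl⟩ := h
  exact indicator_le_self _ _ x

lemma markMean_rect (k : Fin K) (D : Set Plane) (c : Channel) {B : Set ℝ} (hB : MeasurableSet B) (z : Plane) :
    N.markMean k ((D ×ˢ ({c} : Set Channel) ×ˢ B).indicator 1) z =
      D.indicator (fun z => ENNReal.ofReal (N.rho k c (N.linkDist k z)) * N.gainLaw c B) z := by
  unfold Params.markMean
  rw [Finset.sum_eq_single c]
  · by_cases hz : z ∈ D
    · rw [indicator_of_mem hz, ← lintegral_indicator_one hB]
      congr 2
      ext g
      by_cases hg : g ∈ B <;> simp [hz, hg]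
    · simp [hz]
  · intro c' _ hc'
    simp [hc']
  · simp

/-- This is the field `marks` for the event that the nodes in `S` have their positions in the
prescribed sets `D p`. -/
lemma lintegral_prod_rect [IsProbabilityMeasure μ] (S : Finset (Node K))
    (φ : Node K → Plane × Channel × ℝ → ℝ≥0∞) (hφ : ∀ p, IsRect (φ p)) :
    ∫⁻ ω, ∏ p ∈ S, φ p (W.mark p ω) ∂μ =
      ∫⁻ ω, ∏ p ∈ S, N.markMean p.1 (φ p) (W.pos p.1 p.2 ω) ∂μ := by
  classical
  choose D c B hD hB hφ using hφ
  set E : Set (Fin K → ℕ → Plane) := {x | ∀ p ∈ S, x p.1 p.2 ∈ D p} with hE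
  have hEm : MeasurableSet E := by
    have : E = ⋂ p ∈ S, (fun x : Fin K → ℕ → Plane => x p.1 p.2) ⁻¹' D p := by
      ext x; simp [hE]
    rw [this]
    exact Finset.measurableSet_biInter _ fun p _ =>
      ((measurable_pi_apply p.2).comp (measurable_pi_apply p.1)) (hD p)
  have hposm : Measurable fun ω => (fun k i => W.pos k i ω : Fin K → ℕ → Plane) :=
    measurable_pi_lambda _ fun k => measurable_pi_lambda _ fun i => W.measurable_pos k i
  have hset : {ω | (fun k i => W.pos k i ω) ∈ E ∧ ∀ p ∈ S, W.chan p ω = c p ∧ W.gain p ω ∈ B p} =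
      ⋂ p ∈ S, W.mark p ⁻¹' (D p ×ˢ ({c p} : Set Channel) ×ˢ B p) := by
    ext ω
    simp only [hE, mem_ofPred_eq, mem_iInter, mem_preimage, mark, mem_prod, mem_singleton_iff]
    exact ⟨fun h p hp => ⟨h.1 p hp, h.2 p hp⟩, fun h => ⟨fun p hp => (h p hp).1, fun p hp => (h p hp).2⟩⟩
  have hsm : MeasurableSet (⋂ p ∈ S, W.mark p ⁻¹' (D p ×ˢ ({c p} : Set Channel) ×ˢ B p)) :=
    Finset.measurableSet_biInter _ fun p _ =>
      W.measurable_mark p ((hD p).prod ((measurableSet_singleton _).prod (hB p)))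
  have h := W.marks E hEm S c B hB
  have hEm' : MeasurableSet {ω | (fun k i => W.pos k i ω) ∈ E} := hposm hEm
  rw [hset, ← lintegral_indicator_one hsm, ← lintegral_indicator hEm'] at h
  refine Eq.trans (lintegral_congr fun ω => ?_) (h.trans (lintegral_congr fun ω => ?_))
  · simp_rw [hφ]
    by_cases hω : ∀ p ∈ S, W.mark p ω ∈ D p ×ˢ ({c p} : Set Channel) ×ˢ B p
    · rw [indicator_of_mem (by simpa using hω)]
      exact Finset.prod_eq_one fun p hp => by rw [indicator_of_mem (hω p hp)]; rfl
    · rw [indicator_of_notMem (by simpa using hω)]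
      push Not at hω
      obtain ⟨p, hp, hn⟩ := hω
      exact Finset.prod_eq_zero hp (indicator_of_notMem hn _)
  · simp_rw [hφ, markMean_rect _ _ _ (hB _)]
    by_cases hω : (fun k i => W.pos k i ω) ∈ E
    · rw [indicator_of_mem (show ω ∈ {ω | (fun k i => W.pos k i ω) ∈ E} from hω)]
      exact Finset.prod_congr rfl fun p hp => by rw [indicator_of_mem (hω p hp)]
    · rw [indicator_of_notMem (show ω ∉ {ω | (fun k i => W.pos k i ω) ∈ E} from hω)]
      simp only [hE, mem_ofPred_eq] at hω
      push Not at hω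
      obtain ⟨p, hp, hn⟩ := hω
      exact (Finset.prod_eq_zero hp (indicator_of_notMem hn _)).symm

/-- Reduces boxes with any set of states to those with a single state, the only ones that `IsRect`
admits. -/
lemma channel_slices {m : Measure (Plane × Channel × ℝ)} {s : Set Plane} (t : Set Channel) {u : Set ℝ}
    (hs : MeasurableSet s) (hu : MeasurableSet u) :
    m (s ×ˢ t ×ˢ u) = ∑ c ∈ t.toFinite.toFinset, m (s ×ˢ ({c} : Set Channel) ×ˢ u) := by
  have : s ×ˢ t ×ˢ u = ⋃ c ∈ t.toFinite.toFinset, s ×ˢ ({c} : Set Channel) ×ˢ u := by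
    ext ⟨z, c, g⟩
    simp only [mem_prod, mem_iUnion, mem_singleton_iff, Finite.mem_toFinset, exists_prop]
    exact ⟨fun ⟨h1, h2, h3⟩ => ⟨c, h2, h1, rfl, h3⟩, fun ⟨c', h2, h1, h, h3⟩ => ⟨h1, h ▸ h2, h3⟩⟩
  rw [this, measure_biUnion_finset]
  · intro c _ c' _ hcc
    simp only [Function.onFun]
    rw [Set.disjoint_left]
    rintro ⟨z, e, g⟩ ⟨-, h1, -⟩ ⟨-, h2, -⟩
    exact hcc (h1.symm.trans h2)
  · exact fun c _ => hs.prod ((measurableSet_singleton c).prod hu)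

/-- Averaging over the states and gains of finitely many nodes. -/
theorem lintegral_prod_mark [IsProbabilityMeasure μ] (S : Finset (Node K))
    (φ : Node K → Plane × Channel × ℝ → ℝ≥0∞) (hφ : ∀ p, Measurable (φ p)) (hφ1 : ∀ p x, φ p x ≤ 1) :
    ∫⁻ ω, ∏ p ∈ S, φ p (W.mark p ω) ∂μ =
      ∫⁻ ω, ∏ p ∈ S, N.markMean p.1 (φ p) (W.pos p.1 p.2 ω) ∂μ := by
  classical
  have key : ∀ φ : Node K → Plane × Channel × ℝ → ℝ≥0∞, (∀ p, Measurable (φ p)) → (∀ p x, φ p x ≤ 1) →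
      (∀ p, p ∉ S → IsRect (φ p)) →
      ∫⁻ ω, ∏ p ∈ S, φ p (W.mark p ω) ∂μ =
        ∫⁻ ω, ∏ p ∈ S, N.markMean p.1 (φ p) (W.pos p.1 p.2 ω) ∂μ := by
    -- Induction on the set `T` of nodes whose function may be arbitrary; the other functions are
    -- still indicators of rectangles.
    suffices ∀ T : Finset (Node K), T ⊆ S →
        ∀ φ : Node K → Plane × Channel × ℝ → ℝ≥0∞, (∀ p, Measurable (φ p)) → (∀ p x, φ p x ≤ 1) →
        (∀ p, p ∉ T → IsRect (φ p)) →
        ∫⁻ ω, ∏ p ∈ S, φ p (W.mark p ω) ∂μ =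
          ∫⁻ ω, ∏ p ∈ S, N.markMean p.1 (φ p) (W.pos p.1 p.2 ω) ∂μ from this S subset_rfl
    intro T
    induction T using Finset.induction_on with
    | empty => exact fun _ φ _ _ hr => W.lintegral_prod_rect S φ fun p => hr p (by simp)
    | insert a T haT ih =>
      intro hTS φ hφ hφ1 hr
      have haS : a ∈ S := hTS (Finset.mem_insert_self a T)
      -- With the other factors frozen, both sides are integrals of `φ a` against measures `m1` and
      -- `m2` on the mark space. The induction hypothesis makes these agree on rectangles, hence
      -- everywhere.
      set Y : Ω → ℝ≥0∞ := fun ω => ∏ p ∈ S.erase a, φ p (W.mark p ω) with hY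
      set Z : Ω → ℝ≥0∞ := fun ω => ∏ p ∈ S.erase a, N.markMean p.1 (φ p) (W.pos p.1 p.2 ω) with hZ
      have hYm : Measurable Y := Finset.measurable_prod _ fun p _ => (hφ p).comp (W.measurable_mark p)
      have hZm : Measurable Z := Finset.measurable_prod _ fun p _ =>
        (N.measurable_markMean p.1 (hφ p)).comp (W.measurable_pos _ _)
      set m1 : Measure (Plane × Channel × ℝ) := (μ.withDensity Y).map (W.mark a)
      set m2 : Measure (Plane × Channel × ℝ) :=
        N.markedMeasure a.1 ((μ.withDensity Z).map (W.pos a.1 a.2))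
      have hl1 : ∀ ψ, Measurable ψ → ∫⁻ x, ψ x ∂m1 = ∫⁻ ω, ψ (W.mark a ω) * Y ω ∂μ := by
        intro ψ hψ
        have hψ' : Measurable fun ω => ψ (W.mark a ω) := hψ.comp (W.measurable_mark a)
        rw [lintegral_map hψ (W.measurable_mark a), lintegral_withDensity_eq_lintegral_mul _ hYm hψ']
        exact lintegral_congr fun ω => mul_comm _ _
      have hl2 : ∀ ψ, Measurable ψ →
          ∫⁻ x, ψ x ∂m2 = ∫⁻ ω, N.markMean a.1 ψ (W.pos a.1 a.2 ω) * Z ω ∂μ := by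
        intro ψ hψ
        have hm := N.measurable_markMean a.1 hψ
        have hm' : Measurable fun ω => N.markMean a.1 ψ (W.pos a.1 a.2 ω) :=
          hm.comp (W.measurable_pos _ _)
        rw [N.lintegral_markedMeasure _ _ hψ, lintegral_map hm (W.measurable_pos _ _),
          lintegral_withDensity_eq_lintegral_mul _ hZm hm']
        exact lintegral_congr fun ω => mul_comm _ _
      have hfin : IsFiniteMeasure m1 := by
        refine ⟨?_⟩
        have := hl1 1 measurable_one
        simp only [Pi.one_apply, lintegral_one, one_mul] at this
        rw [this]
        calc ∫⁻ ω, Y ω ∂μ ≤ ∫⁻ _, 1 ∂μ :=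
              lintegral_mono fun ω => Finset.prod_le_one' fun p _ => hφ1 p _
          _ < ∞ := by simp
      have hrect : ∀ ψ, IsRect ψ → ∫⁻ x, ψ x ∂m1 = ∫⁻ x, ψ x ∂m2 := by
        intro ψ hψ
        rw [hl1 ψ hψ.measurable, hl2 ψ hψ.measurable]
        have := ih ((Finset.subset_insert a T).trans hTS) (Function.update φ a ψ)
          (fun p => by
            by_cases h : p = a
            · subst h; simpa using hψ.measurable
            · simpa [h] using hφ p)
          (fun p => by
            by_cases h : p = a
            · subst h; simpa using hψ.le_one
            · simpa [h] using hφ1 p)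
          (fun p hp => by
            by_cases h : p = a
            · subst h; simpa using hψ
            · simpa [h] using hr p (by simp [h, hp]))
        simp_rw [← Finset.mul_prod_erase S _ haS, Function.update_self] at this
        have e1 : ∀ ω, ∏ p ∈ S.erase a, Function.update φ a ψ p (W.mark p ω) = Y ω := fun ω =>
          Finset.prod_congr rfl fun p hp => by rw [Function.update_of_ne (Finset.ne_of_mem_erase hp)]
        have e2 : ∀ ω, ∏ p ∈ S.erase a, N.markMean p.1 (Function.update φ a ψ p) (W.pos p.1 p.2 ω) = Z ω := fun ω =>
          Finset.prod_congr rfl fun p hp => by rw [Function.update_of_ne (Finset.ne_of_mem_erase hp)]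
        simp_rw [e1, e2] at this
        exact this
      have hm : m1 = m2 := by
        refine Measure.ext_prod₃ fun {s t u} hs _ hu => ?_
        rw [channel_slices t hs hu, channel_slices t hs hu]
        refine Finset.sum_congr rfl fun c _ => ?_
        have := hrect _ ⟨s, c, u, hs, hu, rfl⟩
        have hms := hs.prod ((measurableSet_singleton c).prod hu)
        rwa [lintegral_indicator_one hms, lintegral_indicator_one hms] at this
      simp_rw [← Finset.mul_prod_erase S _ haS]
      rw [← hl1 _ (hφ a), ← hl2 _ (hφ a), hm]
  have hrect1 : IsRect ((univ ×ˢ ({Channel.los} : Set Channel) ×ˢ univ).indicator 1) :=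
    ⟨univ, .los, univ, .univ, .univ, rfl⟩
  -- Functions at nodes outside `S` do not enter the products, so they may be replaced by a
  -- rectangle.
  have := key (fun p => if p ∈ S then φ p else (univ ×ˢ ({Channel.los} : Set Channel) ×ˢ univ).indicator 1)
    (fun p => by split_ifs; exacts [hφ p, hrect1.measurable])
    (fun p => by split_ifs; exacts [hφ1 p, hrect1.le_one])
    (fun p hp => by rw [if_neg hp]; exact hrect1)
  refine Eq.trans (lintegral_congr fun ω => ?_) (this.trans (lintegral_congr fun ω => ?_))
  · exact Finset.prod_congr rfl fun p hp => by rw [if_pos hp]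
  · exact Finset.prod_congr rfl fun p hp => by rw [if_pos hp]

/-- Layer, position, link state and gain of a node. -/
def point (p : Node K) (ω : Ω) : Fin K × Plane × Channel × ℝ := (p.1, W.mark p ω)

/-- Marks can be averaged out for finitely many nodes at a time; this passes to all nodes, along the
countably generated filter of finite sets. -/
lemma tendsto_lintegral_prod_eneg [IsProbabilityMeasure μ] {f : Node K → Ω → ℝ≥0∞}
    (hf : ∀ p, Measurable (f p)) :
    Tendsto (fun S : Finset (Node K) => ∫⁻ ω, ∏ p ∈ S, eneg (f p ω) ∂μ) atTop
      (𝓝 (∫⁻ ω, eneg (∑' p, f p ω) ∂μ)) := by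
  simp_rw [← eneg_sum]
  refine tendsto_lintegral_filter_of_dominated_convergence (fun _ => 1) ?_ ?_ (by simp) ?_
  · exact Eventually.of_forall fun S => measurable_eneg.comp (Finset.measurable_sum _ fun p _ => hf p)
  · exact Eventually.of_forall fun S => Eventually.of_forall fun ω => eneg_le_one _
  · exact Eventually.of_forall fun ω => (continuous_eneg.tendsto _).comp ENNReal.summable.hasSum

/-- The marked points form a Poisson process, as far as its Laplace functional is concerned. -/
theorem hasPoissonLaplace [IsProbabilityMeasure μ] : HasPoissonLaplace W.point N.intensity μ := by
  refine ⟨fun p => measurable_const.prodMk (W.measurable_mark p), fun w hw => ?_⟩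
  have hwk : ∀ k, Measurable fun x => w (k, x) := fun k => hw.comp measurable_prodMk_left
  have hek : ∀ k, Measurable fun x => eneg (w (k, x)) := fun k => measurable_eneg.comp (hwk k)
  set v : Fin K → Plane → ℝ≥0∞ := fun k => N.markMean k fun x => eneg (w (k, x)) with hv
  have hvm : ∀ k, Measurable (v k) := fun k => N.measurable_markMean k (hek k)
  have hv1 : ∀ k z, v k z ≤ 1 := fun k z => N.markMean_le_one k (fun x => eneg_le_one _) z
  have hlm : ∀ k i, Measurable fun ω => nlog (v k (W.pos k i ω)) := fun k i =>
    measurable_nlog.comp ((hvm k).comp (W.measurable_pos k i))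
  -- Averaging over its mark turns the factor of a node at `z` into `v k z ∈ [0, 1]`. Written as
  -- `eneg (nlog (v k z))`, this is a Laplace functional of the positions alone.
  have h1 : ∫⁻ ω, eneg (∑' p, w (W.point p ω)) ∂μ =
      ∫⁻ ω, eneg (∑' p : Node K, nlog (v p.1 (W.pos p.1 p.2 ω))) ∂μ := by
    have t1 := tendsto_lintegral_prod_eneg (μ := μ) (f := fun p ω => w (W.point p ω))
      (fun p => (hwk p.1).comp (W.measurable_mark p))
    have t2 := tendsto_lintegral_prod_eneg (μ := μ)
      (f := fun p : Node K => fun ω => nlog (v p.1 (W.pos p.1 p.2 ω))) (fun p => hlm p.1 p.2)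
    have he : ∀ S : Finset (Node K), ∫⁻ ω, ∏ p ∈ S, eneg (w (W.point p ω)) ∂μ =
        ∫⁻ ω, ∏ p ∈ S, eneg (nlog (v p.1 (W.pos p.1 p.2 ω))) ∂μ := by
      intro S
      simp_rw [eneg_nlog (hv1 _ _)]
      exact W.lintegral_prod_mark S (fun p x => eneg (w (p.1, x))) (fun p => hek p.1) (fun p x => eneg_le_one _)
    simp_rw [he] at t1
    exact tendsto_nhds_unique t1 t2
  rw [h1]
  have h2 : ∀ ω, eneg (∑' p : Node K, nlog (v p.1 (W.pos p.1 p.2 ω))) =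
      ∏ k, eneg (∑' i, nlog (v k (W.pos k i ω))) := fun ω => by
    rw [ENNReal.tsum_prod (f := fun k i => nlog (v k (W.pos k i ω))), tsum_fintype, eneg_sum]
  simp_rw [h2]
  have hind : iIndepFun (fun k ω => eneg (∑' i, nlog (v k (W.pos k i ω)))) μ := by
    refine W.indep_layers.comp (fun k (z : ℕ → Plane) => eneg (∑' i, nlog (v k (z i)))) fun k => ?_
    exact measurable_eneg.comp (Measurable.tsum fun i =>
      measurable_nlog.comp ((hvm k).comp (measurable_pi_apply i)))
  rw [lintegral_prod_eq_prod_lintegral_of_indepFun Finset.univ _ hind fun k =>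
    measurable_eneg.comp (Measurable.tsum fun i => hlm k i)]
  have hew : Measurable fun y => 1 - eneg (w y) := (measurable_eneg.comp hw).const_sub 1
  rw [N.lintegral_intensity hew, eneg_sum]
  refine Finset.prod_congr rfl fun k _ => ?_
  have hsf : SigmaFinite (ENNReal.ofReal (N.lam k) • (volume : Measure Plane)) :=
    inferInstanceAs (SigmaFinite ((N.lam k).toNNReal • (volume : Measure Plane)))
  have hnm : Measurable fun z => nlog (v k z) := measurable_nlog.comp (hvm k)
  rw [(W.poisson k).laplace hnm]
  congr 1
  refine lintegral_congr fun z => ?_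
  rw [eneg_nlog (hv1 k z), N.markMean_one_sub k (hek k) (fun x => eneg_le_one _)]

end Network

/-! ### Lengths of links and closed forms -/

/-- Exponential tilting takes the Gamma density of rate `m` to a constant times the one of rate `m +
t`, which again has mass one. -/
lemma lintegral_gammaMeasure_eneg {m : ℕ} (hm : 1 ≤ m) {t : ℝ} (ht : 0 ≤ t) :
    ∫⁻ g, eneg (ENNReal.ofReal (t * g)) ∂(gammaMeasure (m : ℝ) (m : ℝ)) =
      ENNReal.ofReal ((1 / (1 + t / m)) ^ m) := by
  have hm0 : (0 : ℝ) < m := by exact_mod_cast hm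
  have hmeas : Measurable fun g : ℝ => eneg (ENNReal.ofReal (t * g)) := by fun_prop
  have hpdf : ∀ r : ℝ, Measurable (gammaPDF m r) := fun r => (measurable_gammaPDFReal _ _).ennreal_ofReal
  rw [gammaMeasure, lintegral_withDensity_eq_lintegral_mul _ (hpdf m) hmeas]
  have h1 : ∀ g, (gammaPDF m m * fun g : ℝ => eneg (ENNReal.ofReal (t * g))) g =
      ENNReal.ofReal ((1 / (1 + t / m)) ^ m) * gammaPDF m (m + t) g := by
    intro g
    rcases lt_or_ge g 0 with hg | hg
    · simp [gammaPDF_of_neg hg]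
    · rw [Pi.mul_apply, gammaPDF_of_nonneg hg, gammaPDF_of_nonneg hg, eneg_ofReal (by positivity),
        ← ENNReal.ofReal_mul (by positivity), ← ENNReal.ofReal_mul (by positivity)]
      congr 1
      have e1 : Real.exp (-((m + t) * g)) = Real.exp (-(m * g)) * Real.exp (-(t * g)) := by
        rw [← Real.exp_add]; ring_nf
      have e2 : (1 / (1 + t / m)) ^ m * ((m : ℝ) + t) ^ m = (m : ℝ) ^ m := by
        rw [← mul_pow]; congr 1; field_simp
      rw [e1, Real.rpow_natCast, Real.rpow_natCast, ← e2]
      ring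
  simp_rw [h1]
  rw [lintegral_const_mul _ (hpdf _),
    lintegral_gammaPDF_eq_one hm0 (by positivity), mul_one]

namespace Params

variable {K : ℕ} (N : Params K)

lemma linkDist_ge (k : Fin K) (z : Plane) : N.h k ≤ N.linkDist k z := by
  unfold linkDist
  exact Real.le_sqrt_of_sq_le (by nlinarith [sq_nonneg ‖z - N.xrec‖])

lemma linkDist_pos (k : Fin K) (z : Plane) : 0 < N.linkDist k z :=
  (N.h_pos k).trans_le (N.linkDist_ge k z)

lemma linkDist_le_iff (k : Fin K) {t : ℝ} (ht : N.h k ≤ t) (z : Plane) :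
    N.linkDist k z ≤ t ↔ z ∈ Metric.closedBall N.xrec (Real.sqrt (t ^ 2 - N.h k ^ 2)) := by
  have hh := N.h_pos k
  rw [linkDist, Real.sqrt_le_left (by linarith), Metric.mem_closedBall, dist_eq_norm,
    Real.le_sqrt (norm_nonneg _) (by nlinarith)]
  constructor <;> intro h <;> linarith

/-- Links of length at most `t ≥ h` come from a disc of area `π (t ^ 2 - h ^ 2)`, whose derivative
in `t` is `2 π t`. The two measures are compared on half-lines. -/
lemma map_linkDist (k : Fin K) :
    (volume : Measure Plane).map (N.linkDist k) =
      ((volume : Measure ℝ).restrict (Ioi (N.h k))).withDensity fun x => ENNReal.ofReal (2 * Real.pi * x) := by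
  have hh := N.h_pos k
  have h1 : ∀ t, ((volume : Measure Plane).map (N.linkDist k)) (Iic t) =
      ENNReal.ofReal (Real.pi * (max t (N.h k) ^ 2 - N.h k ^ 2)) := by
    intro t
    rw [Measure.map_apply (N.measurable_linkDist k) measurableSet_Iic]
    rcases lt_or_ge t (N.h k) with ht | ht
    · have : N.linkDist k ⁻¹' Iic t = ∅ := by
        ext z
        simpa using ht.trans_le (N.linkDist_ge k z)
      rw [this, max_eq_right ht.le]; simp
    · have : N.linkDist k ⁻¹' Iic t = Metric.closedBall N.xrec (Real.sqrt (t ^ 2 - N.h k ^ 2)) := by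
        ext z
        exact N.linkDist_le_iff k ht z
      rw [this, EuclideanSpace.volume_closedBall_fin_two, max_eq_left ht,
        ← ENNReal.ofReal_pow (Real.sqrt_nonneg _), ← ENNReal.ofReal_mul (by positivity),
        Real.sq_sqrt (by nlinarith), mul_comm]
  have h2 : ∀ t, (((volume : Measure ℝ).restrict (Ioi (N.h k))).withDensity
      fun x => ENNReal.ofReal (2 * Real.pi * x)) (Iic t) =
      ENNReal.ofReal (Real.pi * (max t (N.h k) ^ 2 - N.h k ^ 2)) := by
    intro t
    rw [withDensity_apply _ measurableSet_Iic, Measure.restrict_restrict measurableSet_Iic, inter_comm,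
      Ioi_inter_Iic]
    have e : Ioc (N.h k) t = Ioc (N.h k) (max t (N.h k)) := by
      rcases lt_or_ge t (N.h k) with ht | ht
      · rw [max_eq_right ht.le, Ioc_self, Ioc_eq_empty (by simpa using ht.le)]
      · rw [max_eq_left ht]
    rw [e, ← ofReal_integral_eq_lintegral_ofReal, ← intervalIntegral.integral_of_le (le_max_right _ _),
      intervalIntegral.integral_const_mul, integral_id]
    · congr 1; ring
    · exact (Continuous.integrableOn_Icc (by fun_prop)).mono_set Ioc_subset_Icc_self
    · refine (ae_restrict_iff' measurableSet_Ioc).2 (Eventually.of_forall fun x hx => ?_)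
      have : 0 < x := hh.trans hx.1
      simp only [Pi.zero_apply]; positivity
  refine Measure.ext_of_Ioc' _ _ (fun a b _ => ?_) (fun a b hab => ?_)
  · refine ne_top_of_le_ne_top ?_ (measure_mono Ioc_subset_Iic_self)
    rw [h1]; exact ENNReal.ofReal_ne_top
  · rw [← Iic_sdiff_Iic, measure_sdiff (Iic_subset_Iic.2 hab.le) nullMeasurableSet_Iic,
      measure_sdiff (Iic_subset_Iic.2 hab.le) nullMeasurableSet_Iic, h1, h1, h2, h2]
    · rw [h2]; exact ENNReal.ofReal_ne_top
    · rw [h1]; exact ENNReal.ofReal_ne_top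

lemma lintegral_linkDist (k : Fin K) {F : ℝ → ℝ≥0∞} (hF : Measurable F) :
    ∫⁻ z, F (N.linkDist k z) ∂(volume : Measure Plane) =
      ∫⁻ x in Ioi (N.h k), ENNReal.ofReal (2 * Real.pi * x) * F x := by
  rw [← lintegral_map hF (N.measurable_linkDist k), map_linkDist,
    lintegral_withDensity_eq_lintegral_mul _ (by fun_prop) hF]
  rfl

/-- The length of the link of a marked point. -/
def ptDist (x : Fin K × Plane × Channel × ℝ) : ℝ := N.linkDist x.1 x.2.1

/-- Layer and state take countably many values, so they can be fixed when measurability is checked.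
-/
lemma measurable_of_sections {β : Type*} [MeasurableSpace β] {φ : Fin K × Plane × Channel × ℝ → β}
    (h : ∀ k c, Measurable fun q : Plane × ℝ => φ (k, q.1, c, q.2)) : Measurable φ := by
  have h1 : Measurable fun q : (Fin K × Channel) × (Plane × ℝ) => φ (q.1.1, q.2.1, q.1.2, q.2.2) :=
    measurable_from_prod_countable_right fun kc => h kc.1 kc.2
  have h2 : Measurable fun x : Fin K × Plane × Channel × ℝ => ((x.1, x.2.2.1), (x.2.1, x.2.2.2)) := by
    fun_prop
  exact h1.comp h2

lemma measurable_ptDist : Measurable N.ptDist :=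
  measurable_of_sections fun k _ => (N.measurable_linkDist k).comp measurable_fst

lemma lintegral_ptDist {F : ℝ → ℝ≥0∞} (hF : Measurable F) :
    ∫⁻ x, F (N.ptDist x) ∂N.intensity =
      ∑ k, ENNReal.ofReal (N.lam k) * ∫⁻ x in Ioi (N.h k), ENNReal.ofReal (2 * Real.pi * x) * F x := by
  have hF' : Measurable fun x => F (N.ptDist x) := hF.comp N.measurable_ptDist
  rw [N.lintegral_intensity hF']
  refine Finset.sum_congr rfl fun k _ => ?_
  rw [lintegral_smul_measure, smul_eq_mul]
  congr 1
  rw [← N.lintegral_linkDist k hF]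
  refine lintegral_congr fun z => ?_
  unfold markMean ptDist
  simp [← Finset.sum_mul, sum_ofReal_rho]

/-- Absence of atoms here and local finiteness in `intensity_ptDist_le` are what Mecke's formula
demands of the parameter, the link length. -/
lemma intensity_ptDist_eq (t : ℝ) : N.intensity {x | N.ptDist x = t} = 0 := by
  have hm : MeasurableSet {x | N.ptDist x = t} := N.measurable_ptDist (measurableSet_singleton t)
  rw [← lintegral_indicator_one hm]
  have := N.lintegral_ptDist (F := ({t} : Set ℝ).indicator 1) (measurable_one.indicator (measurableSet_singleton t))
  refine this.trans (Finset.sum_eq_zero fun k _ => ?_)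
  have : ∫⁻ x in Ioi (N.h k), ENNReal.ofReal (2 * Real.pi * x) * ({t} : Set ℝ).indicator 1 x = 0 := by
    rw [lintegral_eq_zero_iff' (by
      refine AEMeasurable.mul (by fun_prop) ?_
      exact (measurable_one.indicator (measurableSet_singleton t)).aemeasurable)]
    refine ae_restrict_of_ae ?_
    filter_upwards [Measure.ae_ne volume t] with x hx
    simp [hx]
  rw [this, mul_zero]

lemma intensity_ptDist_le (t : ℝ) : N.intensity {x | N.ptDist x ≤ t} ≠ ∞ := by
  have hm : MeasurableSet {x | N.ptDist x ≤ t} := N.measurable_ptDist measurableSet_Iic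
  rw [← lintegral_indicator_one hm]
  have := N.lintegral_ptDist (F := (Iic t).indicator 1) (measurable_one.indicator measurableSet_Iic)
  refine ne_of_eq_of_ne this ?_
  rw [ne_eq, ENNReal.sum_eq_top]
  push Not
  intro k _
  refine ENNReal.mul_ne_top ENNReal.ofReal_ne_top ?_
  refine ne_top_of_le_ne_top (b := ∫⁻ x in Ioc (N.h k) t, ENNReal.ofReal (2 * Real.pi * t)) ?_ ?_
  · rw [lintegral_const]
    exact ENNReal.mul_ne_top ENNReal.ofReal_ne_top (by simp)
  · rw [← lintegral_indicator measurableSet_Ioi, ← lintegral_indicator measurableSet_Ioc]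
    refine lintegral_mono fun x => ?_
    by_cases h1 : N.h k < x
    · by_cases h2 : x ≤ t
      · simp only [mem_Ioi, h1, indicator_of_mem, mem_Iic, h2, Pi.one_apply, mul_one, mem_Ioc, and_self]
        apply ENNReal.ofReal_le_ofReal
        gcongr
      · simp [h2]
    · simp [h1]

/-! #### The weight that describes voids and interference -/

lemma α_pos (c : Channel) : 0 < N.α c := by linarith [N.two_le_α c]

lemma radius_mono (j k : Fin K) (c co : Channel) {y y' : ℝ} (hy : 0 ≤ y) (h : y ≤ y') :
    N.radius j c k co y ≤ N.radius j c k co y' := by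
  have := N.P_pos k
  have := N.P_pos j
  have := N.α_pos c
  have := N.α_pos co
  unfold radius
  gcongr

lemma radius_self (j : Fin K) (c : Channel) {y : ℝ} (hy : 0 ≤ y) : N.radius j c j c y = y := by
  rw [radius, mul_div_right_comm, div_self (N.P_pos j).ne', one_mul]
  rw [← Real.rpow_mul hy, mul_one_div, div_self (N.α_pos c).ne', Real.rpow_one]

lemma radius_lt_iff (j k : Fin K) (c co : Channel) {x y : ℝ} (hx : 0 < x) (hy : 0 < y) :
    N.radius j c k co y < x ↔ N.P k * x ^ (-N.α co) < N.P j * y ^ (-N.α c) := by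
  have h1 := N.P_pos k
  have h2 := N.P_pos j
  have h3 := N.α_pos co
  have hxa : 0 < x ^ N.α co := Real.rpow_pos_of_pos hx _
  have hya : 0 < y ^ N.α c := Real.rpow_pos_of_pos hy _
  rw [radius, one_div, Real.rpow_inv_lt_iff_of_pos (by positivity) hx.le h3, Real.rpow_neg hx.le, Real.rpow_neg hy.le,
    div_lt_iff₀ h2, ← div_eq_mul_inv, ← div_eq_mul_inv, div_lt_div_iff₀ hxa hya]
  rw [mul_comm (N.P j)]

/-- Exponent for the void of the nodes whose average received power exceeds that of the main link
of length `y`, and for the interference from the other ones. -/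
def weight (j : Fin K) (c : Channel) (s : ℝ) (y : ℝ) (x : Fin K × Plane × Channel × ℝ) : ℝ≥0∞ :=
  (if N.ptDist x ≤ N.radius j c x.1 x.2.2.1 (max y 0) then ∞ else 0) +
    ENNReal.ofReal s * ENNReal.ofReal (N.P x.1 * x.2.2.2 * N.ptDist x ^ (-N.α x.2.2.1))

/-- The cutoff `max y 0` in `weight` serves this statement: `radius` is monotone for nonnegative
lengths, whereas Mecke's formula asks for monotonicity on all of `ℝ`. -/
lemma weight_mono (j : Fin K) (c : Channel) (s : ℝ) : Monotone (N.weight j c s) := by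
  intro y y' h x
  unfold weight
  gcongr ?_ + _
  have := N.radius_mono j x.1 c x.2.2.1 (le_max_right y 0) (max_le_max_right 0 h)
  split_ifs with h1 h2
  · exact le_rfl
  · exact absurd (h1.trans this) h2
  · exact zero_le
  · exact le_rfl

lemma measurable_of_sections_prod {β : Type*} [MeasurableSpace β]
    {φ : ℝ × (Fin K × Plane × Channel × ℝ) → β}
    (h : ∀ k c, Measurable fun q : ℝ × Plane × ℝ => φ (q.1, k, q.2.1, c, q.2.2)) : Measurable φ := by
  have h1 : Measurable fun q : (Fin K × Channel) × (ℝ × Plane × ℝ) =>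
      φ (q.2.1, q.1.1, q.2.2.1, q.1.2, q.2.2.2) :=
    measurable_from_prod_countable_right fun kc => h kc.1 kc.2
  have h2 : Measurable fun q : ℝ × (Fin K × Plane × Channel × ℝ) =>
      ((q.2.1, q.2.2.2.1), (q.1, q.2.2.1, q.2.2.2.2)) := by fun_prop
  exact h1.comp h2

@[fun_prop]
lemma measurable_radius (j : Fin K) (c : Channel) (k : Fin K) (co : Channel) :
    Measurable (N.radius j c k co) := by
  unfold radius; fun_prop

lemma measurable_weight_uncurry (j : Fin K) (c : Channel) (s : ℝ) :
    Measurable fun q : ℝ × (Fin K × Plane × Channel × ℝ) => N.weight j c s q.1 q.2 := by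
  refine measurable_of_sections_prod fun k co => ?_
  have hd : Measurable fun q : ℝ × Plane × ℝ => N.linkDist k q.2.1 := by fun_prop
  have h1 : Measurable fun q : ℝ × Plane × ℝ =>
      if N.linkDist k q.2.1 ≤ N.radius j c k co (max q.1 0) then ∞ else (0 : ℝ≥0∞) :=
    Measurable.ite (measurableSet_le hd (by fun_prop)) measurable_const measurable_const
  have h2 : Measurable fun q : ℝ × Plane × ℝ =>
      ENNReal.ofReal s * ENNReal.ofReal (N.P k * q.2.2 * N.linkDist k q.2.1 ^ (-N.α co)) := by
    fun_prop
  exact h1.add h2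

lemma measurable_weight (j : Fin K) (c : Channel) (s y : ℝ) : Measurable (N.weight j c s y) := by
  have h : Measurable fun x : Fin K × Plane × Channel × ℝ => N.weight j c s y x :=
    Measurable.of_uncurry_left (f := N.weight j c s) (N.measurable_weight_uncurry j c s)
  exact h

lemma intervalIntegrable_rho (k : Fin K) (c : Channel) {a b : ℝ} (ha : 0 ≤ a) :
    IntegrableOn (fun x => 2 * Real.pi * N.lam k * x * N.rho k c x) (Ioc a b) := by
  have hl := N.lam_pos k
  refine Measure.integrableOn_of_bounded (M := 2 * Real.pi * N.lam k * b) (by simp) ?_ ?_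
  · exact (((measurable_const.mul measurable_id).mul (N.measurable_rho k c))).aestronglyMeasurable
  · refine (ae_restrict_iff' measurableSet_Ioc).2 (Eventually.of_forall fun x hx => ?_)
    have hx0 : 0 < x := ha.trans_lt hx.1
    have h0 := N.rho_nonneg k c x
    rw [Real.norm_of_nonneg (by positivity)]
    calc 2 * Real.pi * N.lam k * x * N.rho k c x ≤ 2 * Real.pi * N.lam k * x * 1 := by
          gcongr; exact N.rho_le_one k c x
      _ ≤ 2 * Real.pi * N.lam k * b := by rw [mul_one]; gcongr; exact hx.2

lemma ofReal_ccdfV (k : Fin K) (c : Channel) (v : ℝ) :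
    ENNReal.ofReal (N.ccdfV k c v) =
      eneg (∫⁻ x in Ioc (N.h k) (max v (N.h k)), ENNReal.ofReal (2 * Real.pi * N.lam k * x * N.rho k c x)) := by
  have hl := N.lam_pos k
  have hnn : 0 ≤ᵐ[volume.restrict (Ioc (N.h k) (max v (N.h k)))]
      fun x => 2 * Real.pi * N.lam k * x * N.rho k c x := by
    refine (ae_restrict_iff' measurableSet_Ioc).2 (Eventually.of_forall fun x hx => ?_)
    have hx0 : 0 < x := (N.h_pos k).trans hx.1
    have h0 := N.rho_nonneg k c x
    simp only [Pi.zero_apply]; positivity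
  rw [← ofReal_integral_eq_lintegral_ofReal (N.intervalIntegrable_rho k c (N.h_pos k).le) hnn,
    eneg_ofReal (integral_nonneg_of_ae hnn), ccdfV, intervalIntegral.integral_of_le (le_max_right _ _)]

/-- The transform of the gain of a link of length `x`. -/
def gainTransform (k : Fin K) (co : Channel) (s x : ℝ) : ℝ :=
  (1 / (1 + s * N.P k * x ^ (-N.α co) / N.m co)) ^ N.m co

lemma gainTransform_nonneg (k : Fin K) (co : Channel) {s x : ℝ} (hs : 0 ≤ s) (hx : 0 < x) :
    0 ≤ N.gainTransform k co s x := by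
  have := N.P_pos k
  unfold gainTransform; positivity

lemma gainTransform_le_one (k : Fin K) (co : Channel) {s x : ℝ} (hs : 0 ≤ s) (hx : 0 < x) :
    N.gainTransform k co s x ≤ 1 := by
  have := N.P_pos k
  have h : 0 ≤ s * N.P k * x ^ (-N.α co) / N.m co := by positivity
  unfold gainTransform
  exact pow_le_one₀ (by positivity) ((div_le_one (by positivity)).2 (by linarith))

lemma measurable_gainTransform (k : Fin K) (co : Channel) (s : ℝ) : Measurable (N.gainTransform k co s) := by
  unfold gainTransform; fun_prop

lemma lintegral_one_sub_weight (j k : Fin K) (c co : Channel) {s y : ℝ} (hs : 0 ≤ s) (hy : 0 ≤ y) (z : Plane) :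
    ∫⁻ g, (1 - eneg (N.weight j c s y (k, z, co, g))) ∂(N.gainLaw co) =
      if N.linkDist k z ≤ N.radius j c k co y then 1 else
        ENNReal.ofReal (1 - N.gainTransform k co s (N.linkDist k z)) := by
  have hd := N.linkDist_pos k z
  have hP := N.P_pos k
  unfold weight ptDist
  simp only [max_eq_left hy]
  split_ifs with h
  · simp
  · have hD : 0 < N.linkDist k z ^ (-N.α co) := Real.rpow_pos_of_pos hd _
    have e : ∀ g : ℝ, eneg (0 + ENNReal.ofReal s * ENNReal.ofReal (N.P k * g * N.linkDist k z ^ (-N.α co))) =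
        eneg (ENNReal.ofReal (s * N.P k * N.linkDist k z ^ (-N.α co) * g)) := by
      intro g
      rw [zero_add, ← ENNReal.ofReal_mul hs]
      ring_nf
    simp_rw [e]
    have hm : Measurable fun g : ℝ => eneg (ENNReal.ofReal (s * N.P k * N.linkDist k z ^ (-N.α co) * g)) := by
      fun_prop
    have hL := lintegral_gammaMeasure_eneg (N.one_le_m co) (t := s * N.P k * N.linkDist k z ^ (-N.α co)) (by positivity)
    have hfin : ∫⁻ g, eneg (ENNReal.ofReal (s * N.P k * N.linkDist k z ^ (-N.α co) * g)) ∂(N.gainLaw co) ≠ ∞ :=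
      ne_of_eq_of_ne hL ENNReal.ofReal_ne_top
    rw [lintegral_sub hm hfin (Eventually.of_forall fun g => eneg_le_one _)]
    rw [show ∫⁻ g, eneg (ENNReal.ofReal (s * N.P k * N.linkDist k z ^ (-N.α co) * g)) ∂(N.gainLaw co) = _ from hL]
    rw [ENNReal.ofReal_sub _ (N.gainTransform_nonneg k co hs hd)]
    simp [gainTransform]

/-- Split the range of lengths at `max R h`. Below it the weight is infinite, which leaves the void
exponent of `ccdfV`; above it the transform of the gain gives the exponent of `laplaceI`. -/
lemma lintegral_layer_weight (j k : Fin K) (c co : Channel) {s y : ℝ} (hs : 0 ≤ s) (hy : 0 ≤ y) :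
    eneg (∫⁻ z, ENNReal.ofReal (N.rho k co (N.linkDist k z)) *
        ∫⁻ g, (1 - eneg (N.weight j c s y (k, z, co, g))) ∂(N.gainLaw co)
          ∂(ENNReal.ofReal (N.lam k) • (volume : Measure Plane))) =
      ENNReal.ofReal (N.ccdfV k co (N.radius j c k co y)) * ENNReal.ofReal (N.laplaceI j c y k co s) := by
  have hl := N.lam_pos k
  have hh := N.h_pos k
  have hq := N.measurable_gainTransform k co s
  have hr := N.measurable_rho k co
  set R := N.radius j c k co y
  simp_rw [N.lintegral_one_sub_weight j k c co hs hy]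
  rw [lintegral_smul_measure, smul_eq_mul]
  have hF : Measurable fun x => ENNReal.ofReal (N.rho k co x) *
      (if x ≤ R then 1 else ENNReal.ofReal (1 - N.gainTransform k co s x)) :=
    hr.ennreal_ofReal.mul (Measurable.ite measurableSet_Iic measurable_const
      (hq.const_sub 1).ennreal_ofReal)
  rw [N.lintegral_linkDist k hF]
  rw [N.ofReal_ccdfV, laplaceI, ← eneg_eq_ofReal, ← eneg_add]
  congr 1
  rw [← lintegral_const_mul' _ _ ENNReal.ofReal_ne_top, ← lintegral_const_mul' _ _ ENNReal.ofReal_ne_top]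
  rw [← Ioc_union_Ioi_eq_Ioi (le_max_right R (N.h k)),
    lintegral_union measurableSet_Ioi (Ioc_disjoint_Ioi le_rfl)]
  congr 1
  · refine setLIntegral_congr_fun measurableSet_Ioc fun x hx => ?_
    have hx0 : 0 < x := hh.trans hx.1
    have hxR : x ≤ R := by
      rcases le_max_iff.1 hx.2 with h | h
      · exact h
      · exact absurd hx.1 (not_lt.2 h)
    have h0 := N.rho_nonneg k co x
    simp only [if_pos hxR, mul_one]
    rw [← ENNReal.ofReal_mul (by positivity), ← ENNReal.ofReal_mul (by positivity)]
    congr 1; ring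
  · refine setLIntegral_congr_fun measurableSet_Ioi fun x hx => ?_
    have hx1 : max R (N.h k) < x := hx
    have hx0 : 0 < x := (hh.trans_le (le_max_right _ _)).trans hx1
    have hxR : ¬ x ≤ R := not_le.2 ((le_max_left _ _).trans_lt hx1)
    have h0 := N.rho_nonneg k co x
    have h1 := N.gainTransform_le_one k co hs hx0
    simp only [if_neg hxR]
    rw [← ENNReal.ofReal_mul h0, ← ENNReal.ofReal_mul (by positivity), ← ENNReal.ofReal_mul (by positivity),
      ← ENNReal.ofReal_mul (by positivity)]
    congr 1
    rw [gainTransform]; ring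

lemma ccdfV_pos (k : Fin K) (c : Channel) (v : ℝ) : 0 < N.ccdfV k c v := Real.exp_pos _

lemma laplaceI_nonneg (j k : Fin K) (c co : Channel) (y s : ℝ) : 0 ≤ N.laplaceI j c y k co s :=
  expNeg_nonneg _

lemma otherVoid_pos (j : Fin K) (c : Channel) (y : ℝ) : 0 < N.otherVoid j c y :=
  Finset.prod_pos fun _ _ => N.ccdfV_pos _ _ _

lemma laplaceTotal_nonneg (j : Fin K) (c : Channel) (y s : ℝ) : 0 ≤ N.laplaceTotal j c y s :=
  mul_nonneg (Real.exp_pos _).le (Finset.prod_nonneg fun _ _ => N.laplaceI_nonneg _ _ _ _ _ _)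

/-- The layers and states contribute independent factors. The void factor of `(j, c)` itself is
`ccdfV j c y` by `radius_self`; it is absent from `otherVoid` and will become part of `pdfV j c y`.
-/
lemma eneg_lintegral_weight (j : Fin K) (c : Channel) {s y : ℝ} (hs : 0 ≤ s) (hy : 0 ≤ y) :
    eneg (∫⁻ x, (1 - eneg (N.weight j c s y x)) ∂N.intensity) * ENNReal.ofReal (Real.exp (-s * N.σ ^ 2)) =
      ENNReal.ofReal (N.ccdfV j c y * N.otherVoid j c y * N.laplaceTotal j c y s) := by
  have hwm : Measurable fun x => 1 - eneg (N.weight j c s y x) :=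
    (measurable_eneg.comp (N.measurable_weight j c s y)).const_sub 1
  have hprod : eneg (∫⁻ x, (1 - eneg (N.weight j c s y x)) ∂N.intensity) =
      ∏ q : Fin K × Channel, (ENNReal.ofReal (N.ccdfV q.1 q.2 (N.radius j c q.1 q.2 y)) *
        ENNReal.ofReal (N.laplaceI j c y q.1 q.2 s)) := by
    rw [N.lintegral_intensity hwm, eneg_sum, Fintype.prod_prod_type]
    refine Finset.prod_congr rfl fun k _ => ?_
    unfold markMean
    have hmm : ∀ co, Measurable fun z => ENNReal.ofReal (N.rho k co (N.linkDist k z)) *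
        ∫⁻ g, (1 - eneg (N.weight j c s y (k, z, co, g))) ∂(N.gainLaw co) := fun co =>
      Measurable.mul (by fun_prop)
        (measurable_section (hwm.comp measurable_prodMk_left) co).lintegral_prod_right'
    rw [lintegral_finsetSum _ fun co _ => hmm co, eneg_sum]
    exact Finset.prod_congr rfl fun co _ => N.lintegral_layer_weight j k c co hs hy
  have hself : N.ccdfV j c y * N.otherVoid j c y =
      ∏ q : Fin K × Channel, N.ccdfV q.1 q.2 (N.radius j c q.1 q.2 y) := by
    rw [← Finset.mul_prod_erase Finset.univ _ (Finset.mem_univ (j, c)), N.radius_self j c hy]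
    rfl
  rw [hprod, hself, laplaceTotal, Finset.prod_mul_distrib,
    ← ENNReal.ofReal_prod_of_nonneg (fun q _ => (N.ccdfV_pos _ _ _).le),
    ← ENNReal.ofReal_prod_of_nonneg (fun q _ => N.laplaceI_nonneg _ _ _ _ _ _),
    ENNReal.ofReal_mul (Finset.prod_nonneg fun q _ => (N.ccdfV_pos _ _ _).le),
    ENNReal.ofReal_mul (Real.exp_pos _).le]
  ring

lemma pdfV_of_lt (j : Fin K) (c : Channel) {y : ℝ} (hy : N.h j < y) :
    N.pdfV j c y = 2 * Real.pi * N.lam j * y * N.rho j c y * N.ccdfV j c y := by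
  rw [pdfV, if_neg (not_lt.2 hy.le), ccdfV, max_eq_left hy.le]

/-- The density of the length of the main link on the event that it belongs to layer `j` and
state `c`. -/
def mainDensity (j : Fin K) (c : Channel) (y : ℝ) : ℝ := N.pdfV j c y * N.otherVoid j c y

lemma mainDensity_nonneg (j : Fin K) (c : Channel) (y : ℝ) : 0 ≤ N.mainDensity j c y := by
  refine mul_nonneg ?_ (N.otherVoid_pos j c y).le
  unfold pdfV
  split_ifs with h
  · exact le_rfl
  · have hy : 0 < y := (N.h_pos j).trans_le (not_lt.1 h)
    have := N.lam_pos j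
    have := N.rho_nonneg j c y
    positivity

end Params

/-! ### The law of length, gain and interference of the main link -/

/-- Mecke's formula for a product functional that depends monotonically on a real parameter of the
distinguished point, for an intensity measure that is finite where the parameter is bounded. -/
theorem HasPoissonLaplace.mecke_monotone_of_locallyFinite {Ω E ι : Type*} [MeasurableSpace Ω]
    [MeasurableSpace E] [Countable ι] {x : ι → Ω → E} {Λ : Measure E} {μ : Measure Ω} [IsFiniteMeasure μ]
    (h : HasPoissonLaplace x Λ μ) {γ : E → ℝ≥0∞} {w : ℝ → E → ℝ≥0∞} {d : E → ℝ} (hγ : Measurable γ)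
    (hγ1 : ∀ y, γ y ≤ 1) (hw : Measurable fun q : ℝ × E => w q.1 q.2) (hmono : Monotone w)
    (hd : Measurable d) (hatom : ∀ t, Λ {y | d y = t} = 0) (hfin : ∀ t, Λ {y | d y ≤ t} ≠ ∞) :
    ∫⁻ ω, ∑' p, γ (x p ω) * eneg (∑' q : {q // q ≠ p}, w (d (x p ω)) (x q ω)) ∂μ =
      ∫⁻ y, γ y * eneg (∫⁻ y', (1 - eneg (w (d y) y')) ∂Λ) ∂Λ := by
  -- `γ` need not be integrable, but its restriction to each unit slab of `d` is, and the slabs add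
  -- up.
  set A : ℤ → Set E := fun n => {y | ⌊d y⌋ = n}
  have hA : ∀ n, MeasurableSet (A n) := fun n => (Int.measurable_floor.comp hd) (measurableSet_singleton n)
  have hwt : ∀ t, Measurable (w t) := fun t => Measurable.of_uncurry_left (f := w) hw
  have hdec : ∀ y, γ y = ∑' n, (A n).indicator γ y := by
    intro y
    rw [tsum_eq_single ⌊d y⌋]
    · exact (indicator_of_mem (show y ∈ A ⌊d y⌋ from rfl) γ).symm
    · intro n hn
      exact indicator_of_notMem (show y ∉ A n from fun hy : ⌊d y⌋ = n => hn hy.symm) γ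
  have hn := fun n => h.mecke_monotone (γ := (A n).indicator γ) (w := w) (hγ.indicator (hA n)) (by
    refine ne_top_of_le_ne_top (hfin (n + 1)) ?_
    calc ∫⁻ y, (A n).indicator γ y ∂Λ ≤ ∫⁻ y, (A n).indicator 1 y ∂Λ :=
          lintegral_mono fun y => indicator_le_indicator (hγ1 y)
      _ = Λ (A n) := lintegral_indicator_one (hA n)
      _ ≤ _ := measure_mono fun y (hy : ⌊d y⌋ = n) => by
        have := Int.lt_floor_add_one (d y)
        rw [hy] at this
        exact this.le) hwt hmono hd hatom
  have hH : Antitone fun t => eneg (∫⁻ y', (1 - eneg (w t y')) ∂Λ) := fun s t hst =>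
    antitone_eneg (lintegral_mono fun y => tsub_le_tsub_left (antitone_eneg (hmono hst y)) _)
  have hHm : Measurable fun y => eneg (∫⁻ y', (1 - eneg (w (d y) y')) ∂Λ) := hH.measurable.comp hd
  have hL : ∀ ω, ∑' p, γ (x p ω) * eneg (∑' q : {q // q ≠ p}, w (d (x p ω)) (x q ω)) =
      ∑' n, ∑' p, (A n).indicator γ (x p ω) * eneg (∑' q : {q // q ≠ p}, w (d (x p ω)) (x q ω)) := by
    intro ω
    rw [ENNReal.tsum_comm]
    refine tsum_congr fun p => ?_
    rw [ENNReal.tsum_mul_right, ← hdec]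
  have hR : ∀ y, γ y * eneg (∫⁻ y', (1 - eneg (w (d y) y')) ∂Λ) =
      ∑' n, (A n).indicator γ y * eneg (∫⁻ y', (1 - eneg (w (d y) y')) ∂Λ) := by
    intro y
    rw [ENNReal.tsum_mul_right, ← hdec]
  simp_rw [hL]
  rw [lintegral_congr hR, lintegral_tsum, lintegral_tsum]
  · exact tsum_congr hn
  · exact fun n => ((hγ.indicator (hA n)).mul hHm).aemeasurable
  · intro n
    refine (Measurable.tsum fun p => ((hγ.indicator (hA n)).comp (h.measurable p)).mul
      (measurable_eneg.comp (Measurable.tsum fun q => ?_))).aemeasurable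
    have hpair : Measurable fun ω => (d (x p ω), x q ω) :=
      (hd.comp (h.measurable p)).prodMk (h.measurable q)
    exact hw.comp hpair

namespace Network

variable {K : ℕ} {N : Params K} {Ω : Type*} [MeasurableSpace Ω] {μ : Measure Ω}
  (W : Network N μ)

lemma dist_pos (p : Node K) (ω : Ω) : 0 < W.dist p ω := N.linkDist_pos _ _

lemma measurable_dist (p : Node K) : Measurable (W.dist p) :=
  (N.measurable_linkDist p.1).comp (W.measurable_pos _ _)

lemma measurable_pathloss (p : Node K) : Measurable fun ω => W.dist p ω ^ (-N.α (W.chan p ω)) := by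
  have h : Measurable fun ω => -N.α (W.chan p ω) :=
    (measurable_from_top (f := fun c => -N.α c)).comp (W.measurable_chan' p)
  exact (W.measurable_dist p).pow h

lemma measurable_avgPower (p : Node K) : Measurable (W.avgPower p) :=
  (W.measurable_pathloss p).const_mul _

lemma measurable_power (p : Node K) : Measurable (W.power p) :=
  ((W.measurable_gain p).const_mul _).mul (W.measurable_pathloss p)

lemma measurable_interference (p : Node K) : Measurable (W.interference p) :=
  (Measurable.tsum fun _ => (W.measurable_power _).ennreal_ofReal).add_const _

/-- The `i`-th node of layer `j` is the transmitter of the main link, which is in state `c`. -/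
def mainSet (j : Fin K) (c : Channel) (i : ℕ) : Set Ω := {ω | W.IsMain (j, i) ω ∧ W.chan (j, i) ω = c}

lemma measurableSet_isMain (p : Node K) : MeasurableSet {ω | W.IsMain p ω} := by
  have : {ω | W.IsMain p ω} = ⋂ q : Node K, ⋂ _ : q ≠ p, {ω | W.avgPower q ω < W.avgPower p ω} := by
    ext ω; simp [IsMain]
  rw [this]
  exact MeasurableSet.iInter fun q => MeasurableSet.iInter fun _ =>
    measurableSet_lt (W.measurable_avgPower q) (W.measurable_avgPower p)

lemma measurableSet_mainSet (j : Fin K) (c : Channel) (i : ℕ) : MeasurableSet (W.mainSet j c i) :=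
  (W.measurableSet_isMain _).inter (W.measurable_chan _ c)

/-- The law of length, gain and interference of the main link on the event that this belongs to
layer `j` and state `c`. -/
def mainLaw (j : Fin K) (c : Channel) : Measure (ℝ × ℝ × ℝ≥0∞) :=
  Measure.sum fun i => (μ.restrict (W.mainSet j c i)).map
    fun ω => (W.dist (j, i) ω, W.gain (j, i) ω, W.interference (j, i) ω)

lemma lintegral_mainLaw (j : Fin K) (c : Channel) {F : ℝ × ℝ × ℝ≥0∞ → ℝ≥0∞} (hF : Measurable F) :
    ∫⁻ q, F q ∂(W.mainLaw j c) =
      ∑' i, ∫⁻ ω in W.mainSet j c i, F (W.dist (j, i) ω, W.gain (j, i) ω, W.interference (j, i) ω) ∂μ := by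
  rw [mainLaw, lintegral_sum_measure]
  refine tsum_congr fun i => ?_
  rw [lintegral_map hF ((W.measurable_dist _).prodMk ((W.measurable_gain _).prodMk (W.measurable_interference _)))]

lemma avgPower_lt_iff (p q : Node K) (ω : Ω) :
    W.avgPower q ω < W.avgPower p ω ↔
      N.radius p.1 (W.chan p ω) q.1 (W.chan q ω) (W.dist p ω) < W.dist q ω :=
  (N.radius_lt_iff _ _ _ _ (W.dist_pos q ω) (W.dist_pos p ω)).symm

/-- One node `q ≠ p` that is at least as strong makes the sum infinite. Ties count against `p`, in
agreement with the strict inequality in `IsMain`. -/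
lemma eneg_rest (p : Node K) (ω : Ω) {s : ℝ} (hs : 0 ≤ s) [Decidable (W.IsMain p ω)] :
    eneg (∑' q : {q // q ≠ p}, N.weight p.1 (W.chan p ω) s (W.dist p ω) (W.point q ω)) *
        ENNReal.ofReal (Real.exp (-s * N.σ ^ 2)) =
      if W.IsMain p ω then eneg (ENNReal.ofReal s * W.interference p ω) else 0 := by
  have hd : max (W.dist p ω) 0 = W.dist p ω := max_eq_left (W.dist_pos p ω).le
  have hw : ∀ q, N.weight p.1 (W.chan p ω) s (W.dist p ω) (W.point q ω) =
      (if W.avgPower q ω < W.avgPower p ω then 0 else ∞) + ENNReal.ofReal s * ENNReal.ofReal (W.power q ω) := by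
    intro q
    have : ¬ (N.ptDist (W.point q ω) ≤ N.radius p.1 (W.chan p ω) q.1 (W.chan q ω) (W.dist p ω)) ↔
        W.avgPower q ω < W.avgPower p ω := by
      rw [W.avgPower_lt_iff p q ω, not_le]; rfl
    rw [Params.weight, hd]
    change (if N.ptDist (W.point q ω) ≤ N.radius p.1 (W.chan p ω) q.1 (W.chan q ω) (W.dist p ω) then ∞ else 0) +
      ENNReal.ofReal s * ENNReal.ofReal (W.power q ω) = _
    congr 1
    by_cases h : W.avgPower q ω < W.avgPower p ω
    · rw [if_pos h, if_neg (this.2 h)]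
    · rw [if_neg h, if_pos (not_not.1 (this.not.2 h))]
  simp_rw [hw]
  split_ifs with h
  · have h0 : ∀ q : {q // q ≠ p}, (if W.avgPower q ω < W.avgPower p ω then (0 : ℝ≥0∞) else ∞) = 0 :=
      fun q => if_pos (h q q.2)
    simp_rw [h0, zero_add]
    rw [ENNReal.tsum_mul_left, neg_mul, ← eneg_ofReal (by positivity), ← eneg_add, ENNReal.ofReal_mul hs,
      ← mul_add]
    rfl
  · rw [IsMain] at h
    push Not at h
    obtain ⟨q, hq, hle⟩ := h
    have : ∑' q : {q // q ≠ p}, ((if W.avgPower q ω < W.avgPower p ω then (0 : ℝ≥0∞) else ∞) +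
        ENNReal.ofReal s * ENNReal.ofReal (W.power q ω)) = ∞ := by
      refine ENNReal.tsum_eq_top_of_eq_top ⟨⟨q, hq⟩, ?_⟩
      rw [if_neg (not_lt.2 hle), top_add]
    rw [this, eneg_top, zero_mul]

/-- The joint transform of length, gain and interference of the main link. -/
theorem lintegral_mainLaw_eneg [IsProbabilityMeasure μ] (j : Fin K) (c : Channel) {B C : Set ℝ}
    (hB : MeasurableSet B) (hC : MeasurableSet C) {s : ℝ} (hs : 0 ≤ s) :
    ∫⁻ q, B.indicator 1 q.1 * C.indicator 1 q.2.1 * eneg (ENNReal.ofReal s * q.2.2) ∂(W.mainLaw j c) =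
      N.gainLaw c C * ∫⁻ y in B ∩ Ioi (N.h j),
        ENNReal.ofReal (N.mainDensity j c y * N.laplaceTotal j c y s) := by
  classical
  have hB1 : Measurable (B.indicator (1 : ℝ → ℝ≥0∞)) := measurable_one.indicator hB
  have hC1 : Measurable (C.indicator (1 : ℝ → ℝ≥0∞)) := measurable_one.indicator hC
  -- `γ` prescribes layer, state, length and gain of the distinguished node; that it is the main one
  -- is left to `weight`.
  set γ : Fin K × Plane × Channel × ℝ → ℝ≥0∞ := fun x =>
    if x.1 = j ∧ x.2.2.1 = c then B.indicator 1 (N.ptDist x) * C.indicator 1 x.2.2.2 else 0 with hγdef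
  have hγ : Measurable γ := by
    refine Params.measurable_of_sections fun k co => ?_
    by_cases h : k = j ∧ co = c
    · simp only [hγdef, h, and_self, if_true]
      exact (hB1.comp ((N.measurable_linkDist _).comp measurable_fst)).mul (hC1.comp measurable_snd)
    · simp only [hγdef, h, if_false]
      exact measurable_const
  have hγ1 : ∀ x, γ x ≤ 1 := fun x => by
    simp only [hγdef]
    split_ifs
    · exact mul_le_one' (indicator_le_self _ _ _) (indicator_le_self _ _ _)
    · exact zero_le
  set σs : ℝ≥0∞ := ENNReal.ofReal (Real.exp (-s * N.σ ^ 2))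
  have hM := W.hasPoissonLaplace.mecke_monotone_of_locallyFinite hγ hγ1 (N.measurable_weight_uncurry j c s)
    (N.weight_mono j c s) N.measurable_ptDist N.intensity_ptDist_eq N.intensity_ptDist_le
  have hlhs : ∫⁻ q, B.indicator 1 q.1 * C.indicator 1 q.2.1 * eneg (ENNReal.ofReal s * q.2.2) ∂(W.mainLaw j c) =
      (∫⁻ ω, ∑' p, γ (W.point p ω) * eneg (∑' q : {q // q ≠ p},
        N.weight j c s (N.ptDist (W.point p ω)) (W.point q ω)) ∂μ) * σs := by
    have hFm : Measurable fun q : ℝ × ℝ × ℝ≥0∞ =>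
        B.indicator 1 q.1 * C.indicator 1 q.2.1 * eneg (ENNReal.ofReal s * q.2.2) :=
      ((hB1.comp measurable_fst).mul (hC1.comp (measurable_fst.comp measurable_snd))).mul (by fun_prop)
    rw [W.lintegral_mainLaw j c hFm, ← lintegral_mul_const' _ _ ENNReal.ofReal_ne_top]
    simp_rw [← lintegral_indicator (W.measurableSet_mainSet j c _)]
    have hFi : ∀ i, AEMeasurable ((W.mainSet j c i).indicator fun ω => B.indicator 1 (W.dist (j, i) ω) *
        C.indicator 1 (W.gain (j, i) ω) * eneg (ENNReal.ofReal s * W.interference (j, i) ω)) μ := fun i =>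
      (Measurable.indicator (hFm.comp ((W.measurable_dist (j, i)).prodMk
        ((W.measurable_gain (j, i)).prodMk (W.measurable_interference (j, i)))))
        (W.measurableSet_mainSet j c i)).aemeasurable
    rw [← lintegral_tsum hFi]
    refine lintegral_congr fun ω => ?_
    rw [← ENNReal.tsum_mul_right, ENNReal.tsum_prod', tsum_eq_single j]
    · refine tsum_congr fun i => ?_
      by_cases hc : W.chan (j, i) ω = c
      · have hr := W.eneg_rest (j, i) ω hs
        rw [hc] at hr
        have hg : γ (W.point (j, i) ω) =
            B.indicator 1 (W.dist (j, i) ω) * C.indicator 1 (W.gain (j, i) ω) := if_pos ⟨rfl, hc⟩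
        rw [hg, mul_assoc]
        rw [show N.ptDist (W.point (j, i) ω) = W.dist (j, i) ω from rfl, hr]
        by_cases hm : W.IsMain (j, i) ω
        · rw [if_pos hm, indicator_of_mem (show ω ∈ W.mainSet j c i from ⟨hm, hc⟩)]
        · rw [if_neg hm, indicator_of_notMem (fun h : ω ∈ W.mainSet j c i => hm h.1), mul_zero]
      · have hg : γ (W.point (j, i) ω) = 0 := if_neg (fun h => hc h.2)
        rw [indicator_of_notMem (fun h : ω ∈ W.mainSet j c i => hc h.2), hg, zero_mul, zero_mul]
    · intro k hk
      refine ENNReal.tsum_eq_zero.2 fun i => ?_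
      have hg : γ (W.point (k, i) ω) = 0 := if_neg (fun h => hk h.1)
      rw [hg, zero_mul, zero_mul]
  rw [hlhs, hM]
  set H : ℝ → ℝ≥0∞ := fun y => eneg (∫⁻ x, (1 - eneg (N.weight j c s y x)) ∂N.intensity) with hHdef
  have hHm : Measurable H := by
    have : Antitone H := fun s t hst =>
      antitone_eneg (lintegral_mono fun y => tsub_le_tsub_left (antitone_eneg (N.weight_mono j c _ hst y)) _)
    exact this.measurable
  have hγH : Measurable fun x => γ x * H (N.ptDist x) := hγ.mul (hHm.comp N.measurable_ptDist)
  rw [N.lintegral_intensity hγH, Finset.sum_eq_single j]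
  · have hmm : ∀ z, N.markMean j (fun x => γ (j, x) * H (N.ptDist (j, x))) z =
        N.gainLaw c C * (fun y => ENNReal.ofReal (N.rho j c y) * (B.indicator 1 y * H y)) (N.linkDist j z) := by
      intro z
      unfold Params.markMean
      rw [Finset.sum_eq_single c]
      · have : ∀ g, γ (j, z, c, g) * H (N.ptDist (j, z, c, g)) =
            B.indicator 1 (N.linkDist j z) * H (N.linkDist j z) * C.indicator 1 g := by
          intro g
          have hg : γ (j, z, c, g) = B.indicator 1 (N.linkDist j z) * C.indicator 1 g := if_pos ⟨rfl, rfl⟩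
          rw [hg, show N.ptDist (j, z, c, g) = N.linkDist j z from rfl]
          ring
        simp_rw [this]
        rw [lintegral_const_mul _ hC1, lintegral_indicator_one hC]
        ring
      · intro c' _ hc'
        have : ∀ g, γ (j, z, c', g) = 0 := fun g => if_neg (fun h => hc' h.2)
        simp [this]
      · simp
    simp_rw [hmm]
    have hFm : Measurable fun y => ENNReal.ofReal (N.rho j c y) * (B.indicator 1 y * H y) :=
      (N.measurable_rho j c).ennreal_ofReal.mul (hB1.mul hHm)
    have hFd : Measurable fun z => ENNReal.ofReal (N.rho j c (N.linkDist j z)) *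
        (B.indicator 1 (N.linkDist j z) * H (N.linkDist j z)) := hFm.comp (N.measurable_linkDist j)
    rw [lintegral_const_mul _ hFd, lintegral_smul_measure,
      N.lintegral_linkDist j hFm, mul_assoc, smul_eq_mul]
    congr 1
    rw [← lintegral_const_mul' _ _ ENNReal.ofReal_ne_top, ← lintegral_mul_const' _ _ ENNReal.ofReal_ne_top,
      ← setLIntegral_indicator hB]
    refine setLIntegral_congr_fun measurableSet_Ioi fun y (hy : N.h j < y) => ?_
    have hy0 : 0 < y := (N.h_pos j).trans hy
    have hl := N.lam_pos j
    by_cases hyB : y ∈ B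
    · have hH : H y * σs = _ := N.eneg_lintegral_weight j c hs hy0.le
      simp only [indicator_of_mem hyB, Pi.one_apply, one_mul]
      rw [show ENNReal.ofReal (N.lam j) * (ENNReal.ofReal (2 * Real.pi * y) *
        (ENNReal.ofReal (N.rho j c y) * H y)) * σs = ENNReal.ofReal (N.lam j) *
        (ENNReal.ofReal (2 * Real.pi * y) * (ENNReal.ofReal (N.rho j c y) * (H y * σs))) by ring, hH, ← ENNReal.ofReal_mul (N.rho_nonneg _ _ _),
        ← ENNReal.ofReal_mul (by positivity), ← ENNReal.ofReal_mul (by positivity), Params.mainDensity,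
        N.pdfV_of_lt j c hy]
      congr 1; ring
    · simp [indicator_of_notMem hyB]
  · intro k _ hk
    have : ∀ z, N.markMean k (fun x => γ (k, x) * H (N.ptDist (k, x))) z = 0 := by
      intro z
      have : ∀ x, γ (k, x) = 0 := fun x => if_neg (fun h => hk h.1)
      simp [Params.markMean, this]
    simp_rw [this, lintegral_zero]
  · simp

end Network

/-! ### Laplace transforms of measures on `[0, ∞]` -/

lemma eneg_injective : Function.Injective eneg := fun a b h => by
  have := EReal.exp_strictMono.injective h
  exact_mod_cast neg_injective this

lemma continuous_toReal_eneg : Continuous fun x => (eneg x).toReal :=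
  ENNReal.continuousOn_toReal.comp_continuous continuous_eneg fun x => eneg_ne_top x

/-- The function `exp (-x)` on the compact space `[0, ∞]`. -/
def enegBCF : BoundedContinuousFunction ℝ≥0∞ ℝ :=
  BoundedContinuousFunction.mkOfCompact ⟨fun x => (eneg x).toReal, continuous_toReal_eneg⟩

/-- The polynomials in `exp (-x)`. -/
def enegAlgebra : StarSubalgebra ℝ (BoundedContinuousFunction ℝ≥0∞ ℝ) :=
  { Algebra.adjoin ℝ {enegBCF} with
    star_mem' := by
      intro f hf
      have : star f = f := by ext x; simp
      rw [this]; exact hf }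

/-- A finite measure on `[0, ∞]` is determined by its Laplace transform. -/
theorem measure_eq_of_laplace {ν ν' : Measure ℝ≥0∞} [IsFiniteMeasure ν] [IsFiniteMeasure ν']
    (h : ∀ s : ℝ, 0 ≤ s → ∫⁻ x, eneg (ENNReal.ofReal s * x) ∂ν = ∫⁻ x, eneg (ENNReal.ofReal s * x) ∂ν') :
    ν = ν' := by
  -- The polynomials in `exp (-x)` form an algebra that separates the points of `[0, ∞]`, the point
  -- `∞` included.
  refine ext_of_forall_mem_subalgebra_integral_eq_of_polish (𝕜 := ℝ) (A := enegAlgebra) ?_ ?_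
  · intro x y hxy
    refine ⟨fun x => (eneg x).toReal, ⟨_, ⟨enegBCF, Algebra.self_mem_adjoin_singleton ℝ enegBCF, rfl⟩, rfl⟩, ?_⟩
    intro he
    exact hxy (eneg_injective ((ENNReal.toReal_eq_toReal_iff' (eneg_ne_top _) (eneg_ne_top _)).1 he))
  · intro g hg
    have hg' : g ∈ Algebra.adjoin ℝ {enegBCF} := hg
    rw [Algebra.adjoin_singleton_eq_range_aeval] at hg'
    obtain ⟨p, rfl⟩ := hg'
    induction p using Polynomial.induction_on' with
    | add p q hp hq =>
      have hp' := hp (by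
        change _ ∈ Algebra.adjoin ℝ {enegBCF}
        rw [Algebra.adjoin_singleton_eq_range_aeval]; exact ⟨p, rfl⟩)
      have hq' := hq (by
        change _ ∈ Algebra.adjoin ℝ {enegBCF}
        rw [Algebra.adjoin_singleton_eq_range_aeval]; exact ⟨q, rfl⟩)
      simp only [AlgHom.toRingHom_eq_coe, RingHom.coe_coe, map_add, BoundedContinuousFunction.coe_add, Pi.add_apply] at hp' hq' ⊢
      rw [integral_add (BoundedContinuousFunction.integrable _ _) (BoundedContinuousFunction.integrable _ _),
        integral_add (BoundedContinuousFunction.integrable _ _) (BoundedContinuousFunction.integrable _ _), hp', hq']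
    -- A power of `exp (-x)` integrates to the transform at `s = n`. For `n = 0` this is the total
    -- mass, thanks to `0 * ∞ = 0`.
    | monomial n a =>
      have hval : ∀ x, ((Polynomial.aeval enegBCF) (Polynomial.monomial n a) : BoundedContinuousFunction ℝ≥0∞ ℝ) x =
          a * (eneg (ENNReal.ofReal n * x)).toReal := by
        intro x
        rw [Polynomial.aeval_monomial, BoundedContinuousFunction.mul_apply]
        congr 1
        rw [ENNReal.ofReal_natCast, mul_comm, eneg_mul_nat, ENNReal.toReal_pow]
        rfl
      have hint : ∀ m : Measure ℝ≥0∞, ∫ x, (eneg (ENNReal.ofReal n * x)).toReal ∂m =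
          (∫⁻ x, eneg (ENNReal.ofReal n * x) ∂m).toReal := fun m =>
        integral_toReal (by fun_prop) (Eventually.of_forall fun x => (eneg_ne_top _).lt_top)
      simp only [AlgHom.toRingHom_eq_coe, RingHom.coe_coe]
      simp_rw [hval, integral_const_mul, hint, h n (by positivity)]

/-! ### The tail of the Gamma distribution -/

/-- The partial sum of `n` terms of the Poisson distribution with parameter `u`. -/
def poissonHead (n : ℕ) (u : ℝ) : ℝ := ∑ i ∈ Finset.range n, u ^ i / (i.factorial : ℝ) * Real.exp (-u)

lemma poissonHead_nonneg (n : ℕ) {u : ℝ} (hu : 0 ≤ u) : 0 ≤ poissonHead n u :=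
  Finset.sum_nonneg fun i _ => by positivity

lemma continuous_poissonHead (n : ℕ) : Continuous (poissonHead n) := by
  unfold poissonHead; fun_prop

/-- The derivatives of the terms telescope, and only the last one survives. -/
lemma hasDerivAt_poissonHead (n : ℕ) (u : ℝ) :
    HasDerivAt (poissonHead (n + 1)) (-(u ^ n / (n.factorial : ℝ) * Real.exp (-u))) u := by
  have he : HasDerivAt (fun u : ℝ => Real.exp (-u)) (-Real.exp (-u)) u := by
    simpa using (hasDerivAt_neg u).exp
  induction n with
  | zero =>
    have : poissonHead (0 + 1) = fun u => Real.exp (-u) := by ext; simp [poissonHead]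
    rw [this]; simpa using he
  | succ n ih =>
    have h1 : poissonHead (n + 1 + 1) = fun u =>
        poissonHead (n + 1) u + u ^ (n + 1) / ((n + 1).factorial : ℝ) * Real.exp (-u) := by
      ext v; rw [poissonHead, Finset.sum_range_succ]; rfl
    rw [h1]
    have h2 := ((hasDerivAt_pow (n + 1) u).div_const ((n + 1).factorial : ℝ)).mul he
    refine (ih.add h2).congr_deriv ?_
    have hf : ((n + 1).factorial : ℝ) = (n + 1) * n.factorial := by push_cast [Nat.factorial_succ]; ring
    have : (n.factorial : ℝ) ≠ 0 := by positivity
    rw [hf]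
    push_cast
    field_simp
    simp

lemma tendsto_poissonHead (n : ℕ) : Tendsto (poissonHead n) atTop (𝓝 0) := by
  have : Tendsto (fun u : ℝ => ∑ i ∈ Finset.range n, u ^ i / (i.factorial : ℝ) * Real.exp (-u)) atTop
      (𝓝 (∑ i ∈ Finset.range n, 0 / (i.factorial : ℝ))) := by
    refine tendsto_finsetSum _ fun i _ => ?_
    have := (Real.tendsto_pow_mul_exp_neg_atTop_nhds_zero i).div_const (i.factorial : ℝ)
    refine this.congr fun u => ?_
    ring
  simp only [zero_div, Finset.sum_const_zero] at this
  exact this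

/-- By `hasDerivAt_poissonHead` the function `-poissonHead m (m * g)` is a primitive of the Gamma
density, and it vanishes at infinity. -/
lemma gammaMeasure_Ioi {m : ℕ} (hm : 1 ≤ m) {x : ℝ} (hx : 0 ≤ x) :
    gammaMeasure (m : ℝ) (m : ℝ) (Ioi x) = ENNReal.ofReal (poissonHead m (m * x)) := by
  obtain ⟨k, rfl⟩ : ∃ k, m = k + 1 := ⟨m - 1, by omega⟩
  set r : ℝ := ((k + 1 : ℕ) : ℝ) with hr
  have hr0 : 0 < r := by rw [hr]; positivity
  have hderiv : ∀ g ∈ Ici x, HasDerivAt (fun g => -poissonHead (k + 1) (r * g))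
      (r * ((r * g) ^ k / (k.factorial : ℝ) * Real.exp (-(r * g)))) g := by
    intro g _
    have h1 : HasDerivAt (fun g : ℝ => r * g) r g := by simpa using (hasDerivAt_id g).const_mul r
    have := ((hasDerivAt_poissonHead k (r * g)).comp g h1).neg
    refine this.congr_deriv ?_
    ring
  have hnn : ∀ g ∈ Ioi x, 0 ≤ r * ((r * g) ^ k / (k.factorial : ℝ) * Real.exp (-(r * g))) := by
    intro g hg
    have : 0 < g := hx.trans_lt hg
    positivity
  have hlim : Tendsto (fun g => -poissonHead (k + 1) (r * g)) atTop (𝓝 0) := by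
    have := ((tendsto_poissonHead (k + 1)).comp (tendsto_id.const_mul_atTop hr0)).neg
    simpa using this
  have hint := integrableOn_Ioi_deriv_of_nonneg' hderiv hnn hlim
  have hval := integral_Ioi_of_hasDerivAt_of_nonneg' hderiv hnn hlim
  rw [gammaMeasure, withDensity_apply _ measurableSet_Ioi]
  have hpdf : ∀ g ∈ Ioi x, gammaPDF r r g =
      ENNReal.ofReal (r * ((r * g) ^ k / (k.factorial : ℝ) * Real.exp (-(r * g)))) := by
    intro g hg
    have hg0 : 0 < g := hx.trans_lt hg
    rw [gammaPDF_of_nonneg hg0.le]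
    congr 1
    have e1 : Real.Gamma r = k.factorial := by
      rw [hr]; push_cast; exact Real.Gamma_nat_eq_factorial k
    have e2 : g ^ (r - 1) = g ^ k := by
      rw [← Real.rpow_natCast]; congr 1; rw [hr]; push_cast; ring
    have e3 : r ^ r = r ^ (k + 1) := by
      conv_lhs => rw [show r ^ r = r ^ (((k + 1 : ℕ) : ℝ)) from rfl]
      exact Real.rpow_natCast r (k + 1)
    rw [e1, e2, e3, mul_pow]
    ring
  rw [setLIntegral_congr_fun measurableSet_Ioi hpdf, ← ofReal_integral_eq_lintegral_ofReal hint
    ((ae_restrict_iff' measurableSet_Ioi).2 (Eventually.of_forall hnn)), hval]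
  simp

/-! ### Derivatives of Laplace transforms -/

section Mgf

variable (κ : Measure ℝ≥0∞) [IsFiniteMeasure κ]

lemma integrable_exp_restrict {s : ℝ} (hs : 0 ≤ s) :
    Integrable (fun x : ℝ≥0∞ => Real.exp (s * -x.toReal)) (κ.restrict {∞}ᶜ) := by
  refine Integrable.of_bound (C := 1) (by fun_prop) (Eventually.of_forall fun x => ?_)
  rw [Real.norm_of_nonneg (Real.exp_pos _).le]
  exact Real.exp_le_one_iff.2 (mul_nonpos_of_nonneg_of_nonpos hs (by simp))

lemma Ioi_subset_interior_integrableExpSet :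
    Ioi (0 : ℝ) ⊆ interior (integrableExpSet (fun x : ℝ≥0∞ => -x.toReal) (κ.restrict {∞}ᶜ)) :=
  interior_maximal (fun _ hs => integrable_exp_restrict κ (le_of_lt hs)) isOpen_Ioi

/-- For `s > 0` an atom at `∞` contributes nothing. On the finite part the transform is a moment
generating function, so analyticity and differentiation under the integral are available. -/
lemma lintegral_eneg_eq_mgf {s : ℝ} (hs : 0 < s) :
    ∫⁻ x, eneg (ENNReal.ofReal s * x) ∂κ =
      ENNReal.ofReal (mgf (fun x : ℝ≥0∞ => -x.toReal) (κ.restrict {∞}ᶜ) s) := by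
  have h1 : ∫⁻ x, eneg (ENNReal.ofReal s * x) ∂κ =
      ∫⁻ x in {∞}ᶜ, eneg (ENNReal.ofReal s * x) ∂κ := by
    rw [← lintegral_add_compl _ (measurableSet_singleton (∞ : ℝ≥0∞))]
    have : ∫⁻ x in {∞}, eneg (ENNReal.ofReal s * x) ∂κ = 0 := by
      simp [ENNReal.mul_top (ENNReal.ofReal_pos.2 hs).ne']
    rw [this, zero_add]
  rw [h1, mgf, ofReal_integral_eq_lintegral_ofReal (integrable_exp_restrict κ hs.le)
    (Eventually.of_forall fun x => (Real.exp_pos _).le)]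
  refine setLIntegral_congr_fun (measurableSet_singleton _).compl fun x hx => ?_
  lift x to ℝ≥0 using hx
  change eneg (ENNReal.ofReal s * x) = ENNReal.ofReal (Real.exp (s * -(x : ℝ)))
  rw [← ENNReal.ofReal_coe_nnreal, ← ENNReal.ofReal_mul hs.le, eneg_ofReal (by positivity)]
  ring_nf

/-- If `L` is a nonincreasing function that agrees with the Laplace transform of `κ` at positive
rationals, then the Taylor-like sum of its derivatives is the mean of `poissonHead`. -/
theorem sum_iteratedDeriv_eq {L : ℝ → ℝ} (hL0 : ∀ s, 0 ≤ L s) (hanti : AntitoneOn L (Ioi 0))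
    (h : ∀ q : ℚ, 0 < q → ∫⁻ x, eneg (ENNReal.ofReal q * x) ∂κ = ENNReal.ofReal (L q))
    (m : ℕ) {s : ℝ} (hs : 0 < s) :
    ∑ n ∈ Finset.range m, (-s) ^ n / (n.factorial : ℝ) * iteratedDeriv n L s =
      ∫ x in {∞}ᶜ, poissonHead m (s * x.toReal) ∂κ := by
  set X : ℝ≥0∞ → ℝ := fun x => -x.toReal with hX
  set κ' := κ.restrict {∞}ᶜ with hκ
  have hq : ∀ q : ℚ, 0 < q → L q = mgf X κ' q := by
    intro q hq
    have h1 := h q hq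
    rw [lintegral_eneg_eq_mgf κ (by exact_mod_cast hq)] at h1
    exact ((ENNReal.ofReal_eq_ofReal_iff mgf_nonneg (hL0 _)).1 h1).symm
  have hint := Ioi_subset_interior_integrableExpSet κ
  have hcont : ∀ t, 0 < t → ContinuousAt (mgf X κ') t := fun t ht =>
    (analyticAt_mgf (hint ht)).continuousAt
  -- A monotone function that agrees with a continuous one at the positive rationals agrees with it
  -- on `(0, ∞)`; rationals on either side of `t` give the two inequalities.
  have hL : ∀ t, 0 < t → L t = mgf X κ' t := by
    intro t ht
    refine le_antisymm (le_of_forall_gt fun b hb => ?_) (le_of_forall_lt fun b hb => ?_)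
    · have hev := ((hcont t ht).eventually_lt_const hb).and (eventually_gt_nhds ht)
      obtain ⟨ε, hε, hball⟩ := Metric.eventually_nhds_iff.1 hev
      obtain ⟨q, hq1, hq2⟩ := exists_rat_btwn (show t - ε < t by linarith)
      obtain ⟨h1, h2⟩ := hball (y := (q : ℝ)) (by rw [Real.dist_eq, abs_lt]; constructor <;> linarith)
      have h2' : 0 < q := by exact_mod_cast h2
      calc L t ≤ L q := hanti h2 ht hq2.le
        _ = _ := hq q h2'
        _ < b := h1
    · have hev := ((hcont t ht).eventually_const_lt hb).and (eventually_gt_nhds ht)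
      obtain ⟨ε, hε, hball⟩ := Metric.eventually_nhds_iff.1 hev
      obtain ⟨q, hq1, hq2⟩ := exists_rat_btwn (show t < t + ε by linarith)
      obtain ⟨h1, h2⟩ := hball (y := (q : ℝ)) (by rw [Real.dist_eq, abs_lt]; constructor <;> linarith)
      have h2' : 0 < q := by exact_mod_cast h2
      calc b < _ := h1
        _ = L q := (hq q h2').symm
        _ ≤ L t := hanti ht h2 hq1.le
  have hev : L =ᶠ[𝓝 s] mgf X κ' := by
    filter_upwards [eventually_gt_nhds hs] with t ht using hL t ht
  -- As `X` is minus the variable, the sign `(-1) ^ n` of the derivative cancels the one of `(-s) ^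
  -- n`.
  have hd : ∀ n, iteratedDeriv n L s = ∫ x, X x ^ n * Real.exp (s * X x) ∂κ' := fun n => by
    rw [hev.iteratedDeriv_eq n, iteratedDeriv_mgf (hint hs)]
  simp_rw [hd, ← integral_const_mul]
  rw [← integral_finsetSum]
  · refine integral_congr_ae (Eventually.of_forall fun x => ?_)
    simp only [poissonHead]
    refine Finset.sum_congr rfl fun n _ => ?_
    rw [hX, show s * -x.toReal = -(s * x.toReal) by ring, mul_pow,
      show (-x.toReal) ^ n = (-1) ^ n * x.toReal ^ n by rw [← mul_pow]; ring_nf,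
      show (-s) ^ n = (-1) ^ n * s ^ n by rw [← mul_pow]; ring_nf]
    have : ((-1 : ℝ) ^ n) * (-1) ^ n = 1 := by rw [← mul_pow]; simp
    linear_combination (s ^ n * x.toReal ^ n / (n.factorial : ℝ) * Real.exp (-(s * x.toReal))) * this
  · intro n _
    exact (integrable_pow_mul_exp_of_mem_interior_integrableExpSet (hint hs) n).const_mul _

end Mgf

/-! ### Measurability and monotonicity of the closed forms; the success threshold for the gain -/

namespace Params

variable {K : ℕ} (N : Params K)

lemma antitone_expNeg : Antitone expNeg := fun a b h => by
  rw [← toReal_eneg, ← toReal_eneg]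
  exact ENNReal.toReal_mono (eneg_ne_top _) (antitone_eneg h)

/-- Measurable because monotone; the same works for `laplaceI` as a function of the radius. -/
lemma measurable_ccdfV (k : Fin K) (c : Channel) : Measurable (N.ccdfV k c) := by
  have h : Antitone fun v => ENNReal.ofReal (N.ccdfV k c v) := fun v v' hv => by
    simp only [N.ofReal_ccdfV]
    exact antitone_eneg (lintegral_mono_set (Ioc_subset_Ioc_right (max_le_max_right _ hv)))
  have h2 : N.ccdfV k c = fun v => (ENNReal.ofReal (N.ccdfV k c v)).toReal := by
    ext v; rw [ENNReal.toReal_ofReal (N.ccdfV_pos k c v).le]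
  rw [h2]
  exact h.measurable.ennreal_toReal

lemma measurable_laplaceI (j k : Fin K) (c co : Channel) (s : ℝ) :
    Measurable fun y => N.laplaceI j c y k co s := by
  have h : Monotone fun R => expNeg (ENNReal.ofReal (2 * Real.pi * N.lam k) *
      ∫⁻ x in Ioi (max R (N.h k)), ENNReal.ofReal (x * N.rho k co x *
        (1 - (1 / (1 + s * N.P k * x ^ (-N.α co) / N.m co)) ^ N.m co))) := fun R R' hR =>
    antitone_expNeg (mul_le_mul_right (lintegral_mono_set (Ioi_subset_Ioi (max_le_max_right _ hR))) _)
  exact h.measurable.comp (N.measurable_radius j c k co)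

lemma measurable_laplaceTotal (j : Fin K) (c : Channel) (s : ℝ) :
    Measurable fun y => N.laplaceTotal j c y s :=
  (Finset.measurable_prod _ fun q _ => N.measurable_laplaceI j q.1 c q.2 s).const_mul _

lemma measurable_mainDensity (j : Fin K) (c : Channel) : Measurable (N.mainDensity j c) := by
  have h1 : N.pdfV j c = fun v => if v < N.h j then 0 else
      2 * Real.pi * N.lam j * v * N.rho j c v * N.ccdfV j c v := by
    ext v
    unfold pdfV
    split_ifs with h
    · rfl
    · rw [ccdfV, max_eq_left (not_lt.1 h)]
  have h2 : Measurable (N.pdfV j c) := by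
    rw [h1]
    refine Measurable.ite measurableSet_Iio measurable_const ?_
    exact ((measurable_const.mul measurable_id).mul (N.measurable_rho j c)).mul (N.measurable_ccdfV j c)
  exact h2.mul (Finset.measurable_prod _ fun q _ =>
    (N.measurable_ccdfV q.1 q.2).comp (N.measurable_radius j c q.1 q.2))

lemma laplaceI_antitoneOn (j k : Fin K) (c co : Channel) (y : ℝ) :
    AntitoneOn (fun s => N.laplaceI j c y k co s) (Ici 0) := by
  intro s hs s' hs' hss
  have hs : 0 ≤ s := hs
  have hP := N.P_pos k
  refine antitone_expNeg (mul_le_mul_right ?_ _)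
  refine setLIntegral_mono' measurableSet_Ioi fun x hx => ?_
  have hx0 : 0 < x := (N.h_pos k).trans ((le_max_right _ _).trans_lt hx)
  have hr := N.rho_nonneg k co x
  have hs'0 : 0 ≤ s' := hs'
  apply ENNReal.ofReal_le_ofReal
  gcongr

/-- Needed to pass from rational to real `s` in the conditional transform at a fixed length. -/
lemma laplaceTotal_antitoneOn (j : Fin K) (c : Channel) (y : ℝ) :
    AntitoneOn (N.laplaceTotal j c y) (Ici 0) := by
  intro s hs s' hs' hss
  unfold laplaceTotal
  refine mul_le_mul (Real.exp_le_exp.2 ?_) ?_ (Finset.prod_nonneg fun _ _ => N.laplaceI_nonneg _ _ _ _ _ _)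
    (Real.exp_pos _).le
  · nlinarith [sq_nonneg N.σ]
  · exact Finset.prod_le_prod (fun _ _ => N.laplaceI_nonneg _ _ _ _ _ _) fun q _ =>
      N.laplaceI_antitoneOn j q.1 c q.2 y hs hs' hss

lemma laplaceTotal_zero (j : Fin K) (c : Channel) (y : ℝ) : N.laplaceTotal j c y 0 = 1 := by
  simp [laplaceTotal, laplaceI, expNeg]

lemma evalPoint_pos (j : Fin K) (c : Channel) {y : ℝ} (hy : 0 < y) : 0 < N.evalPoint j c y := by
  have := N.m_pos c
  have := N.β_pos
  have := N.P_pos j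
  unfold evalPoint; positivity

/-- The set of gains for which the transmission over a main link of layer `j`, state `c` and
length `y` is successful when the interference is `t`. -/
def goodGains (j : Fin K) (c : Channel) (y : ℝ) (t : ℝ≥0∞) : Set ℝ :=
  {g | ENNReal.ofReal N.β < ENNReal.ofReal (N.P j * g * y ^ (-N.α c)) / t}

/-- For finite `t`, success means a gain above `β t / (P y ^ (-α))`, and `m` times this threshold is
`evalPoint * t`. At `t = ∞` no gain suffices, whence the indicator. -/
lemma gainLaw_goodGains (j : Fin K) (c : Channel) {y : ℝ} (hy : 0 < y) (t : ℝ≥0∞) :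
    N.gainLaw c (N.goodGains j c y t) =
      ({∞}ᶜ : Set ℝ≥0∞).indicator (fun t => ENNReal.ofReal (poissonHead (N.m c) (N.evalPoint j c y * t.toReal))) t := by
  have hβ := N.β_pos
  have hP := N.P_pos j
  have hm := N.m_pos c
  have hyα : 0 < y ^ (-N.α c) := Real.rpow_pos_of_pos hy _
  have h0 : ENNReal.ofReal N.β ≠ 0 := (ENNReal.ofReal_pos.2 hβ).ne'
  have hset : N.goodGains j c y t = {g | ENNReal.ofReal N.β * t < ENNReal.ofReal (N.P j * g * y ^ (-N.α c))} := by
    ext g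
    exact ENNReal.lt_div_iff_mul_lt (Or.inr ENNReal.ofReal_ne_top) (Or.inr h0)
  rw [hset]
  by_cases ht : t = ∞
  · subst ht
    simp [ENNReal.mul_top h0]
  · rw [indicator_of_mem (show t ∈ ({∞}ᶜ : Set ℝ≥0∞) from ht)]
    have hset2 : {g | ENNReal.ofReal N.β * t < ENNReal.ofReal (N.P j * g * y ^ (-N.α c))} =
        Ioi (N.β * t.toReal / (N.P j * y ^ (-N.α c))) := by
      ext g
      change ENNReal.ofReal N.β * t < ENNReal.ofReal (N.P j * g * y ^ (-N.α c)) ↔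
        N.β * t.toReal / (N.P j * y ^ (-N.α c)) < g
      rw [div_lt_iff₀ (by positivity), ← ENNReal.ofReal_toReal ht, ← ENNReal.ofReal_mul hβ.le,
        ENNReal.ofReal_lt_ofReal_iff_of_nonneg (by positivity), ENNReal.toReal_ofReal ENNReal.toReal_nonneg]
      rw [show N.P j * g * y ^ (-N.α c) = g * (N.P j * y ^ (-N.α c)) by ring]
    rw [hset2, gainLaw, gammaMeasure_Ioi (N.one_le_m c) (by positivity)]
    congr 2
    unfold evalPoint
    ring

/-- The lengths of the main link carry the density `mainDensity`. -/
def lengthLaw (j : Fin K) (c : Channel) : Measure ℝ :=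
  ((volume : Measure ℝ).restrict (Ioi (N.h j))).withDensity fun y => ENNReal.ofReal (N.mainDensity j c y)

lemma setLIntegral_lengthLaw (j : Fin K) (c : Channel) {B : Set ℝ} (hB : MeasurableSet B) {F : ℝ → ℝ≥0∞}
    (hF : Measurable F) :
    ∫⁻ y in B, F y ∂(N.lengthLaw j c) =
      ∫⁻ y in B ∩ Ioi (N.h j), ENNReal.ofReal (N.mainDensity j c y) * F y := by
  rw [lengthLaw, setLIntegral_withDensity_eq_setLIntegral_mul _ (N.measurable_mainDensity j c).ennreal_ofReal hF hB,
    Measure.restrict_restrict hB]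
  rfl

end Params

/-! ### Independence of the gain and conditioning on the length of the main link -/

namespace Network

variable {K : ℕ} {N : Params K} {Ω : Type*} [MeasurableSpace Ω] {μ : Measure Ω}
  (W : Network N μ)

lemma isMain_unique {p q : Node K} {ω : Ω} (hp : W.IsMain p ω) (hq : W.IsMain q ω) : p = q := by
  by_contra h
  exact lt_asymm (hp q (Ne.symm h)) (hq p h)

lemma mainSet_disjoint (j : Fin K) (c : Channel) : Pairwise (fun i i' => Disjoint (W.mainSet j c i) (W.mainSet j c i')) := by
  intro i i' hi
  rw [Set.disjoint_left]
  rintro ω ⟨h1, -⟩ ⟨h2, -⟩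
  exact hi (Prod.ext_iff.1 (W.isMain_unique h1 h2)).2

instance isFiniteMeasure_mainLaw [IsProbabilityMeasure μ] (j : Fin K) (c : Channel) :
    IsFiniteMeasure (W.mainLaw j c) := by
  refine ⟨?_⟩
  have := W.lintegral_mainLaw j c (F := fun _ => 1) measurable_const
  simp only [lintegral_one, Measure.restrict_apply_univ] at this
  rw [this, ← measure_iUnion (W.mainSet_disjoint j c) (W.measurableSet_mainSet j c)]
  exact measure_lt_top _ _

/-- The law of length and interference of the main link. -/
def mainLaw₂ (j : Fin K) (c : Channel) : Measure (ℝ × ℝ≥0∞) :=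
  (W.mainLaw j c).map fun q => (q.1, q.2.2)

/-- In the joint transform, `C` enters only through the factor `gainLaw c C`. By uniqueness of
Laplace transforms, so it does in the law of the interference restricted to length in `B` and gain
in `C`. -/
lemma mainLaw_prod [IsProbabilityMeasure μ] (j : Fin K) (c : Channel) {B C : Set ℝ} {D : Set ℝ≥0∞}
    (hB : MeasurableSet B) (hC : MeasurableSet C) (hD : MeasurableSet D) :
    W.mainLaw j c (B ×ˢ C ×ˢ D) = N.gainLaw c C * W.mainLaw j c (B ×ˢ univ ×ˢ D) := by
  have hI : Measurable fun q : ℝ × ℝ × ℝ≥0∞ => q.2.2 := by fun_prop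
  have hlap : ∀ C : Set ℝ, MeasurableSet C → ∀ s : ℝ, 0 ≤ s →
      ∫⁻ t, eneg (ENNReal.ofReal s * t) ∂(((W.mainLaw j c).restrict (B ×ˢ C ×ˢ univ)).map fun q => q.2.2) =
        N.gainLaw c C * ∫⁻ y in B ∩ Ioi (N.h j), ENNReal.ofReal (N.mainDensity j c y * N.laplaceTotal j c y s) := by
    intro C hC s hs
    rw [lintegral_map (by fun_prop) hI, ← lintegral_indicator (hB.prod (hC.prod .univ)),
      ← W.lintegral_mainLaw_eneg j c hB hC hs]
    refine lintegral_congr fun q => ?_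
    by_cases h1 : q.1 ∈ B <;> by_cases h2 : q.2.1 ∈ C <;> simp [h1, h2, indicator]
  have hfinC : N.gainLaw c C ≠ ∞ := measure_ne_top _ _
  have hsm : IsFiniteMeasure (N.gainLaw c C •
      (((W.mainLaw j c).restrict (B ×ˢ univ ×ˢ univ)).map fun q => q.2.2)) := Measure.smul_finite _ hfinC
  have heq : (((W.mainLaw j c).restrict (B ×ˢ C ×ˢ univ)).map fun q => q.2.2) =
      N.gainLaw c C • (((W.mainLaw j c).restrict (B ×ˢ univ ×ˢ univ)).map fun q => q.2.2) := by
    refine measure_eq_of_laplace fun s hs => ?_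
    rw [lintegral_smul_measure, hlap C hC s hs, hlap univ .univ s hs, measure_univ, one_mul, smul_eq_mul]
  have h := congrArg (fun m => m D) heq
  simp only [Measure.smul_apply, smul_eq_mul] at h
  rw [Measure.map_apply hI hD, Measure.map_apply hI hD, Measure.restrict_apply (hI hD),
    Measure.restrict_apply (hI hD)] at h
  have e : ∀ C : Set ℝ, (fun q : ℝ × ℝ × ℝ≥0∞ => q.2.2) ⁻¹' D ∩ B ×ˢ C ×ˢ univ = B ×ˢ C ×ˢ D := by
    intro C; ext q; simp only [mem_inter_iff, mem_preimage, mem_prod, mem_univ, and_true]; tauto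
  rwa [e, e] at h

instance isFiniteMeasure_mainLaw₂ [IsProbabilityMeasure μ] (j : Fin K) (c : Channel) :
    IsFiniteMeasure (W.mainLaw₂ j c) := by
  unfold mainLaw₂; infer_instance

/-- The gain of the main link is independent of its length and the interference. -/
lemma mainLaw_eq [IsProbabilityMeasure μ] (j : Fin K) (c : Channel) :
    W.mainLaw j c = ((W.mainLaw₂ j c).prod (N.gainLaw c)).map fun q => (q.1.1, q.2, q.1.2) := by
  have hm : Measurable fun q : (ℝ × ℝ≥0∞) × ℝ => (q.1.1, q.2, q.1.2) := by fun_prop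
  have hm2 : Measurable fun q : ℝ × ℝ × ℝ≥0∞ => (q.1, q.2.2) := by fun_prop
  refine Measure.ext_prod₃ fun {B C D} hB hC hD => ?_
  rw [W.mainLaw_prod j c hB hC hD, Measure.map_apply hm (hB.prod (hC.prod hD))]
  have e : (fun q : (ℝ × ℝ≥0∞) × ℝ => (q.1.1, q.2, q.1.2)) ⁻¹' (B ×ˢ C ×ˢ D) = (B ×ˢ D) ×ˢ C := by
    ext q; simp only [mem_preimage, mem_prod]; tauto
  rw [e, Measure.prod_prod, mainLaw₂, Measure.map_apply hm2 (hB.prod hD), mul_comm]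
  congr 2
  ext q; simp

lemma lintegral_mainLaw₂ [IsProbabilityMeasure μ] (j : Fin K) (c : Channel) {B : Set ℝ}
    (hB : MeasurableSet B) {s : ℝ} (hs : 0 ≤ s) :
    ∫⁻ q, B.indicator 1 q.1 * eneg (ENNReal.ofReal s * q.2) ∂(W.mainLaw₂ j c) =
      ∫⁻ y in B, ENNReal.ofReal (N.laplaceTotal j c y s) ∂(N.lengthLaw j c) := by
  have hB1 : Measurable (B.indicator (1 : ℝ → ℝ≥0∞)) := measurable_one.indicator hB
  have hF : Measurable fun q : ℝ × ℝ≥0∞ => B.indicator 1 q.1 * eneg (ENNReal.ofReal s * q.2) :=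
    (hB1.comp measurable_fst).mul (by fun_prop)
  rw [mainLaw₂, lintegral_map hF (by fun_prop),
    N.setLIntegral_lengthLaw j c hB (N.measurable_laplaceTotal j c s).ennreal_ofReal]
  have h := W.lintegral_mainLaw_eneg j c hB .univ hs
  rw [measure_univ, one_mul] at h
  simp only [indicator_univ, Pi.one_apply, mul_one] at h
  rw [h]
  exact lintegral_congr fun y => ENNReal.ofReal_mul (N.mainDensity_nonneg j c y)

/-- The transform at `s = 0`, where `laplaceTotal` is `1` and, as `0 * ∞ = 0`, infinite interference
counts fully. -/
lemma fst_mainLaw₂ [IsProbabilityMeasure μ] (j : Fin K) (c : Channel) :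
    (W.mainLaw₂ j c).fst = N.lengthLaw j c := by
  ext B hB
  have h := W.lintegral_mainLaw₂ j c hB (s := 0) le_rfl
  simp only [N.laplaceTotal_zero, ENNReal.ofReal_zero, zero_mul, eneg_zero, mul_one, ENNReal.ofReal_one,
    lintegral_one, Measure.restrict_apply_univ] at h
  rw [← h, Measure.fst_apply hB]
  have : ∀ q : ℝ × ℝ≥0∞, B.indicator (1 : ℝ → ℝ≥0∞) q.1 = (Prod.fst ⁻¹' B).indicator 1 q := fun q => rfl
  simp_rw [this]
  rw [lintegral_indicator_one (measurable_fst hB)]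

/-- The conditional law of the interference given the length of the main link. -/
def condInterference [IsProbabilityMeasure μ] (j : Fin K) (c : Channel) : Kernel ℝ ℝ≥0∞ :=
  (W.mainLaw₂ j c).condKernel

instance [IsProbabilityMeasure μ] (j : Fin K) (c : Channel) : IsMarkovKernel (W.condInterference j c) := by
  unfold condInterference; infer_instance

lemma setLIntegral_mainLaw₂ [IsProbabilityMeasure μ] (j : Fin K) (c : Channel) {B : Set ℝ}
    (hB : MeasurableSet B) {F : ℝ × ℝ≥0∞ → ℝ≥0∞} (hF : Measurable F) :
    ∫⁻ q, B.indicator 1 q.1 * F q ∂(W.mainLaw₂ j c) =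
      ∫⁻ y in B, ∫⁻ t, F (y, t) ∂(W.condInterference j c y) ∂(N.lengthLaw j c) := by
  have hB1 : Measurable (B.indicator (1 : ℝ → ℝ≥0∞)) := measurable_one.indicator hB
  conv_lhs => rw [← (W.mainLaw₂ j c).disintegrate (W.mainLaw₂ j c).condKernel]
  have hBF : Measurable fun q : ℝ × ℝ≥0∞ => B.indicator 1 q.1 * F q := (hB1.comp measurable_fst).mul hF
  rw [Measure.lintegral_compProd hBF, W.fst_mainLaw₂,
    ← lintegral_indicator hB]
  refine lintegral_congr fun y => ?_
  by_cases hy : y ∈ B <;> simp [hy, condInterference]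

/-- For each `s` the identity holds off a null set of lengths that may depend on `s`; restricting to
rationals gives one null set for all. -/
lemma ae_laplace_condInterference [IsProbabilityMeasure μ] (j : Fin K) (c : Channel) :
    ∀ᵐ y ∂(N.lengthLaw j c), ∀ q : ℚ, 0 < q →
      ∫⁻ t, eneg (ENNReal.ofReal q * t) ∂(W.condInterference j c y) =
        ENNReal.ofReal (N.laplaceTotal j c y q) := by
  have hfin : IsFiniteMeasure (N.lengthLaw j c) := by rw [← W.fst_mainLaw₂ j c]; infer_instance
  refine ae_all_iff.2 fun q => ?_
  by_cases hq : 0 < q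
  · have hq0 : (0 : ℝ) ≤ q := by exact_mod_cast hq.le
    have : (fun y => ∫⁻ t, eneg (ENNReal.ofReal q * t) ∂(W.condInterference j c y)) =ᵐ[N.lengthLaw j c]
        fun y => ENNReal.ofReal (N.laplaceTotal j c y q) := by
      refine ae_eq_of_forall_setLIntegral_eq_of_sigmaFinite ?_ (N.measurable_laplaceTotal j c q).ennreal_ofReal ?_
      · exact (by fun_prop : Measurable fun t => eneg (ENNReal.ofReal q * t)).lintegral_kernel
      · intro B hB _
        rw [← W.lintegral_mainLaw₂ j c hB hq0]
        exact (W.setLIntegral_mainLaw₂ j c hB (F := fun q' => eneg (ENNReal.ofReal q * q'.2)) (by fun_prop)).symm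
    filter_upwards [this] with y hy _ using hy
  · exact Eventually.of_forall fun y h => absurd h hq

/-- The conditional probability of success, given the length of the main link. -/
def condSuccess [IsProbabilityMeasure μ] (j : Fin K) (c : Channel) (y : ℝ) : ℝ≥0∞ :=
  ∫⁻ t, N.gainLaw c (N.goodGains j c y t) ∂(W.condInterference j c y)

lemma measurableSet_goodGains (N : Params K) (j : Fin K) (c : Channel) :
    MeasurableSet {q : (ℝ × ℝ≥0∞) × ℝ | q.2 ∈ N.goodGains j c q.1.1 q.1.2} := by
  have h : Measurable fun q : (ℝ × ℝ≥0∞) × ℝ => ENNReal.ofReal (N.P j * q.2 * q.1.1 ^ (-N.α c)) / q.1.2 :=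
    Measurable.div (by fun_prop) (by fun_prop)
  exact measurableSet_lt measurable_const h

lemma measurable_gainLaw_goodGains (N : Params K) (j : Fin K) (c : Channel) :
    Measurable fun q : ℝ × ℝ≥0∞ => N.gainLaw c (N.goodGains j c q.1 q.2) :=
  measurable_measure_prodMk_left (measurableSet_goodGains N j c)

lemma measurable_condSuccess [IsProbabilityMeasure μ] (j : Fin K) (c : Channel) :
    Measurable (W.condSuccess j c) :=
  Measurable.lintegral_kernel_prod_right' (measurable_gainLaw_goodGains N j c)

lemma condSuccess_le_one [IsProbabilityMeasure μ] (j : Fin K) (c : Channel) (y : ℝ) :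
    W.condSuccess j c y ≤ 1 := by
  calc W.condSuccess j c y ≤ ∫⁻ _, 1 ∂(W.condInterference j c y) := lintegral_mono fun t => prob_le_one
    _ = 1 := by simp

/-- Given interference `t`, the gain succeeds with probability `poissonHead m (s * t)` at `s =
evalPoint`; by `sum_iteratedDeriv_eq`, its mean over the conditional law of `t` is the sum of
derivatives in `condSTP`. -/
lemma ae_condSTP [IsProbabilityMeasure μ] (j : Fin K) (c : Channel) :
    ∀ᵐ y ∂(N.lengthLaw j c), N.condSTP j c y = (W.condSuccess j c y).toReal := by
  have hpos : ∀ᵐ y ∂(N.lengthLaw j c), 0 < y := by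
    refine (withDensity_absolutelyContinuous _ _).ae_le ?_
    filter_upwards [ae_restrict_mem measurableSet_Ioi] with y hy using (N.h_pos j).trans hy
  filter_upwards [W.ae_laplace_condInterference j c, hpos] with y hy hy0
  have he := N.evalPoint_pos j c hy0
  have h := sum_iteratedDeriv_eq (W.condInterference j c y) (N.laplaceTotal_nonneg j c y)
    ((N.laplaceTotal_antitoneOn j c y).mono Ioi_subset_Ici_self) hy (N.m c) he
  rw [Params.condSTP, h, condSuccess]
  simp_rw [N.gainLaw_goodGains j c hy0]
  rw [lintegral_indicator (measurableSet_singleton _).compl, integral_eq_lintegral_of_nonneg_ae]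
  · exact Eventually.of_forall fun t => poissonHead_nonneg _ (mul_nonneg he.le ENNReal.toReal_nonneg)
  · exact ((continuous_poissonHead _).measurable.comp
      (ENNReal.measurable_toReal.const_mul _)).aestronglyMeasurable

/-! ### Events about the main link -/

lemma mainEvent_eq (j : Fin K) (c : Channel) (B : Set ℝ) :
    W.mainEvent j c B = ⋃ i, (W.mainSet j c i ∩ W.dist (j, i) ⁻¹' B) := by
  ext ω
  simp only [mainEvent, mainSet, mem_iUnion, mem_inter_iff, mem_preimage]
  exact exists_congr fun i => by
    change _ ∧ _ ∧ _ ↔ (_ ∧ _) ∧ _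
    tauto

lemma measurableSet_mainEvent (j : Fin K) (c : Channel) {B : Set ℝ} (hB : MeasurableSet B) :
    MeasurableSet (W.mainEvent j c B) := by
  rw [mainEvent_eq]
  exact MeasurableSet.iUnion fun i => (W.measurableSet_mainSet j c i).inter (W.measurable_dist _ hB)

lemma lintegral_mainEvent (j : Fin K) (c : Channel) {B : Set ℝ} (hB : MeasurableSet B)
    {Φ : Ω → ℝ≥0∞} {F : ℝ × ℝ × ℝ≥0∞ → ℝ≥0∞} (hF : Measurable F)
    (h : ∀ i, ∀ ω ∈ W.mainSet j c i, Φ ω = F (W.dist (j, i) ω, W.gain (j, i) ω, W.interference (j, i) ω)) :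
    ∫⁻ ω in W.mainEvent j c B, Φ ω ∂μ = ∫⁻ q, B.indicator 1 q.1 * F q ∂(W.mainLaw j c) := by
  have hB1 : Measurable (B.indicator (1 : ℝ → ℝ≥0∞)) := measurable_one.indicator hB
  have hBF : Measurable fun q : ℝ × ℝ × ℝ≥0∞ => B.indicator 1 q.1 * F q := (hB1.comp measurable_fst).mul hF
  rw [W.lintegral_mainLaw j c hBF, mainEvent_eq, lintegral_iUnion
    (fun i => (W.measurableSet_mainSet j c i).inter (W.measurable_dist _ hB))
    (fun i i' hi => (W.mainSet_disjoint j c hi).mono inter_subset_left inter_subset_left)]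
  refine tsum_congr fun i => ?_
  rw [inter_comm, ← setLIntegral_indicator (W.measurable_dist _ hB)]
  refine setLIntegral_congr_fun (W.measurableSet_mainSet j c i) fun ω hω => ?_
  by_cases hd : W.dist (j, i) ω ∈ B
  · rw [indicator_of_mem (show ω ∈ W.dist (j, i) ⁻¹' B from hd), h i ω hω]
    simp [hd]
  · rw [indicator_of_notMem (show ω ∉ W.dist (j, i) ⁻¹' B from hd)]
    simp [hd]

/-- Integrals over the main event in terms of the length law. -/
lemma lintegral_mainEvent_eq [IsProbabilityMeasure μ] (j : Fin K) (c : Channel) {B : Set ℝ} (hB : MeasurableSet B)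
    {Φ : Ω → ℝ≥0∞} {F : ℝ × ℝ × ℝ≥0∞ → ℝ≥0∞} (hF : Measurable F)
    (h : ∀ i, ∀ ω ∈ W.mainSet j c i, Φ ω = F (W.dist (j, i) ω, W.gain (j, i) ω, W.interference (j, i) ω)) :
    ∫⁻ ω in W.mainEvent j c B, Φ ω ∂μ =
      ∫⁻ y in B, ∫⁻ t, ∫⁻ g, F (y, g, t) ∂(N.gainLaw c) ∂(W.condInterference j c y) ∂(N.lengthLaw j c) := by
  have hB1 : Measurable (B.indicator (1 : ℝ → ℝ≥0∞)) := measurable_one.indicator hB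
  have hm : Measurable fun q : (ℝ × ℝ≥0∞) × ℝ => (q.1.1, q.2, q.1.2) := by fun_prop
  have hBF : Measurable fun q : ℝ × ℝ × ℝ≥0∞ => B.indicator 1 q.1 * F q := (hB1.comp measurable_fst).mul hF
  have hFm : Measurable fun q : (ℝ × ℝ≥0∞) × ℝ => F (q.1.1, q.2, q.1.2) := hF.comp hm
  have hBFm : Measurable fun q : (ℝ × ℝ≥0∞) × ℝ => B.indicator 1 q.1.1 * F (q.1.1, q.2, q.1.2) := hBF.comp hm
  rw [W.lintegral_mainEvent j c hB hF h, W.mainLaw_eq j c, lintegral_map hBF hm,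
    lintegral_prod _ hBFm.aemeasurable]
  have e : ∀ q : ℝ × ℝ≥0∞, ∫⁻ g, B.indicator 1 q.1 * F (q.1, g, q.2) ∂(N.gainLaw c) =
      B.indicator 1 q.1 * ∫⁻ g, F (q.1, g, q.2) ∂(N.gainLaw c) := fun q =>
    lintegral_const_mul _ (hFm.comp measurable_prodMk_left)
  simp_rw [e]
  exact W.setLIntegral_mainLaw₂ j c hB (F := fun q => ∫⁻ g, F (q.1, g, q.2) ∂(N.gainLaw c))
    hFm.lintegral_prod_right'

lemma measure_mainEvent [IsProbabilityMeasure μ] (j : Fin K) (c : Channel) {B : Set ℝ} (hB : MeasurableSet B) :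
    μ (W.mainEvent j c B) = ∫⁻ y in B ∩ Ioi (N.h j), ENNReal.ofReal (N.mainDensity j c y) := by
  have h := W.lintegral_mainEvent_eq j c hB (Φ := fun _ => 1) (F := fun _ => 1) measurable_const (fun _ _ _ => rfl)
  simp only [lintegral_const, Measure.restrict_apply_univ, one_mul, measure_univ] at h
  rw [h]
  have := N.setLIntegral_lengthLaw j c hB (F := fun _ => 1) measurable_const
  simpa using this

lemma mem_success_iff {p : Node K} {ω : Ω} (h : W.IsMain p ω) :
    ω ∈ W.success ↔ ENNReal.ofReal N.β < W.sinr p ω := by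
  constructor
  · rintro ⟨q, hq, hs⟩
    rwa [W.isMain_unique h hq]
  · exact fun hs => ⟨p, h, hs⟩

lemma measurableSet_success : MeasurableSet W.success := by
  have : W.success = ⋃ p, ({ω | W.IsMain p ω} ∩ {ω | ENNReal.ofReal N.β < W.sinr p ω}) := by
    ext ω; simp [success]
  rw [this]
  refine MeasurableSet.iUnion fun p => (W.measurableSet_isMain p).inter (measurableSet_lt measurable_const ?_)
  exact (W.measurable_power p).ennreal_ofReal.div (W.measurable_interference p)

lemma measure_mainEvent_success [IsProbabilityMeasure μ] (j : Fin K) (c : Channel) {B : Set ℝ}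
    (hB : MeasurableSet B) :
    μ (W.mainEvent j c B ∩ W.success) =
      ∫⁻ y in B ∩ Ioi (N.h j), ENNReal.ofReal (N.mainDensity j c y) * W.condSuccess j c y := by
  have hS := W.measurableSet_success
  set G : Set (ℝ × ℝ × ℝ≥0∞) := {q | q.2.1 ∈ N.goodGains j c q.1 q.2.2} with hG
  have hGm : MeasurableSet G := by
    have hm : Measurable fun q : ℝ × ℝ × ℝ≥0∞ => ((q.1, q.2.2), q.2.1) := by fun_prop
    exact hm (measurableSet_goodGains N j c)
  have h := W.lintegral_mainEvent_eq j c hB (Φ := W.success.indicator 1) (F := G.indicator 1)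
    (measurable_one.indicator hGm) (fun i ω hω => by
      -- On `mainSet` the main node is known, so success is a condition on its length, gain and
      -- interference alone.
      have : ω ∈ W.success ↔ (W.dist (j, i) ω, W.gain (j, i) ω, W.interference (j, i) ω) ∈ G := by
        rw [W.mem_success_iff hω.1, sinr, power, hω.2]
        rfl
      by_cases hs : ω ∈ W.success
      · rw [indicator_of_mem hs, indicator_of_mem (this.1 hs)]; rfl
      · rw [indicator_of_notMem hs, indicator_of_notMem (this.not.1 hs)])
  rw [lintegral_indicator_one hS, Measure.restrict_apply hS, inter_comm] at h
  rw [h, ← N.setLIntegral_lengthLaw j c hB (W.measurable_condSuccess j c)]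
  refine lintegral_congr fun y => lintegral_congr fun t => ?_
  have hgm : MeasurableSet (N.goodGains j c y t) :=
    measurable_prodMk_left (x := (y, t)) (measurableSet_goodGains N j c)
  rw [← lintegral_indicator_one hgm]
  rfl

lemma mainInterference_eq {p : Node K} {ω : Ω} (h : W.IsMain p ω) :
    W.mainInterference ω = W.interference p ω := by
  refine le_antisymm (iSup₂_le fun q hq => ?_) (le_iSup₂ (f := fun p (_ : W.IsMain p ω) => W.interference p ω) p h)
  rw [W.isMain_unique h hq]

lemma measurable_mainInterference : Measurable W.mainInterference := by
  classical
  refine Measurable.iSup fun p => ?_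
  have : (fun ω => ⨆ _ : W.IsMain p ω, W.interference p ω) =
      {ω | W.IsMain p ω}.indicator (W.interference p) := by
    ext ω
    by_cases h : W.IsMain p ω
    · rw [indicator_of_mem (show ω ∈ {ω | W.IsMain p ω} from h)]; simp [h]
    · rw [indicator_of_notMem (show ω ∉ {ω | W.IsMain p ω} from h)]; simp [h]
  rw [this]
  exact (W.measurable_interference p).indicator (W.measurableSet_isMain p)

lemma lintegral_mainEvent_eneg [IsProbabilityMeasure μ] (j : Fin K) (c : Channel) {B : Set ℝ}
    (hB : MeasurableSet B) {s : ℝ} (hs : 0 ≤ s) :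
    ∫⁻ ω in W.mainEvent j c B, eneg (ENNReal.ofReal s * W.mainInterference ω) ∂μ =
      ∫⁻ y in B ∩ Ioi (N.h j), ENNReal.ofReal (N.mainDensity j c y * N.laplaceTotal j c y s) := by
  rw [W.lintegral_mainEvent j c hB (F := fun q => eneg (ENNReal.ofReal s * q.2.2)) (by fun_prop)
    (fun i ω hω => by rw [W.mainInterference_eq hω.1])]
  have h := W.lintegral_mainLaw_eneg j c hB .univ hs
  rw [measure_univ, one_mul] at h
  simpa using h

end Network

/-! ### Normalisation by the association probability -/

namespace Params

variable {K : ℕ} (N : Params K)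

lemma assocProb_eq_integral_Ioi (j : Fin K) (c : Channel) :
    N.assocProb j c = ∫ y in Ioi (N.h j), N.mainDensity j c y := by
  change ∫ y in Ioi (0 : ℝ), N.mainDensity j c y = _
  rw [← integral_Ici_eq_integral_Ioi (x := N.h j)]
  refine setIntegral_eq_of_subset_of_forall_sdiff_eq_zero measurableSet_Ioi
    (fun y hy => (N.h_pos j).trans_le hy) fun y hy => ?_
  rw [mainDensity, pdfV, if_pos (not_le.1 hy.2), zero_mul]

/-- If `assocProb` is `0`, the nonnegative `mainDensity` vanishes almost everywhere, so division by
zero does no harm. Integrability ensures that the `0` is not the default value of the integral. -/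
lemma ae_pdfY_mul_assocProb (j : Fin K) (c : Channel)
    (h : IntegrableOn (N.mainDensity j c) (Ioi (N.h j))) :
    ∀ᵐ y ∂(volume.restrict (Ioi (N.h j))), N.pdfY j c y * N.assocProb j c = N.mainDensity j c y := by
  by_cases hA : N.assocProb j c = 0
  · have h0 := hA
    rw [assocProb_eq_integral_Ioi,
      integral_eq_zero_iff_of_nonneg (fun y => N.mainDensity_nonneg j c y) h] at h0
    filter_upwards [h0] with y hy
    rw [hA, mul_zero, hy]; rfl
  · refine Eventually.of_forall fun y => ?_
    rw [pdfY, mainDensity]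
    field_simp

end Params

namespace Network

variable {K : ℕ} {N : Params K} {Ω : Type*} [MeasurableSpace Ω] {μ : Measure Ω}
  (W : Network N μ)


/-- The integral is the probability of an event, so no estimate of the density is needed. -/
lemma integrableOn_mainDensity [IsProbabilityMeasure μ] (W : Network N μ) (j : Fin K) (c : Channel) :
    IntegrableOn (N.mainDensity j c) (Ioi (N.h j)) := by
  refine ⟨(N.measurable_mainDensity j c).aestronglyMeasurable, ?_⟩
  rw [hasFiniteIntegral_iff_ofReal (Eventually.of_forall fun y => N.mainDensity_nonneg j c y)]
  have h := W.measure_mainEvent j c .univ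
  rw [univ_inter] at h
  rw [← h]
  exact measure_lt_top _ _

lemma ae_condSTP_mul [IsProbabilityMeasure μ] (j : Fin K) (c : Channel) :
    ∀ᵐ y ∂(volume.restrict (Ioi (N.h j))), N.condSTP j c y * N.pdfY j c y * N.assocProb j c =
      N.mainDensity j c y * (W.condSuccess j c y).toReal := by
  have h := W.ae_condSTP j c
  rw [Params.lengthLaw, ae_withDensity_iff (N.measurable_mainDensity j c).ennreal_ofReal] at h
  filter_upwards [h, N.ae_pdfY_mul_assocProb j c (W.integrableOn_mainDensity j c)] with y h1 h2
  rw [mul_assoc, h2]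
  -- Where the density vanishes nothing is known about `condSTP`, but both sides are zero.
  by_cases h0 : N.mainDensity j c y = 0
  · rw [h0, mul_zero, zero_mul]
  · have hpos := (N.mainDensity_nonneg j c y).lt_of_ne' h0
    rw [h1 (ENNReal.ofReal_pos.2 hpos).ne', mul_comm]

lemma measurable_mainDensity_mul_condSuccess [IsProbabilityMeasure μ] (j : Fin K) (c : Channel) :
    Measurable fun y => N.mainDensity j c y * (W.condSuccess j c y).toReal :=
  (N.measurable_mainDensity j c).mul (W.measurable_condSuccess j c).ennreal_toReal

lemma integrableOn_condSTP_mul [IsProbabilityMeasure μ] (W : Network N μ) (j : Fin K) (c : Channel) :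
    IntegrableOn (fun y => N.condSTP j c y * N.pdfY j c y * N.assocProb j c) (Ioi (N.h j)) := by
  refine Integrable.congr ?_ (EventuallyEq.symm (W.ae_condSTP_mul j c))
  refine Integrable.mono (W.integrableOn_mainDensity j c)
    (W.measurable_mainDensity_mul_condSuccess j c).aestronglyMeasurable (Eventually.of_forall fun y => ?_)
  rw [norm_mul]
  refine mul_le_of_le_one_right (norm_nonneg _) ?_
  rw [Real.norm_of_nonneg ENNReal.toReal_nonneg]
  exact ENNReal.toReal_le_of_le_ofReal zero_le_one (by simpa using W.condSuccess_le_one j c y)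

lemma real_mainEvent [IsProbabilityMeasure μ] (j : Fin K) (c : Channel) {B : Set ℝ} (hB : MeasurableSet B) :
    μ.real (W.mainEvent j c B) = ∫ y in B ∩ Ioi (N.h j), N.mainDensity j c y := by
  rw [integral_eq_lintegral_of_nonneg_ae (Eventually.of_forall fun y => N.mainDensity_nonneg j c y)
    (N.measurable_mainDensity j c).aestronglyMeasurable, ← W.measure_mainEvent j c hB]
  rfl

lemma real_mainEvent_success [IsProbabilityMeasure μ] (j : Fin K) (c : Channel) {B : Set ℝ}
    (hB : MeasurableSet B) :
    μ.real (W.mainEvent j c B ∩ W.success) =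
      ∫ y in B ∩ Ioi (N.h j), N.condSTP j c y * N.pdfY j c y * N.assocProb j c := by
  rw [integral_congr_ae (ae_restrict_of_ae_restrict_of_subset inter_subset_right (W.ae_condSTP_mul j c)),
    integral_eq_lintegral_of_nonneg_ae
      (Eventually.of_forall fun y => mul_nonneg (N.mainDensity_nonneg j c y) ENNReal.toReal_nonneg)
      (W.measurable_mainDensity_mul_condSuccess j c).aestronglyMeasurable,
    measureReal_def, W.measure_mainEvent_success j c hB]
  congr 1
  refine lintegral_congr fun y => ?_
  rw [ENNReal.ofReal_mul (N.mainDensity_nonneg j c y),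
    ENNReal.ofReal_toReal ((W.condSuccess_le_one j c y).trans_lt ENNReal.one_lt_top).ne]

lemma integral_mainEvent_expNeg [IsProbabilityMeasure μ] (j : Fin K) (c : Channel) {B : Set ℝ}
    (hB : MeasurableSet B) {s : ℝ} (hs : 0 ≤ s) :
    ∫ ω in W.mainEvent j c B, expNeg (ENNReal.ofReal s * W.mainInterference ω) ∂μ =
      ∫ y in B ∩ Ioi (N.h j), N.laplaceTotal j c y s * N.pdfY j c y * N.assocProb j c := by
  have hI := W.measurable_mainInterference
  have h : (fun y => N.laplaceTotal j c y s * N.pdfY j c y * N.assocProb j c)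
      =ᵐ[volume.restrict (B ∩ Ioi (N.h j))] fun y => N.mainDensity j c y * N.laplaceTotal j c y s := by
    filter_upwards [ae_restrict_of_ae_restrict_of_subset (s := B ∩ Ioi (N.h j)) inter_subset_right
      (N.ae_pdfY_mul_assocProb j c (W.integrableOn_mainDensity j c))] with y hy
    rw [mul_assoc, hy, mul_comm]
  simp_rw [← toReal_eneg]
  rw [integral_congr_ae h, integral_toReal (by fun_prop)
      (Eventually.of_forall fun ω => (eneg_ne_top _).lt_top), W.lintegral_mainEvent_eneg j c hB hs,
    integral_eq_lintegral_of_nonneg_ae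
      (Eventually.of_forall fun y => mul_nonneg (N.mainDensity_nonneg j c y) (N.laplaceTotal_nonneg j c y s))
      ((N.measurable_mainDensity j c).mul (N.measurable_laplaceTotal j c s)).aestronglyMeasurable]

/-- Success includes the existence of a main link, and this is unique, so the main events split it
disjointly. Almost sure existence plays no role. -/
lemma real_success [IsProbabilityMeasure μ] :
    μ.real W.success = ∑ j, ∑ c, μ.real (W.mainEvent j c univ ∩ W.success) := by
  have hU : W.success = ⋃ q ∈ (Finset.univ : Finset (Fin K × Channel)),
      (W.mainEvent q.1 q.2 univ ∩ W.success) := by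
    ext ω
    simp only [Finset.mem_univ, iUnion_true, mem_iUnion, mem_inter_iff]
    refine ⟨fun h => ?_, fun ⟨_, h⟩ => h.2⟩
    obtain ⟨⟨j, i⟩, hp, -⟩ := id h
    exact ⟨(j, W.chan (j, i) ω), ⟨i, hp, rfl, mem_univ _⟩, h⟩
  conv_lhs => rw [hU]
  rw [measureReal_biUnion_finset, Fintype.sum_prod_type]
  · rintro ⟨j, c⟩ - ⟨j', c'⟩ - hne
    refine Set.disjoint_left.2 ?_
    rintro ω ⟨⟨i, hp, hc, -⟩, -⟩ ⟨⟨i', hp', hc', -⟩, -⟩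
    obtain ⟨rfl, rfl⟩ := Prod.ext_iff.1 (W.isMain_unique hp hp')
    exact hne (Prod.ext rfl (hc.symm.trans hc'))
  · exact fun q _ => (W.measurableSet_mainEvent _ _ .univ).inter W.measurableSet_success

end Network

end AerialNetwork

end

theorem lemma3 {K : ℕ} (N : AerialNetwork.Params K)
    {Ω : Type*} [MeasurableSpace Ω] (μ : Measure Ω) [IsProbabilityMeasure μ]
    (W : AerialNetwork.Network N μ) :
    -- the successful transmission probability
    ((∀ j c, IntegrableOn (fun y => N.condSTP j c y * N.pdfY j c y * N.assocProb j c)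
        (Set.Ioi (N.h j))) ∧
      μ.real W.success = ∑ j : Fin K, ∑ c : AerialNetwork.Channel,
        ∫ y in Set.Ioi (N.h j), N.condSTP j c y * N.pdfY j c y * N.assocProb j c) ∧
    ∀ (j : Fin K) (c : AerialNetwork.Channel) (B : Set ℝ), MeasurableSet B →
      -- association probability and density of the main link distance
      μ.real (W.mainEvent j c Set.univ) = N.assocProb j c ∧
      μ.real (W.mainEvent j c B) =
        ∫ y in B ∩ Set.Ioi (N.h j), N.pdfY j c y * N.assocProb j c ∧
      -- conditional success probability, given the layer, state and length of the main link
      μ.real (W.mainEvent j c B ∩ W.success) =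
        ∫ y in B ∩ Set.Ioi (N.h j), N.condSTP j c y * N.pdfY j c y * N.assocProb j c ∧
      -- conditional Laplace transform of interference plus noise
      ∀ s : ℝ, 0 ≤ s →
        ∫ ω in W.mainEvent j c B,
            AerialNetwork.expNeg (ENNReal.ofReal s * W.mainInterference ω) ∂μ =
          ∫ y in B ∩ Set.Ioi (N.h j),
            N.laplaceTotal j c y s * N.pdfY j c y * N.assocProb j c := by
  refine ⟨⟨W.integrableOn_condSTP_mul, ?_⟩, fun j c B hB => ⟨?_, ?_, ?_, fun s hs => ?_⟩⟩
  · rw [W.real_success]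
    refine Finset.sum_congr rfl fun j _ => Finset.sum_congr rfl fun c _ => ?_
    rw [W.real_mainEvent_success j c .univ, Set.univ_inter]
  · rw [W.real_mainEvent j c .univ, Set.univ_inter, N.assocProb_eq_integral_Ioi]
  · rw [W.real_mainEvent j c hB]
    exact (integral_congr_ae (ae_restrict_of_ae_restrict_of_subset Set.inter_subset_right
      (N.ae_pdfY_mul_assocProb j c (W.integrableOn_mainDensity j c)))).symm
  · exact W.real_mainEvent_success j c hB
  · exact W.integral_mainEvent_expNeg j c hB hs
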